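/- Let $n\ge 1$ and fix an index $\ell$, $x=x_\ell$. Consider Pfaffian systems $du=\Omega u$ on $\mathbb{C}^n$ with $$\Omega=\sum_{i=1}^n S_{x_i}\,dx_i+\sum_{H\in\mathcal A}A_H\,d\log f_H,\qquad S_{x_i}=A_{x_i}+\sum_{j\ne i}A_{x_ix_j}x_j,$$ where $\mathcal A$ is a finite set of affine hyperplanes $H=\{f_H=0\}$, the $A_{x_i}$, $A_{x_ix_j}=A_{x_jx_i}$ and $A_H\neq 0$ are constant $N\times N$ complex matrices ($N\ge1$), and $\Omega\wedge\Omega=0$. Let $\mathcal A_{x_i}$ be the set of $H\in\mathcal A$ whose polynomial $f_H$ depends on $x_i$, and for $H\in\mathcal A_x$ write $f_H=(f_H)_x\,(x-a_H)$. Assume * $A_x$ and all $A_{xx_j}$ ($j\ne\ell$) are diagonalizable; * if $\mathcal A_x\cap\mathcal A_{x_j}\neq\emptyset$ for some $j\neq\ell$, then $A_{xx_j}=0$ for all $j\ne\ell$. Then $A_x$ and the $A_{xx_j}$ commute. Let $\hat H_k=\{x=\alpha_k\}$ be the distinct components of $\det(x-S_x)=0$, the $\alpha_k$ being the (affine-linear)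 eigenvalues of $S_x$, and let $E_k$ be the projection onto the common eigenspace for $\alpha_k$ along the others. For $\varepsilon=\pm1$ let $\mathcal L^{\varepsilon x}(\Omega)$ be the form with values in $\mathrm{End}\bigl((\mathbb C^N)^{\mathcal A_x}\bigr)$ that sends $(v_H)_{H\in\mathcal A_x}$ to the vector with $H$-component $$\begin{aligned}&-\varepsilon a_H v_H\,dx+\sum_{y\neq x}\Bigl(A_y+\sum_{z\ne x,y}A_{yz}z+a_HA_{yx}+(a_H)_y(A_x-\varepsilon x)\Bigr)v_H\,dy+\sum_{K\in\mathcal A\setminus\mathcal A_x}A_Kv_H\,d\log f_K\\&+\sum_{H'}A_{H'}(v_H-v_{H'})\,d\log(a_H-a_{H'})-\sum_k d\log(x-\varepsilon\alpha_k)\,E_k\sum_{H'\in\mathcal A_x}A_{H'}v_{H'},\end{aligned}$$ where $y,z$ run over the variables and $H'$ in the first sum of the second line runs over the $H'\in\mathcal A_x$ with $a_H-a_{H'}$ non-constant. This form preserves $\mathcal K^x=\bigoplus_{H\in\mathcal A_x}\ker A_H$; the middle Laplace transform $\mathcal{ML}^{x}(\Omega)$ ($\varepsilon=1$) and the inverse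 middle Laplace transform $\mathcal{ML}^{-x}(\Omega)$ ($\varepsilon=-1$) are the forms that it induces on $(\mathbb C^N)^{\mathcal A_x}/\mathcal K^x$. Call $\Omega$ irreducible in the $x$-direction if $0$ and $\mathbb C^N$ are the only subspaces invariant under $A_x$, all $A_{xx_j}$ and all $A_H$ with $H\in\mathcal A_x$. Write $\Omega'\sim\Omega$ if $\Omega'=P^{-1}\Omega P$ for a constant invertible $P$. **Theorem.** Let $\Omega$ be as above, irreducible in the $x$-direction, with $\mathcal A_x\neq\emptyset$. Then $\mathcal{ML}^{x}(\Omega)$ and $\mathcal{ML}^{-x}(\Omega)$ are well defined and satisfy the same assumptions, and 1. $\mathcal{ML}^{-x}\circ\mathcal{ML}^{x}(\Omega)\sim\Omega$ and $\mathcal{ML}^{x}\circ\mathcal{ML}^{-x}(\Omega)\sim\Omega$; 2. $\mathcal{ML}^{x}(\Omega)$ and $\mathcal{ML}^{-x}(\Omega)$ are irreducible in the $x$-direction. Moreover, for non-empty finite sets $\mathcal T,\mathcal S$ of hyperplanes depending on $x$, let $\mathfrak M^{irr}_{\mathcal T,\mathcal S}$ be the set of $\sim$-classes of such irreducible $\Omega$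 (of any size $N\ge1$) with $\mathcal A_x=\mathcal T$ and $\{\hat H_k\}=\mathcal S$, and let $-\mathcal T$ be the image of $\mathcal T$ under $x\mapsto -x$. Then $\mathcal{ML}^{x}$ and $\mathcal{ML}^{-x}$ induce bijections $\mathfrak M^{irr}_{\mathcal T,\mathcal S}\to\mathfrak M^{irr}_{\mathcal S,-\mathcal T}$ and $\mathfrak M^{irr}_{\mathcal T,\mathcal S}\to\mathfrak M^{irr}_{-\mathcal S,\mathcal T}$. -/

import Mathlib

/-- An affine hyperplane of `ℂⁿ`. -/
@[ext]
structure Hyperplane (n : ℕ) where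
  carrier : Set (Fin n → ℂ)
  exists_eq : ∃ (c : Fin n → ℂ) (d : ℂ), c ≠ 0 ∧ carrier = {x | ∑ i, c i * x i + d = 0}

namespace Hyperplane

variable {n : ℕ}

/-- The partial derivatives `(f_H)_{x_i}` of a defining linear polynomial `f_H` of `H`. -/
noncomputable def coeff (H : Hyperplane n) : Fin n → ℂ := H.exists_eq.choose

/-- The constant term of the same defining polynomial `f_H`. -/
noncomputable def const (H : Hyperplane n) : ℂ := H.exists_eq.choose_spec.choose

/-- The defining polynomial `f_H`, evaluated at a point. It is unique up to a nonzero factor; only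
ratios such as `(f_H)_{x_i} / f_H` are used below, and these do not depend on the choice. -/
noncomputable def poly (H : Hyperplane n) (x : Fin n → ℂ) : ℂ := ∑ i, H.coeff i * x i + H.const

theorem coeff_ne_zero (H : Hyperplane n) : H.coeff ≠ 0 :=
  H.exists_eq.choose_spec.choose_spec.1

theorem mem_iff (H : Hyperplane n) (x : Fin n → ℂ) : x ∈ H.carrier ↔ H.poly x = 0 := by
  have h := H.exists_eq.choose_spec.choose_spec.2
  exact Set.ext_iff.1 h x

/-- `(f_H)_{x_i} ≠ 0`. -/
def DependsOn (H : Hyperplane n) (i : Fin n) : Prop := H.coeff i ≠ 0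

/-- For `H` depending on `x_ℓ`, the linear polynomial `a_H` in the variables other than `x_ℓ` with
`f_H = (f_H)_{x_ℓ} (x_ℓ - a_H)`, evaluated at a point. -/
noncomputable def root (ℓ : Fin n) (H : Hyperplane n) (x : Fin n → ℂ) : ℂ :=
  x ℓ - H.poly x / H.coeff ℓ

/-- The derivative `(a_H)_{x_j}`, for `j ≠ ℓ`. -/
noncomputable def slope (ℓ : Fin n) (H : Hyperplane n) (j : Fin n) : ℂ :=
  -(H.coeff j / H.coeff ℓ)

/-- The image of `H` under `x_ℓ ↦ ε x_ℓ`, `ε = ±1`. For `ε = -1` and `H = {x_ℓ = a_H}` this is the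
hyperplane `σ(H) = {x_ℓ = -a_H}`; for `ε = 1` it is `H`. -/
def flip (ℓ : Fin n) (ε : ℤˣ) (H : Hyperplane n) : Hyperplane n where
  carrier := {x | Function.update x ℓ (((ε : ℤ) : ℂ) * x ℓ) ∈ H.carrier}
  exists_eq := by
    have hε : ((ε : ℤ) : ℂ) ≠ 0 := by
      exact_mod_cast ε.ne_zero
    refine ⟨fun i => if i = ℓ then ((ε : ℤ) : ℂ) * H.coeff i else H.coeff i, H.const, ?_, ?_⟩
    · intro h
      apply H.coeff_ne_zero
      funext i
      have hi := congrFun h i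
      by_cases hl : i = ℓ
      · simp only [hl, if_true, Pi.zero_apply, mul_eq_zero, hε, false_or] at hi ⊢
        exact hi
      · simpa [hl] using hi
    · ext x
      rw [Set.mem_ofPred_eq, mem_iff, Set.mem_ofPred_eq, poly]
      have : ∀ i, H.coeff i * Function.update x ℓ (((ε : ℤ) : ℂ) * x ℓ) i =
          (if i = ℓ then ((ε : ℤ) : ℂ) * H.coeff i else H.coeff i) * x i := by
        intro i
        by_cases hl : i = ℓ
        · subst hl; simp; ring
        · simp [hl]
      simp only [this]

theorem root_eq_sum (ℓ : Fin n) (H : Hyperplane n) (hH : H.DependsOn ℓ) (x : Fin n → ℂ) :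
    H.root ℓ x = H.root ℓ 0 + ∑ j, (if j = ℓ then 0 else H.slope ℓ j * x j) := by
  have h0 : H.coeff ℓ ≠ 0 := hH
  have hs : ∑ j, H.coeff j * x j =
      H.coeff ℓ * x ℓ + ∑ j, (if j = ℓ then 0 else H.coeff j * x j) := by
    rw [← Finset.add_sum_erase _ _ (Finset.mem_univ ℓ), ← Finset.add_sum_erase _
      (fun j => if j = ℓ then (0 : ℂ) else H.coeff j * x j) (Finset.mem_univ ℓ)]
    simp only [if_true, zero_add]
    congr 1
    exact Finset.sum_congr rfl fun j hj => by simp [(Finset.mem_erase.1 hj).1]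
  have hs' : ∑ j, (if j = ℓ then 0 else H.slope ℓ j * x j) =
      -(∑ j, (if j = ℓ then 0 else H.coeff j * x j)) / H.coeff ℓ := by
    rw [← Finset.sum_neg_distrib, Finset.sum_div]
    refine Finset.sum_congr rfl fun j _ => ?_
    by_cases hj : j = ℓ
    · simp [hj]
    · simp only [hj, if_false, slope]; ring
  rw [hs', root, root, poly, poly, hs]
  field_simp
  simp
  ring

theorem mem_iff_root (ℓ : Fin n) (H : Hyperplane n) (hH : H.DependsOn ℓ) (x : Fin n → ℂ) :
    x ∈ H.carrier ↔ x ℓ = H.root ℓ x := by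
  have h0 : H.coeff ℓ ≠ 0 := hH
  rw [mem_iff, root]
  constructor
  · intro h; simp [h]
  · intro h
    have : H.poly x / H.coeff ℓ = 0 := by linear_combination h
    simpa [h0] using this

theorem root_update (ℓ : Fin n) (H : Hyperplane n) (hH : H.DependsOn ℓ) (x : Fin n → ℂ) (t : ℂ) :
    H.root ℓ (Function.update x ℓ t) = H.root ℓ x := by
  rw [root_eq_sum ℓ H hH, root_eq_sum ℓ H hH x]
  congr 1
  refine Finset.sum_congr rfl fun j _ => ?_
  by_cases hj : j = ℓ <;> simp [hj]

end Hyperplane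

/-- A matrix 1-form
`Ω = ∑ᵢ (A_{x_i} + ∑_{j ≠ i} A_{x_i x_j} x_j) dx_i + ∑_H A_H d log f_H`,
with `A_{x_i x_j} = A_{x_j x_i}` and coefficients in `End(V)` (matrices, for `V = ℂᴺ`). The
arrangement is the finite set of the `H` with `A_H ≠ 0`. The coefficients are determined by the
form. -/
structure PfaffianForm (n : ℕ) (V : Type*) [AddCommGroup V] [Module ℂ V] where
  /-- `A_{x_i}` -/
  cst : Fin n → Module.End ℂ V
  /-- `A_{x_i x_j}` for `i ≠ j` -/
  lin : Fin n → Fin n → Module.End ℂ V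
  lin_self : ∀ i, lin i i = 0
  lin_symm : ∀ i j, lin i j = lin j i
  /-- `A_H` -/
  res : Hyperplane n →₀ Module.End ℂ V

/-- Diagonalizability of an endomorphism. -/
def IsDiagonalizable {V : Type*} [AddCommGroup V] [Module ℂ V] (f : Module.End ℂ V) : Prop :=
  ⨆ μ : ℂ, Module.End.eigenspace f μ = ⊤

/-- The endomorphism of `V ⧸ K` induced by an endomorphism `f` that preserves `K`
(by convention `0` if `f` does not preserve `K`). -/
noncomputable def inducedEnd {V : Type*} [AddCommGroup V] [Module ℂ V] (K : Submodule ℂ V)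
    (f : Module.End ℂ V) : Module.End ℂ (V ⧸ K) :=
  open scoped Classical in if h : K ≤ K.comap f then K.mapQ K f h else 0

theorem inducedEnd_zero {V : Type*} [AddCommGroup V] [Module ℂ V] (K : Submodule ℂ V) :
    inducedEnd K 0 = 0 := by
  unfold inducedEnd
  split_ifs with h
  · ext x; simp
  · rfl

/-- The block diagonal endomorphism of `V^ι` with diagonal blocks `f i`. -/
def blockDiag {ι V : Type*} [AddCommGroup V] [Module ℂ V] (f : ι → Module.End ℂ V) :
    Module.End ℂ (ι → V) :=
  LinearMap.pi fun i => f i ∘ₗ LinearMap.proj i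

namespace PfaffianForm

section Basic

variable {n : ℕ} {V : Type*} [AddCommGroup V] [Module ℂ V]

/-- `S_{x_i}(x) = A_{x_i} + ∑_{j ≠ i} A_{x_i x_j} x_j`. -/
noncomputable def S (Ω : PfaffianForm n V) (i : Fin n) (x : Fin n → ℂ) : Module.End ℂ V :=
  Ω.cst i + ∑ j, x j • Ω.lin i j

/-- The coefficient of `dx_i` in `Ω`, at a point outside the arrangement. -/
noncomputable def coeffAt (Ω : PfaffianForm n V) (i : Fin n) (x : Fin n → ℂ) : Module.End ℂ V :=
  Ω.S i x + Ω.res.sum fun H A => (H.coeff i / H.poly x) • A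

/-- `Ω ∧ Ω = 0`. -/
def Integrable (Ω : PfaffianForm n V) : Prop :=
  ∀ x : Fin n → ℂ, (∀ H ∈ Ω.res.support, x ∉ H.carrier) →
    ∀ i j, Commute (Ω.coeffAt i x) (Ω.coeffAt j x)

open scoped Classical in
/-- The hyperplanes of the arrangement that depend on `x_ℓ`. -/
noncomputable def polar (ℓ : Fin n) (Ω : PfaffianForm n V) : Finset (Hyperplane n) :=
  Ω.res.support.filter fun H => H.DependsOn ℓ

/-- The standing assumptions on a system in the direction `x_ℓ`: complete integrability;
diagonalizability of `A_{x_ℓ}` and the `A_{x_ℓ x_j}`; and `A_{x_ℓ x_j} = 0` for all `j` as soon as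
some hyperplane of the arrangement depends on `x_ℓ` and on another variable. -/
structure Admissible (ℓ : Fin n) (Ω : PfaffianForm n V) : Prop where
  integrable : Ω.Integrable
  diag_cst : IsDiagonalizable (Ω.cst ℓ)
  diag_lin : ∀ j, j ≠ ℓ → IsDiagonalizable (Ω.lin ℓ j)
  inf : (∃ j, j ≠ ℓ ∧ ∃ H ∈ Ω.polar ℓ, H.DependsOn j) → ∀ j, j ≠ ℓ → Ω.lin ℓ j = 0

/-- Irreducibility in the direction `x_ℓ`: no subspace other than `0` and `V` is invariant under
`A_{x_ℓ}`, the `A_{x_ℓ x_j}`, and the `A_H` with `H` depending on `x_ℓ`. -/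
def Irreducible (ℓ : Fin n) (Ω : PfaffianForm n V) : Prop :=
  ∀ W : Submodule ℂ V, W ≤ W.comap (Ω.cst ℓ) → (∀ j, j ≠ ℓ → W ≤ W.comap (Ω.lin ℓ j)) →
    (∀ H ∈ Ω.polar ℓ, W ≤ W.comap (Ω.res H)) → W = ⊥ ∨ W = ⊤

/-- The components of the hypersurface `det (x_ℓ - S_{x_ℓ}(x)) = 0`. -/
def charArr (ℓ : Fin n) (Ω : PfaffianForm n V) : Set (Hyperplane n) :=
  {H | ∀ x ∈ H.carrier, LinearMap.det (x ℓ • (1 : Module.End ℂ V) - Ω.S ℓ x) = 0}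

/-- The common eigenspace of `S_{x_ℓ}(x)` for the eigenvalue `a_H(x)`: for `x` in `H` we have
`x_ℓ = a_H(x)`, and neither `a_H` nor `S_{x_ℓ}` depends on `x_ℓ`. -/
def eig (ℓ : Fin n) (Ω : PfaffianForm n V) (H : Hyperplane n) : Submodule ℂ V where
  carrier := {v | ∀ x ∈ H.carrier, Ω.S ℓ x v = x ℓ • v}
  add_mem' := by
    intro v w hv hw x hx
    rw [map_add, hv x hx, hw x hx, smul_add]
  zero_mem' := by intro x _; simp
  smul_mem' := by
    intro c v hv x hx
    rw [map_smul, hv x hx, smul_comm]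

open scoped Classical in
/-- The projection `E_H` onto the common eigenspace of `H` along the other common eigenspaces
(these are complementary when `A_{x_ℓ}` and the `A_{x_ℓ x_j}` are simultaneously
diagonalizable). -/
noncomputable def eigProj (ℓ : Fin n) (Ω : PfaffianForm n V) (H : Hyperplane n) :
    Module.End ℂ V :=
  if h : IsCompl (Ω.eig ℓ H) (⨆ H' : {H' // H' ≠ H}, Ω.eig ℓ H'.1) then
    Submodule.projection (Ω.eig ℓ H) (⨆ H' : {H' // H' ≠ H}, Ω.eig ℓ H'.1) h
  else 0

theorem eigProj_eq_zero (ℓ : Fin n) (Ω : PfaffianForm n V) (H : Hyperplane n)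
    (hH : Ω.eig ℓ H = ⊥) : Ω.eigProj ℓ H = 0 := by
  unfold eigProj
  split_ifs with h
  · ext v
    have := Submodule.projection_apply_mem h v
    exact (Submodule.mem_bot ℂ).1 (hH.le this)
  · rfl

theorem S_update (ℓ : Fin n) (Ω : PfaffianForm n V) (x : Fin n → ℂ) (t : ℂ) :
    Ω.S ℓ (Function.update x ℓ t) = Ω.S ℓ x := by
  unfold S
  congr 1
  refine Finset.sum_congr rfl fun j _ => ?_
  by_cases hj : j = ℓ
  · subst hj; simp [Ω.lin_self]
  · simp [hj]

theorem eig_apply (ℓ : Fin n) (Ω : PfaffianForm n V) (H : Hyperplane n) (hH : H.DependsOn ℓ)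
    {v : V} (hv : v ∈ Ω.eig ℓ H) (x : Fin n → ℂ) : Ω.S ℓ x v = H.root ℓ x • v := by
  have hmem : Function.update x ℓ (H.root ℓ x) ∈ H.carrier := by
    rw [H.mem_iff_root ℓ hH, H.root_update ℓ hH]; simp
  have := hv _ hmem
  rwa [S_update, Function.update_self] at this

theorem dependsOn_of_eig (ℓ : Fin n) (Ω : PfaffianForm n V) (H : Hyperplane n)
    (hne : Ω.eig ℓ H ≠ ⊥) : H.DependsOn ℓ := by
  by_contra hH
  have h0 : H.coeff ℓ = 0 := not_not.1 hH
  obtain ⟨v, hv, hv0⟩ := (Submodule.ne_bot_iff _).1 hne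
  obtain ⟨i, hi⟩ := Function.ne_iff.1 H.coeff_ne_zero
  have hi : H.coeff i ≠ 0 := hi
  have hil : i ≠ ℓ := fun h => hi (h ▸ h0)
  have hmem : ∀ t : ℂ,
      Function.update (Pi.single i (-H.const / H.coeff i) : Fin n → ℂ) ℓ t ∈ H.carrier := by
    intro t
    rw [H.mem_iff, Hyperplane.poly, Finset.sum_eq_single i]
    · rw [Function.update_of_ne hil, Pi.single_eq_same]
      field_simp
      ring
    · intro j _ hj
      by_cases hjl : j = ℓ
      · simp [hjl, h0]
      · simp [hjl, hj]
    · simp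
  have h1 := hv _ (hmem 0)
  have h2 := hv _ (hmem 1)
  rw [S_update, Function.update_self] at h1 h2
  rw [h1] at h2
  simp only [zero_smul, one_smul] at h2
  exact hv0 h2.symm

theorem eig_finite [FiniteDimensional ℂ V] (ℓ : Fin n) (Ω : PfaffianForm n V) :
    {H : Hyperplane n | Ω.eig ℓ H ≠ ⊥}.Finite := by
  have hfin : (Set.univ.pi fun j : Fin n =>
      {μ : ℂ | Module.End.HasEigenvalue (Ω.S ℓ (Pi.single j 1)) μ}).Finite :=
    Set.Finite.pi fun j => Module.End.finite_hasEigenvalue _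
  have hfin0 := (Module.End.finite_hasEigenvalue (Ω.S ℓ 0)).prod hfin
  refine Set.Finite.of_finite_image
    (f := fun H : Hyperplane n => (H.root ℓ 0, fun j => H.root ℓ (Pi.single j 1)))
    (hfin0.subset ?_) ?_
  · rintro _ ⟨H, hH, rfl⟩
    have hd := Ω.dependsOn_of_eig ℓ H hH
    obtain ⟨v, hv, hv0⟩ := (Submodule.ne_bot_iff _).1 hH
    have key : ∀ x, Module.End.HasEigenvalue (Ω.S ℓ x) (H.root ℓ x) := fun x =>
      Module.End.hasEigenvalue_of_hasEigenvector
        (Module.End.hasEigenvector_iff.2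
          ⟨Module.End.mem_eigenspace_iff.2 (Ω.eig_apply ℓ H hd hv x), hv0⟩)
    exact ⟨key 0, fun j _ => key _⟩
  · intro H hH H' hH' heq
    have hd := Ω.dependsOn_of_eig ℓ H hH
    have hd' := Ω.dependsOn_of_eig ℓ H' hH'
    simp only [Prod.mk.injEq] at heq
    have hr : ∀ (K : Hyperplane n), K.DependsOn ℓ → ∀ j, j ≠ ℓ →
        K.root ℓ (Pi.single j 1) = K.root ℓ 0 + K.slope ℓ j := by
      intro K hK j hj
      rw [K.root_eq_sum ℓ hK, Finset.sum_eq_single j]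
      · simp [hj]
      · intro i _ hi; simp [hi]
      · simp
    have hroot : ∀ x, H.root ℓ x = H'.root ℓ x := by
      intro x
      rw [H.root_eq_sum ℓ hd, H'.root_eq_sum ℓ hd', heq.1]
      congr 1
      refine Finset.sum_congr rfl fun j _ => ?_
      by_cases hj : j = ℓ
      · simp [hj]
      · have := congrFun heq.2 j
        simp only [hr H hd j hj, hr H' hd' j hj, heq.1, add_right_inj] at this
        simp [hj, this]
    ext x
    rw [H.mem_iff_root ℓ hd, H'.mem_iff_root ℓ hd', hroot x]

open scoped Classical in
/-- The coefficient at `d log f_K` of the Laplace transform (`ε = 1`) or of the inverse Laplace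
transform (`ε = -1`) of `Ω`, as an endomorphism of `V^q`, where the blocks are indexed by the
hyperplanes `H` of the arrangement that depend on `x_ℓ`.

If `K` depends on `x_ℓ`, that is, `K = {x_ℓ = ε a}`, then all block rows are
`-(E A_{H_1}, …, E A_{H_q})`, with `E` the projection onto the eigenspace of `S_{x_ℓ}` for the
eigenvalue `a`.

Otherwise the block `H` of the image of `(v_H)_H` is
`A_K v_H + ∑ A_{H'} (v_H - v_{H'})`, the sum being over all `H'` such that `K` is the hyperplane
`a_H = a_{H'}`. -/
noncomputable def laplaceRes (ℓ : Fin n) (ε : ℤˣ) (Ω : PfaffianForm n V) (K : Hyperplane n) :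
    Module.End ℂ (Ω.polar ℓ → V) :=
  if K.DependsOn ℓ then
    -LinearMap.pi fun _ : Ω.polar ℓ => ∑ H' : Ω.polar ℓ,
      Ω.eigProj ℓ (K.flip ℓ ε) ∘ₗ Ω.res H'.1 ∘ₗ LinearMap.proj H'
  else
    blockDiag (fun _ : Ω.polar ℓ => Ω.res K) +
    LinearMap.pi fun H : Ω.polar ℓ => ∑ H' : Ω.polar ℓ,
      if K.carrier = {x | H.1.root ℓ x = H'.1.root ℓ x} then
        Ω.res H'.1 ∘ₗ ((LinearMap.proj H : (Ω.polar ℓ → V) →ₗ[ℂ] V) - LinearMap.proj H')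
      else 0

theorem flip_injective (ℓ : Fin n) (ε : ℤˣ) :
    Function.Injective (Hyperplane.flip ℓ ε : Hyperplane n → Hyperplane n) := by
  have hε : ((ε : ℤ) : ℂ) * ((ε : ℤ) : ℂ) = 1 := by
    rcases Int.units_eq_one_or ε with h | h <;> simp [h]
  intro H H' h
  have hc := congrArg Hyperplane.carrier h
  ext x
  have hx := Set.ext_iff.1 hc (Function.update x ℓ (((ε : ℤ) : ℂ) * x ℓ))
  simpa [Hyperplane.flip, ← mul_assoc, hε] using hx

theorem laplaceRes_finite [FiniteDimensional ℂ V] (ℓ : Fin n) (ε : ℤˣ) (Ω : PfaffianForm n V) :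
    (Function.support (Ω.laplaceRes ℓ ε)).Finite := by
  classical
  have h1 : {K : Hyperplane n | Ω.eig ℓ (K.flip ℓ ε) ≠ ⊥}.Finite :=
    (Ω.eig_finite ℓ).preimage (flip_injective ℓ ε).injOn
  have h2 : {K : Hyperplane n | ∃ p : Ω.polar ℓ × Ω.polar ℓ,
      K.carrier = {x | p.1.1.root ℓ x = p.2.1.root ℓ x}}.Finite := by
    have hr := Set.finite_range fun p : Ω.polar ℓ × Ω.polar ℓ =>
      {x | p.1.1.root ℓ x = p.2.1.root ℓ x}
    refine (hr.preimage (f := Hyperplane.carrier) ?_).subset ?_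
    · intro H _ H' _ h
      exact Hyperplane.ext h
    · rintro K ⟨p, hp⟩
      exact ⟨p, hp.symm⟩
  refine ((h1.union h2).union Ω.res.support.finite_toSet).subset ?_
  intro K hK
  by_contra hn
  simp only [Set.mem_union, Set.mem_ofPred_eq, not_or, not_not, not_exists, Finset.mem_coe,
    Finsupp.mem_support_iff] at hn
  obtain ⟨⟨hn1, hn2⟩, hn3⟩ := hn
  apply hK
  unfold laplaceRes
  split_ifs with hd
  · rw [Ω.eigProj_eq_zero ℓ _ hn1]
    ext; simp
  · have : ∀ H H' : Ω.polar ℓ, K.carrier ≠ {x | H.1.root ℓ x = H'.1.root ℓ x} :=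
      fun H H' => hn2 (H, H')
    simp only [this, if_false, hn3]
    ext; simp [blockDiag]

end Basic

section Laplace

variable {n : ℕ} {V : Type*} [AddCommGroup V] [Module ℂ V] [FiniteDimensional ℂ V]

/-- The Laplace transform (`ε = 1`) or inverse Laplace transform (`ε = -1`) of `Ω` in the direction
`x_ℓ`, on `V^q`. With `y`, `z` distinct variables other than `x = x_ℓ`, the block `H` of its
polynomial part is `-ε a_H` in the direction `x`, and
`A_y + ∑_z A_{yz} z + a_H A_{yx} + (a_H)_y (A_x - ε x)` in the direction `y`. (In an admissible
system `a_H` is constant unless all `A_{yx}` vanish, whence only `a_H(0)` occurs in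
`a_H A_{yx}`.) -/
noncomputable def signedLaplace (ℓ : Fin n) (ε : ℤˣ) (Ω : PfaffianForm n V) :
    PfaffianForm n (Ω.polar ℓ → V) where
  cst y :=
    if y = ℓ then blockDiag fun H => (-((ε : ℤ) : ℂ) * H.1.root ℓ 0) • (1 : Module.End ℂ V)
    else blockDiag fun H => Ω.cst y + H.1.root ℓ 0 • Ω.lin y ℓ + H.1.slope ℓ y • Ω.cst ℓ
  lin y z :=
    if y = z then 0
    else if y = ℓ then
      blockDiag fun H => (-((ε : ℤ) : ℂ) * H.1.slope ℓ z) • (1 : Module.End ℂ V)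
    else if z = ℓ then
      blockDiag fun H => (-((ε : ℤ) : ℂ) * H.1.slope ℓ y) • (1 : Module.End ℂ V)
    else blockDiag fun _ => Ω.lin y z
  lin_self y := by simp
  lin_symm y z := by
    by_cases hyz : y = z
    · simp [hyz]
    · have hzy : z ≠ y := fun h => hyz h.symm
      by_cases hy : y = ℓ
      · subst hy; simp [hyz, hzy]
      · by_cases hz : z = ℓ
        · subst hz; simp [hyz, hzy]
        · simp [hyz, hzy, hy, hz, Ω.lin_symm y z]
  res := Finsupp.ofSupportFinite (Ω.laplaceRes ℓ ε) (Ω.laplaceRes_finite ℓ ε)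

/-- The subspace `⊕ ker A_H` of `V^q`. -/
def kerSum (ℓ : Fin n) (Ω : PfaffianForm n V) : Submodule ℂ (Ω.polar ℓ → V) :=
  Submodule.pi Set.univ fun H => LinearMap.ker (Ω.res H.1)

/-- All coefficients of `Ω` preserve the subspace `K`. -/
def Preserves (Ω : PfaffianForm n V) (K : Submodule ℂ V) : Prop :=
  (∀ i, K ≤ K.comap (Ω.cst i)) ∧ (∀ i j, K ≤ K.comap (Ω.lin i j)) ∧ ∀ H, K ≤ K.comap (Ω.res H)

/-- The form on `V ⧸ K` induced by a form whose coefficients preserve `K`. -/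
noncomputable def quotient (Ω : PfaffianForm n V) (K : Submodule ℂ V) :
    PfaffianForm n (V ⧸ K) where
  cst i := inducedEnd K (Ω.cst i)
  lin i j := inducedEnd K (Ω.lin i j)
  lin_self i := by rw [Ω.lin_self, inducedEnd_zero]
  lin_symm i j := by rw [Ω.lin_symm]
  res := Ω.res.mapRange (inducedEnd K) (inducedEnd_zero K)

/-- The Laplace transform `L^{x_ℓ}(Ω)`. -/
noncomputable abbrev laplace (ℓ : Fin n) (Ω : PfaffianForm n V) :
    PfaffianForm n (Ω.polar ℓ → V) :=
  Ω.signedLaplace ℓ 1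

/-- The inverse Laplace transform `L^{-x_ℓ}(Ω)`. -/
noncomputable abbrev invLaplace (ℓ : Fin n) (Ω : PfaffianForm n V) :
    PfaffianForm n (Ω.polar ℓ → V) :=
  Ω.signedLaplace ℓ (-1)

/-- The middle Laplace transform `ML^{x_ℓ}(Ω)`. -/
noncomputable abbrev middleLaplace (ℓ : Fin n) (Ω : PfaffianForm n V) :
    PfaffianForm n ((Ω.polar ℓ → V) ⧸ Ω.kerSum ℓ) :=
  (Ω.laplace ℓ).quotient (Ω.kerSum ℓ)

/-- The inverse middle Laplace transform `ML^{-x_ℓ}(Ω)`. -/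
noncomputable abbrev invMiddleLaplace (ℓ : Fin n) (Ω : PfaffianForm n V) :
    PfaffianForm n ((Ω.polar ℓ → V) ⧸ Ω.kerSum ℓ) :=
  (Ω.invLaplace ℓ).quotient (Ω.kerSum ℓ)

end Laplace

/-- Constant gauge equivalence `Ω' = P Ω P⁻¹`, with `P` a constant invertible linear map. -/
def GaugeEquiv {n : ℕ} {V W : Type*} [AddCommGroup V] [Module ℂ V] [AddCommGroup W] [Module ℂ W]
    (Ω : PfaffianForm n V) (Ω' : PfaffianForm n W) : Prop :=
  ∃ P : V ≃ₗ[ℂ] W, (∀ i, Ω'.cst i = P.conj (Ω.cst i)) ∧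
    (∀ i j, Ω'.lin i j = P.conj (Ω.lin i j)) ∧ ∀ H, Ω'.res H = P.conj (Ω.res H)

/-- An element of the set `𝔓^irr_{T,S}`: a form with `N × N` matrix coefficients, for some
`N ≥ 1`, that satisfies the assumptions in the direction `x_ℓ` and is irreducible in this direction,
such that `T` is the set of hyperplanes of its arrangement that depend on `x_ℓ`, and `S` is the
arrangement `det (x_ℓ - S_{x_ℓ}) = 0`. -/
structure IrrSystem {n : ℕ} (ℓ : Fin n) (T S : Set (Hyperplane n)) where
  rank : ℕ
  rank_pos : 0 < rank
  form : PfaffianForm n (Fin rank → ℂ)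
  admissible : form.Admissible ℓ
  irreducible : form.Irreducible ℓ
  polar_eq : (form.polar ℓ : Set (Hyperplane n)) = T
  charArr_eq : form.charArr ℓ = S

instance gaugeSetoid {n : ℕ} (ℓ : Fin n) (T S : Set (Hyperplane n)) :
    Setoid (IrrSystem ℓ T S) where
  r X Y := X.form.GaugeEquiv Y.form
  iseqv :=
    { refl := fun X => ⟨LinearEquiv.refl ℂ _, by simp, by simp, by simp⟩
      symm := by
        rintro X Y ⟨P, h1, h2, h3⟩
        refine ⟨P.symm, fun i => ?_, fun i j => ?_, fun H => ?_⟩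
        · rw [h1]; ext; simp [LinearEquiv.conj_apply]
        · rw [h2]; ext; simp [LinearEquiv.conj_apply]
        · rw [h3]; ext; simp [LinearEquiv.conj_apply]
      trans := by
        rintro X Y Z ⟨P, h1, h2, h3⟩ ⟨Q, k1, k2, k3⟩
        refine ⟨P.trans Q, fun i => ?_, fun i j => ?_, fun H => ?_⟩
        · rw [k1, h1]; ext; simp
        · rw [k2, h2]; ext; simp
        · rw [k3, h3]; ext; simp }

/-- The set `𝔐^irr_{T,S}` of gauge classes of irreducible systems. -/
abbrev IrrClass {n : ℕ} (ℓ : Fin n) (T S : Set (Hyperplane n)) : Type :=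
  Quotient (gaugeSetoid ℓ T S)

end PfaffianForm

/-!
The proof rests on a duality of Harnad type between the poles of a system in the direction `x_ℓ` and
the eigenvalues of its polynomial part. At a fixed generic point, let `S` be the polynomial part of
the coefficient of `dx_ℓ` in `Ω`, a diagonalizable endomorphism of `V`, and let `∑ A_H / (x_ℓ - a_H)`
be its polar part. Put `W = V^q / 𝒦` with `𝒦 = ⨁ ker A_H`, let `P : V → W` be the diagonal
map and `Q : W → V` the map `(v_H) ↦ ∑ A_H v_H`, and let `T` be the block diagonal
endomorphism of `W` with eigenvalues `a_H`. Then the polar part of `Ω` is `Q (x_ℓ - T)⁻¹ P`, and the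
coefficient of `dx_ℓ` in the middle Laplace transform is `-ε T - P (x_ℓ - ε S)⁻¹ Q`. The pairs
`(V, S)` and `(W, T)` thus play symmetric roles. The structure `PfaffianForm.IsDual` records this
symmetric relation between two forms, together with non-degeneracy conditions on `P` and `Q` on each
eigenspace and with linear relations that tie the coefficients of the other `dx_i` to each other.

* `PfaffianForm.Integrable.eventually_relations` extracts from `Ω ∧ Ω = 0`, by comparing partial
  fractions in `x_ℓ`, the relations between the coefficients at generic points.
  `PfaffianForm.integrable_of_eventually`: conversely, integrability may be tested at such points.
* `PfaffianForm.isDual_signedMiddleLaplace`: a system that is irreducible in the direction `x_ℓ` is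
  dual to its middle Laplace transform. Irreducibility enters only through the non-degeneracy of `P`
  and `Q` on the eigenspaces of `S`.
* `PfaffianForm.IsDual.admissible` and `PfaffianForm.IsDual.irreducible`: a dual of a form inherits
  the assumptions and irreducibility.
* `PfaffianForm.IsDual.gaugeEquiv`: a form determines its dual up to gauge equivalence.
* `PfaffianForm.IsDual.symm`: duality for `ε` is inverse to duality for `-ε`.

The inversion formulas follow from the last two points, as `Ω` is a dual of its transform. Duality
exchanges the poles and the components of the characteristic variety, up to `x_ℓ ↦ -x_ℓ`, hence the
bijections between sets of gauge classes.
-/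

open Filter

/-! ### Generic points -/

/-- The filter of generic subsets of `ℂⁿ`: those that contain the complement of the zero set of a
nonzero polynomial. -/
def genericFilter (n : ℕ) : Filter (Fin n → ℂ) where
  sets := {s | ∃ p : MvPolynomial (Fin n) ℂ, p ≠ 0 ∧ ∀ x, MvPolynomial.eval x p ≠ 0 → x ∈ s}
  univ_sets := ⟨1, one_ne_zero, fun _ _ => Set.mem_univ _⟩
  sets_of_superset := by
    rintro s t ⟨p, hp, h⟩ hst
    exact ⟨p, hp, fun x hx => hst (h x hx)⟩
  inter_sets := by
    rintro s t ⟨p, hp, h⟩ ⟨q, hq, k⟩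
    refine ⟨p * q, mul_ne_zero hp hq, fun x hx => ?_⟩
    rw [map_mul] at hx
    exact ⟨h x (left_ne_zero_of_mul hx), k x (right_ne_zero_of_mul hx)⟩

section Generic

variable {n : ℕ}

theorem eventually_generic_iff {p : (Fin n → ℂ) → Prop} :
    (∀ᶠ x in genericFilter n, p x) ↔
      ∃ q : MvPolynomial (Fin n) ℂ, q ≠ 0 ∧ ∀ x, MvPolynomial.eval x q ≠ 0 → p x :=
  Iff.rfl

instance genericFilter_neBot : (genericFilter n).NeBot := by
  refine ⟨fun h => ?_⟩
  have : ∀ᶠ _ in genericFilter n, False := by rw [h]; exact eventually_bot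
  obtain ⟨q, hq, hq'⟩ := eventually_generic_iff.1 this
  exact hq (MvPolynomial.funext fun x => by simpa using hq' x)

theorem eventually_cofinite_line (q : MvPolynomial (Fin n) ℂ) (a b : Fin n → ℂ) (t₀ : ℂ)
    (h : MvPolynomial.eval (a + t₀ • b) q ≠ 0) :
    ∀ᶠ t : ℂ in cofinite, MvPolynomial.eval (a + t • b) q ≠ 0 := by
  set r : Polynomial ℂ := MvPolynomial.aeval
    (fun i => Polynomial.C (a i) + Polynomial.X * Polynomial.C (b i)) q with hr
  have key : ∀ t, r.eval t = MvPolynomial.eval (a + t • b) q := by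
    intro t
    rw [hr, MvPolynomial.aeval_def, ← Polynomial.coe_evalRingHom, MvPolynomial.hom_eval₂,
      MvPolynomial.eval, MvPolynomial.coe_eval₂Hom]
    congr 1
    · ext; simp
    · funext i
      simp only [Polynomial.coe_evalRingHom, Polynomial.eval_add,
        Polynomial.eval_C, Polynomial.eval_mul, Polynomial.eval_X, Pi.add_apply, Pi.smul_apply,
        smul_eq_mul]
  have hr0 : r ≠ 0 := by
    intro h0
    apply h
    rw [← key, h0, Polynomial.eval_zero]
  have hfin : {t : ℂ | r.IsRoot t}.Finite := Polynomial.finite_setOfPred_isRoot hr0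
  refine (hfin.subset ?_)
  intro t ht
  by_contra hne
  apply ht
  change MvPolynomial.eval (a + t • b) q ≠ 0
  rw [← key]
  exact hne

/-- Every line through a generic point consists, up to finitely many points, of generic points. -/
theorem eventually_generic_update {p : (Fin n → ℂ) → Prop} (h : ∀ᶠ x in genericFilter n, p x)
    (i : Fin n) : ∀ᶠ x in genericFilter n, ∀ᶠ t in cofinite, p (Function.update x i t) := by
  obtain ⟨q, hq, hqp⟩ := eventually_generic_iff.1 h
  refine eventually_generic_iff.2 ⟨q, hq, fun x hx => ?_⟩
  have hu : ∀ t : ℂ, Function.update x i t =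
      Function.update x i 0 + t • (Pi.single i 1 : Fin n → ℂ) := by
    intro t
    ext j
    by_cases hj : j = i
    · subst hj; simp
    · simp [hj]
  have := eventually_cofinite_line q (Function.update x i 0) (Pi.single i 1) (x i)
    (by rw [← hu, Function.update_eq_self]; exact hx)
  filter_upwards [this] with t ht
  rw [← hu] at ht
  exact hqp _ ht

/-- Every point lies on a line that consists of generic points, up to finitely many points. -/
theorem exists_generic_line {p : (Fin n → ℂ) → Prop} (h : ∀ᶠ x in genericFilter n, p x)
    (x : Fin n → ℂ) : ∃ v : Fin n → ℂ, ∀ᶠ t : ℂ in cofinite, p (x + t • v) := by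
  obtain ⟨q, hq, hqp⟩ := eventually_generic_iff.1 h
  obtain ⟨z, hz⟩ : ∃ z, MvPolynomial.eval z q ≠ 0 := by
    by_contra! hall
    exact hq (MvPolynomial.funext fun x => by simpa using hall x)
  refine ⟨z - x, ?_⟩
  filter_upwards [eventually_cofinite_line q x (z - x) 1 (by simpa using hz)] with t ht
  exact hqp _ ht

theorem eventually_generic_affine_ne_zero (c : Fin n → ℂ) (d : ℂ) (h : c ≠ 0 ∨ d ≠ 0) :
    ∀ᶠ x in genericFilter n, ∑ i, c i * x i + d ≠ 0 := by
  set q : MvPolynomial (Fin n) ℂ :=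
    ∑ i, MvPolynomial.C (c i) * MvPolynomial.X i + MvPolynomial.C d with hq
  have key : ∀ x, MvPolynomial.eval x q = ∑ i, c i * x i + d := fun x => by simp [hq]
  refine eventually_generic_iff.2 ⟨q, fun h0 => ?_, fun x hx => by rwa [key] at hx⟩
  have hz : ∀ x : Fin n → ℂ, ∑ i, c i * x i + d = 0 := fun x => by rw [← key, h0, map_zero]
  have hd : d = 0 := by simpa using hz 0
  rcases h with h | h
  · apply h
    funext i
    have := hz (Pi.single i 1)
    simpa [hd, Pi.single_apply] using this
  · exact h hd

/-! ### Uniqueness of partial fraction expansions -/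

theorem partialFraction_unique_complex {ι : Type*} (s : Finset ι) (a : ι → ℂ)
    (ha : Set.InjOn a s) (c : ι → ℂ) (m₀ m₁ : ℂ)
    (h : ∀ᶠ t : ℂ in cofinite, m₀ + t * m₁ + ∑ i ∈ s, (t - a i)⁻¹ * c i = 0) :
    m₀ = 0 ∧ m₁ = 0 ∧ ∀ i ∈ s, c i = 0 := by
  classical
  set r : Polynomial ℂ := (Polynomial.C m₀ + Polynomial.X * Polynomial.C m₁) *
      ∏ i ∈ s, (Polynomial.X - Polynomial.C (a i)) +
    ∑ i ∈ s, Polynomial.C (c i) * ∏ j ∈ s.erase i, (Polynomial.X - Polynomial.C (a j)) with hr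
  have hne : ∀ᶠ t : ℂ in cofinite, ∀ i ∈ s, t ≠ a i := by
    rw [Filter.eventually_all_finset]
    intro i _
    exact (Set.finite_singleton (a i)).subset fun t ht => by simpa using ht
  have hr0 : r = 0 := by
    by_contra h0
    have hfin := Polynomial.finite_setOfPred_isRoot h0
    have hev : ∀ᶠ t : ℂ in cofinite, ¬ r.IsRoot t := by
      exact hfin.subset fun t ht => by simpa using ht
    obtain ⟨t, h1, h2, h3⟩ := (hev.and (h.and hne)).exists
    apply h1
    rw [Polynomial.IsRoot, hr]
    simp only [Polynomial.eval_add, Polynomial.eval_mul, Polynomial.eval_C, Polynomial.eval_X,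
      Polynomial.eval_prod, Polynomial.eval_sub, Polynomial.eval_finsetSum]
    have : ∑ i ∈ s, c i * ∏ j ∈ s.erase i, (t - a j) =
        (∑ i ∈ s, (t - a i)⁻¹ * c i) * ∏ j ∈ s, (t - a j) := by
      rw [Finset.sum_mul]
      refine Finset.sum_congr rfl fun i hi => ?_
      rw [← Finset.mul_prod_erase s _ hi]
      have := sub_ne_zero.2 (h3 i hi)
      field_simp
    rw [this, ← add_mul, h2, zero_mul]
  have hc : ∀ i ∈ s, c i = 0 := by
    intro i hi
    have hev := congrArg (Polynomial.eval (a i)) hr0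
    rw [hr] at hev
    simp only [Polynomial.eval_add, Polynomial.eval_mul, Polynomial.eval_C, Polynomial.eval_X,
      Polynomial.eval_prod, Polynomial.eval_sub, Polynomial.eval_finsetSum,
      Polynomial.eval_zero] at hev
    rw [Finset.prod_eq_zero hi (sub_self _), mul_zero, zero_add, Finset.sum_eq_single i] at hev
    · refine (mul_eq_zero.1 hev).resolve_right (Finset.prod_ne_zero_iff.2 fun j hj => ?_)
      rw [Finset.mem_erase] at hj
      exact sub_ne_zero.2 fun e => hj.1 (ha hj.2 hi e.symm)
    · intro j _ hji
      rw [Finset.prod_eq_zero (Finset.mem_erase.2 ⟨hji.symm, hi⟩) (sub_self _), mul_zero]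
    · exact fun hn => absurd hi hn
  have hm : (Polynomial.C m₀ + Polynomial.X * Polynomial.C m₁ : Polynomial ℂ) = 0 := by
    have : (Polynomial.C m₀ + Polynomial.X * Polynomial.C m₁) *
        ∏ i ∈ s, (Polynomial.X - Polynomial.C (a i)) = 0 := by
      rw [hr, Finset.sum_eq_zero, add_zero] at hr0
      · exact hr0
      · intro i hi; simp [hc i hi]
    refine (mul_eq_zero.1 this).resolve_right (Finset.prod_ne_zero_iff.2 fun j _ => ?_)
    exact Polynomial.X_sub_C_ne_zero _
  refine ⟨?_, ?_, hc⟩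
  · simpa using congrArg (Polynomial.eval 0) hm
  · have h0 : m₀ = 0 := by simpa using congrArg (Polynomial.eval 0) hm
    simpa [h0] using congrArg (Polynomial.eval 1) hm

/-- A vector valued function `m₀ + t m₁ + ∑ᵢ cᵢ / (t - aᵢ)` of one variable determines its
coefficients. -/
theorem partialFraction_unique {M : Type*} [AddCommGroup M] [Module ℂ M] {ι : Type*}
    (s : Finset ι) (a : ι → ℂ) (ha : Set.InjOn a s) (c : ι → M) (m₀ m₁ : M)
    (h : ∀ᶠ t : ℂ in cofinite, m₀ + t • m₁ + ∑ i ∈ s, (t - a i)⁻¹ • c i = 0) :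
    m₀ = 0 ∧ m₁ = 0 ∧ ∀ i ∈ s, c i = 0 := by
  have key := fun φ : Module.Dual ℂ M => partialFraction_unique_complex s a ha
    (fun i => φ (c i)) (φ m₀) (φ m₁) (by
      filter_upwards [h] with t ht
      simpa using congrArg φ ht)
  refine ⟨?_, ?_, fun i hi => ?_⟩
  · exact (Module.forall_dual_apply_eq_zero_iff ℂ _).1 fun φ => (key φ).1
  · exact (Module.forall_dual_apply_eq_zero_iff ℂ _).1 fun φ => (key φ).2.1
  · exact (Module.forall_dual_apply_eq_zero_iff ℂ _).1 fun φ => (key φ).2.2 i hi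

/-! ### Hyperplanes and their defining polynomials -/

namespace Hyperplane

/-- The hyperplane `∑ cᵢ xᵢ + d = 0`. -/
def ofCoeffs (c : Fin n → ℂ) (d : ℂ) (hc : c ≠ 0) : Hyperplane n where
  carrier := {x | ∑ i, c i * x i + d = 0}
  exists_eq := ⟨c, d, hc, rfl⟩

/-- The defining polynomial of a hyperplane is unique up to a nonzero factor. -/
theorem exists_smul_eq (H : Hyperplane n) (c : Fin n → ℂ) (d : ℂ) (hc : c ≠ 0)
    (h : ∀ x, x ∈ H.carrier ↔ ∑ i, c i * x i + d = 0) :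
    ∃ r : ℂ, r ≠ 0 ∧ (∀ i, H.coeff i = r * c i) ∧ H.const = r * d ∧
      ∀ x, H.poly x = r * (∑ i, c i * x i + d) := by
  obtain ⟨i, hi⟩ := Function.ne_iff.1 hc
  have hi : c i ≠ 0 := hi
  have key : ∀ x, H.poly x = H.coeff i / c i * (∑ i, c i * x i + d) := by
    intro x
    -- the projection of `x` to the hyperplane in the direction `i`
    set f := ∑ i, c i * x i + d with hf
    have hsum : ∀ e : Fin n → ℂ, ∑ j, e j * (x j + -(f / c i) * (Pi.single i 1 : Fin n → ℂ) j) =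
        ∑ j, e j * x j - e i * (f / c i) := by
      intro e
      simp only [mul_add, Finset.sum_add_distrib, Pi.single_apply]
      simp
      ring
    have hmem : (fun j => x j + -(f / c i) * (Pi.single i 1 : Fin n → ℂ) j) ∈ H.carrier := by
      rw [h, hsum]
      field_simp
      rw [hf]; ring
    rw [mem_iff, poly, hsum] at hmem
    rw [poly]
    linear_combination hmem
  have hconst : H.const = H.coeff i / c i * d := by
    have := key 0
    simpa [poly] using this
  have hcoeff : ∀ j, H.coeff j = H.coeff i / c i * c j := by
    intro j
    have := key (Pi.single j 1)
    simp only [poly, Pi.single_apply, mul_ite, mul_one, mul_zero, Finset.sum_ite_eq',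
      Finset.mem_univ, if_true] at this
    linear_combination this - hconst
  refine ⟨H.coeff i / c i, fun h0 => H.coeff_ne_zero ?_, hcoeff, hconst, key⟩
  funext j
  rw [hcoeff j, h0, zero_mul, Pi.zero_apply]

theorem eventually_poly_ne_zero (H : Hyperplane n) :
    ∀ᶠ x in genericFilter n, H.poly x ≠ 0 :=
  eventually_generic_affine_ne_zero _ _ (Or.inl H.coeff_ne_zero)

theorem root_sub_eq (ℓ : Fin n) {H K : Hyperplane n} (hH : H.DependsOn ℓ) (hK : K.DependsOn ℓ)
    (x : Fin n → ℂ) : H.root ℓ x - K.root ℓ x =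
      ∑ j, (if j = ℓ then 0 else H.slope ℓ j - K.slope ℓ j) * x j +
        (H.root ℓ 0 - K.root ℓ 0) := by
  rw [root_eq_sum ℓ H hH, root_eq_sum ℓ K hK x]
  have : ∑ j, (if j = ℓ then 0 else H.slope ℓ j - K.slope ℓ j) * x j =
      ∑ j, (if j = ℓ then 0 else H.slope ℓ j * x j) -
        ∑ j, (if j = ℓ then 0 else K.slope ℓ j * x j) := by
    rw [← Finset.sum_sub_distrib]
    refine Finset.sum_congr rfl fun j _ => ?_
    split_ifs <;> ring
  rw [this]; ring

theorem eq_of_root_eq (ℓ : Fin n) {H K : Hyperplane n} (hH : H.DependsOn ℓ) (hK : K.DependsOn ℓ)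
    (h : ∀ x, H.root ℓ x = K.root ℓ x) : H = K := by
  ext x
  rw [H.mem_iff_root ℓ hH, K.mem_iff_root ℓ hK, h]

theorem eventually_root_ne (ℓ : Fin n) {H K : Hyperplane n} (hH : H.DependsOn ℓ)
    (hK : K.DependsOn ℓ) (hne : H ≠ K) :
    ∀ᶠ x in genericFilter n, H.root ℓ x ≠ K.root ℓ x := by
  have := eventually_generic_affine_ne_zero
    (fun j => if j = ℓ then 0 else H.slope ℓ j - K.slope ℓ j) (H.root ℓ 0 - K.root ℓ 0) (by
      by_contra! h
      apply hne
      refine eq_of_root_eq ℓ hH hK fun x => ?_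
      rw [← sub_eq_zero, root_sub_eq ℓ hH hK, h.2]
      simp [fun j => congrFun h.1 j])
  filter_upwards [this] with x hx
  rwa [← root_sub_eq ℓ hH hK, sub_ne_zero] at hx

theorem eventually_root_injOn (ℓ : Fin n) (s : Finset (Hyperplane n))
    (hs : ∀ H ∈ s, H.DependsOn ℓ) :
    ∀ᶠ x in genericFilter n, Set.InjOn (fun H : Hyperplane n => H.root ℓ x) s := by
  have : ∀ᶠ x in genericFilter n, ∀ H ∈ s, ∀ K ∈ s, H ≠ K → H.root ℓ x ≠ K.root ℓ x := by
    rw [Filter.eventually_all_finset]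
    intro H hH
    rw [Filter.eventually_all_finset]
    intro K hK
    by_cases h : H = K
    · simp [h]
    · filter_upwards [eventually_root_ne ℓ (hs H hH) (hs K hK) h] with x hx _ using hx
  filter_upwards [this] with x hx H hH K hK e
  by_contra h
  exact hx H hH K hK h e

theorem coeff_div_poly (ℓ : Fin n) (H : Hyperplane n) (hH : H.DependsOn ℓ) (j : Fin n)
    (x : Fin n → ℂ) : H.coeff j / H.poly x = -H.slope ℓ j * (x ℓ - H.root ℓ x)⁻¹ := by
  have h0 : H.coeff ℓ ≠ 0 := hH
  rw [slope, root, neg_neg, sub_sub_cancel, inv_div]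
  by_cases hp : H.poly x = 0
  · simp [hp]
  · field_simp

theorem slope_self (ℓ : Fin n) (H : Hyperplane n) (hH : H.DependsOn ℓ) : H.slope ℓ ℓ = -1 := by
  have h0 : H.coeff ℓ ≠ 0 := hH
  simp [slope, h0]

theorem poly_update (ℓ : Fin n) (H : Hyperplane n) (hH : ¬ H.DependsOn ℓ) (x : Fin n → ℂ) (t : ℂ) :
    H.poly (Function.update x ℓ t) = H.poly x := by
  have h0 : H.coeff ℓ = 0 := not_not.1 hH
  unfold poly
  congr 1
  refine Finset.sum_congr rfl fun j _ => ?_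
  by_cases hj : j = ℓ
  · subst hj; simp [h0]
  · simp [hj]

theorem root_single (ℓ : Fin n) (H : Hyperplane n) (hH : H.DependsOn ℓ) {j : Fin n} (hj : j ≠ ℓ) :
    H.root ℓ (Pi.single j 1) = H.root ℓ 0 + H.slope ℓ j := by
  rw [H.root_eq_sum ℓ hH, Finset.sum_eq_single j]
  · simp [hj]
  · intro i _ hi; simp [hi]
  · simp

theorem slope_ne_zero_iff (ℓ : Fin n) (H : Hyperplane n) (hH : H.DependsOn ℓ) (j : Fin n) :
    H.slope ℓ j ≠ 0 ↔ H.DependsOn j := by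
  have h0 : H.coeff ℓ ≠ 0 := hH
  simp [slope, DependsOn, h0]

/-! ### The reflections `x_ℓ ↦ ± x_ℓ` -/

theorem flip_flip (ℓ : Fin n) (ε : ℤˣ) (H : Hyperplane n) : (H.flip ℓ ε).flip ℓ ε = H := by
  have hε : ((ε : ℤ) : ℂ) * ((ε : ℤ) : ℂ) = 1 := by
    rcases Int.units_eq_one_or ε with h | h <;> simp [h]
  ext x
  simp [flip, ← mul_assoc, hε]

theorem mem_flip (ℓ : Fin n) (ε : ℤˣ) (H : Hyperplane n) (x : Fin n → ℂ) :
    x ∈ (H.flip ℓ ε).carrier ↔ Function.update x ℓ (((ε : ℤ) : ℂ) * x ℓ) ∈ H.carrier :=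
  Iff.rfl

theorem DependsOn.flip {ℓ : Fin n} {H : Hyperplane n} (hH : H.DependsOn ℓ) (ε : ℤˣ) :
    (H.flip ℓ ε).DependsOn ℓ := by
  have hε : ((ε : ℤ) : ℂ) ≠ 0 := by exact_mod_cast ε.ne_zero
  have h0 : H.coeff ℓ ≠ 0 := hH
  have hc : (fun i => if i = ℓ then ((ε : ℤ) : ℂ) * H.coeff i else H.coeff i) ≠ 0 :=
    fun h => mul_ne_zero hε h0 (by simpa using congrFun h ℓ)
  obtain ⟨r, hr, h1, -⟩ := (H.flip ℓ ε).exists_smul_eq _ H.const hc (by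
    intro x
    rw [mem_flip, mem_iff, poly]
    have : ∀ i, H.coeff i * Function.update x ℓ (((ε : ℤ) : ℂ) * x ℓ) i =
        (if i = ℓ then ((ε : ℤ) : ℂ) * H.coeff i else H.coeff i) * x i := by
      intro i
      by_cases hl : i = ℓ
      · subst hl; simp; ring
      · simp [hl]
    simp only [this])
  rw [DependsOn, h1]
  simpa only [if_true] using mul_ne_zero hr (mul_ne_zero hε h0)

theorem dependsOn_flip_iff {ℓ : Fin n} {H : Hyperplane n} (ε : ℤˣ) :
    (H.flip ℓ ε).DependsOn ℓ ↔ H.DependsOn ℓ :=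
  ⟨fun h => by simpa [flip_flip] using h.flip ε, fun h => h.flip ε⟩

theorem root_flip (ℓ : Fin n) (ε : ℤˣ) (H : Hyperplane n) (hH : H.DependsOn ℓ) (x : Fin n → ℂ) :
    (H.flip ℓ ε).root ℓ x = ((ε : ℤ) : ℂ) * H.root ℓ x := by
  have hε : ((ε : ℤ) : ℂ) * ((ε : ℤ) : ℂ) = 1 := by
    rcases Int.units_eq_one_or ε with h | h <;> simp [h]
  have h := ((H.flip ℓ ε).mem_iff_root ℓ (hH.flip ε)
    (Function.update x ℓ ((H.flip ℓ ε).root ℓ x))).2 (by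
      rw [root_update ℓ _ (hH.flip ε)]; simp)
  rw [mem_flip, H.mem_iff_root ℓ hH, root_update ℓ _ hH, root_update ℓ _ hH] at h
  simp only [Function.update_self] at h
  linear_combination ((ε : ℤ) : ℂ) * h - (H.flip ℓ ε).root ℓ x * hε

theorem slope_flip (ℓ : Fin n) (ε : ℤˣ) (H : Hyperplane n) (hH : H.DependsOn ℓ) {j : Fin n}
    (hj : j ≠ ℓ) : (H.flip ℓ ε).slope ℓ j = ((ε : ℤ) : ℂ) * H.slope ℓ j := by
  have h1 := root_single ℓ _ (hH.flip ε) hj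
  rw [root_flip ℓ ε H hH, root_flip ℓ ε H hH, root_single ℓ H hH hj] at h1
  linear_combination -h1

theorem flip_one (ℓ : Fin n) (H : Hyperplane n) : H.flip ℓ 1 = H := by
  ext x
  simp [mem_flip]

end Hyperplane

/-! ### Uniqueness of the coefficients of a logarithmic form -/

theorem affine_unique {M : Type*} [AddCommGroup M] [Module ℂ M] (m : M) (l : Fin n → M)
    (h : ∀ᶠ x in genericFilter n, m + ∑ j, x j • l j = 0) : m = 0 ∧ ∀ j, l j = 0 := by
  have hl : ∀ j, l j = 0 := by
    intro j
    obtain ⟨x, hx⟩ := (eventually_generic_update h j).exists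
    refine (partialFraction_unique (∅ : Finset ℕ) (fun _ => 0) (by simp) (fun _ => 0)
      (m + ∑ k ∈ Finset.univ.erase j, x k • l k) (l j) ?_).2.1
    filter_upwards [hx] with t ht
    rw [← Finset.add_sum_erase _ _ (Finset.mem_univ j), Function.update_self,
      Finset.sum_congr rfl (g := fun k => x k • l k)] at ht
    · rw [Finset.sum_empty, add_zero, ← ht]; abel
    · intro k hk
      rw [Function.update_of_ne (Finset.mem_erase.1 hk).1]
  refine ⟨?_, hl⟩
  obtain ⟨x, hx⟩ := h.exists
  simpa [hl] using hx

/-- The coefficients of a form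
`∑ᵢ (cᵢ + ∑ⱼ xⱼ lᵢⱼ) dxᵢ + ∑_H r_H d log f_H` with values in a vector space are determined by the
values of the form at generic points. -/
theorem logForm_unique {M : Type*} [AddCommGroup M] [Module ℂ M] (c : Fin n → M)
    (l : Fin n → Fin n → M) (r : Hyperplane n →₀ M)
    (h : ∀ᶠ x in genericFilter n, ∀ i,
      c i + ∑ j, x j • l i j + (r.sum fun H A => (H.coeff i / H.poly x) • A) = 0) :
    (∀ i, c i = 0) ∧ (∀ i j, l i j = 0) ∧ ∀ H, r H = 0 := by
  classical
  have hr : ∀ H, r H = 0 := by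
    intro H
    by_contra hH
    obtain ⟨i, hi⟩ := Function.ne_iff.1 H.coeff_ne_zero
    have hi : H.DependsOn i := hi
    obtain ⟨x, hx, hinj⟩ := ((eventually_generic_update h i).and
      (Hyperplane.eventually_root_injOn i (r.support.filter fun H => H.DependsOn i)
        (fun H hH => (Finset.mem_filter.1 hH).2))).exists
    refine hH ((partialFraction_unique (r.support.filter fun H => H.DependsOn i)
      (fun H => H.root i x) hinj r (c i + ∑ k ∈ Finset.univ.erase i, x k • l i k) (l i i) ?_).2.2 H
      (Finset.mem_filter.2 ⟨Finsupp.mem_support_iff.2 hH, hi⟩))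
    filter_upwards [hx] with t ht
    have ht := ht i
    rw [← Finset.add_sum_erase _ _ (Finset.mem_univ i), Function.update_self,
      Finset.sum_congr rfl (g := fun k => x k • l i k), Finsupp.sum,
      ← Finset.sum_filter_add_sum_filter_not r.support (fun H => H.DependsOn i),
      Finset.sum_congr rfl (g := fun H => (t - H.root i x)⁻¹ • r H),
      Finset.sum_eq_zero (s := r.support.filter fun H => ¬ H.DependsOn i)] at ht
    · rw [← ht]; abel
    · intro K hK
      have : K.coeff i = 0 := not_not.1 (Finset.mem_filter.1 hK).2
      simp [this]
    · intro K hK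
      have hK := (Finset.mem_filter.1 hK).2
      rw [K.coeff_div_poly i hK, K.slope_self i hK, K.root_update i hK]
      simp
    · intro k hk
      rw [Function.update_of_ne (Finset.mem_erase.1 hk).1]
  have h0 : r = 0 := by ext H; exact hr H
  have := fun i => affine_unique (c i) (l i) (by
    filter_upwards [h] with x hx
    simpa [h0] using hx i)
  exact ⟨fun i => (this i).1, fun i => (this i).2, hr⟩

end Generic

/-! ### Spectral decomposition of the polynomial part -/

namespace PfaffianForm

section Spectral

variable {n : ℕ} {V : Type*} [AddCommGroup V] [Module ℂ V]

/-- The common eigenspaces of `A_{x_ℓ}` and the `A_{x_ℓ x_j}` span the whole space, that is, these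
endomorphisms are simultaneously diagonalizable. -/
def IsSpectral (ℓ : Fin n) (Ω : PfaffianForm n V) : Prop := ⨆ H, Ω.eig ℓ H = ⊤

theorem S_zero (Ω : PfaffianForm n V) (ℓ : Fin n) : Ω.S ℓ 0 = Ω.cst ℓ := by
  simp [S]

theorem S_single (Ω : PfaffianForm n V) (ℓ j : Fin n) :
    Ω.S ℓ (Pi.single j 1) = Ω.cst ℓ + Ω.lin ℓ j := by
  rw [S, Finset.sum_eq_single j]
  · simp
  · intro k _ hk; simp [hk]
  · simp

theorem cst_apply_of_mem_eig (ℓ : Fin n) (Ω : PfaffianForm n V) (H : Hyperplane n)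
    (hH : H.DependsOn ℓ) {v : V} (hv : v ∈ Ω.eig ℓ H) : Ω.cst ℓ v = H.root ℓ 0 • v := by
  rw [← S_zero, Ω.eig_apply ℓ H hH hv]

theorem lin_apply_of_mem_eig (ℓ : Fin n) (Ω : PfaffianForm n V) (H : Hyperplane n)
    (hH : H.DependsOn ℓ) {v : V} (hv : v ∈ Ω.eig ℓ H) {j : Fin n} (hj : j ≠ ℓ) :
    Ω.lin ℓ j v = H.slope ℓ j • v := by
  have h := Ω.eig_apply ℓ H hH hv (Pi.single j 1)
  rw [S_single, LinearMap.add_apply, Ω.cst_apply_of_mem_eig ℓ H hH hv,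
    H.root_single ℓ hH hj, add_smul] at h
  exact add_left_cancel h

theorem mem_eig_of_apply (ℓ : Fin n) (Ω : PfaffianForm n V) (H : Hyperplane n)
    (hH : H.DependsOn ℓ) {v : V} (h0 : Ω.cst ℓ v = H.root ℓ 0 • v)
    (hl : ∀ j, j ≠ ℓ → Ω.lin ℓ j v = H.slope ℓ j • v) : v ∈ Ω.eig ℓ H := by
  intro x hx
  rw [(H.mem_iff_root ℓ hH x).1 hx, H.root_eq_sum ℓ hH, S, LinearMap.add_apply, h0, add_smul,
    LinearMap.sum_apply, Finset.sum_smul]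
  congr 1
  refine Finset.sum_congr rfl fun j _ => ?_
  by_cases hj : j = ℓ
  · subst hj; simp [Ω.lin_self]
  · simp [hj, hl j hj, smul_smul, mul_comm]

theorem eig_eq_bot (ℓ : Fin n) (Ω : PfaffianForm n V) (H : Hyperplane n) (hH : ¬ H.DependsOn ℓ) :
    Ω.eig ℓ H = ⊥ := by
  by_contra h
  exact hH (Ω.dependsOn_of_eig ℓ H h)

theorem IsSpectral.ext {ℓ : Fin n} {Ω : PfaffianForm n V} (hΩ : Ω.IsSpectral ℓ) {M : Type*}
    [AddCommGroup M] [Module ℂ M] {f g : V →ₗ[ℂ] M}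
    (h : ∀ H, H.DependsOn ℓ → ∀ v ∈ Ω.eig ℓ H, f v = g v) : f = g := by
  ext v
  have hv : v ∈ ⨆ H, Ω.eig ℓ H := by rw [show ⨆ H, Ω.eig ℓ H = ⊤ from hΩ]; trivial
  induction hv using Submodule.iSup_induction' with
  | mem H w hw =>
    by_cases hH : H.DependsOn ℓ
    · exact h H hH w hw
    · rw [Ω.eig_eq_bot ℓ H hH, Submodule.mem_bot] at hw
      simp [hw]
  | zero => simp
  | add v w _ _ hv hw => rw [map_add, map_add, hv, hw]

theorem IsSpectral.isDiagonalizable_cst {ℓ : Fin n} {Ω : PfaffianForm n V} (hΩ : Ω.IsSpectral ℓ) :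
    IsDiagonalizable (Ω.cst ℓ) := by
  rw [IsDiagonalizable, ← top_le_iff, ← show ⨆ H, Ω.eig ℓ H = ⊤ from hΩ]
  refine iSup_le fun H => ?_
  by_cases hH : H.DependsOn ℓ
  · exact le_iSup_of_le (H.root ℓ 0) fun v hv =>
      Module.End.mem_eigenspace_iff.2 (Ω.cst_apply_of_mem_eig ℓ H hH hv)
  · rw [Ω.eig_eq_bot ℓ H hH]; exact bot_le

theorem IsSpectral.isDiagonalizable_lin {ℓ : Fin n} {Ω : PfaffianForm n V} (hΩ : Ω.IsSpectral ℓ)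
    {j : Fin n} (hj : j ≠ ℓ) : IsDiagonalizable (Ω.lin ℓ j) := by
  rw [IsDiagonalizable, ← top_le_iff, ← show ⨆ H, Ω.eig ℓ H = ⊤ from hΩ]
  refine iSup_le fun H => ?_
  by_cases hH : H.DependsOn ℓ
  · exact le_iSup_of_le (H.slope ℓ j) fun v hv =>
      Module.End.mem_eigenspace_iff.2 (Ω.lin_apply_of_mem_eig ℓ H hH hv hj)
  · rw [Ω.eig_eq_bot ℓ H hH]; exact bot_le

theorem isSpectral_of_iSup {ℓ : Fin n} {Ω : PfaffianForm n V} {ι : Type*}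
    (U : ι → Submodule ℂ V) (h : ι → Hyperplane n) (hU : ∀ i, U i ≤ Ω.eig ℓ (h i))
    (htop : ⨆ i, U i = ⊤) : Ω.IsSpectral ℓ :=
  top_unique (htop ▸ iSup_le fun i => (hU i).trans (le_iSup (Ω.eig ℓ) (h i)))

variable [FiniteDimensional ℂ V]

/-- The hyperplanes with nonzero common eigenspace. -/
noncomputable def specFinset (ℓ : Fin n) (Ω : PfaffianForm n V) : Finset (Hyperplane n) :=
  (Ω.eig_finite ℓ).toFinset

theorem mem_specFinset {ℓ : Fin n} {Ω : PfaffianForm n V} {H : Hyperplane n} :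
    H ∈ Ω.specFinset ℓ ↔ Ω.eig ℓ H ≠ ⊥ := by
  simp [specFinset]

theorem dependsOn_of_mem_specFinset {ℓ : Fin n} {Ω : PfaffianForm n V} {H : Hyperplane n}
    (h : H ∈ Ω.specFinset ℓ) : H.DependsOn ℓ :=
  Ω.dependsOn_of_eig ℓ H (mem_specFinset.1 h)

theorem eventually_specFinset_injOn (ℓ : Fin n) (Ω : PfaffianForm n V) :
    ∀ᶠ x in genericFilter n,
      Set.InjOn (fun H : Hyperplane n => H.root ℓ x) (Ω.specFinset ℓ) :=
  Hyperplane.eventually_root_injOn ℓ _ fun _ h => dependsOn_of_mem_specFinset h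

theorem disjoint_eig (ℓ : Fin n) (Ω : PfaffianForm n V) (H : Hyperplane n) :
    Disjoint (Ω.eig ℓ H) (⨆ H' : {H' // H' ≠ H}, Ω.eig ℓ H'.1) := by
  by_cases hH : Ω.eig ℓ H = ⊥
  · rw [hH]; exact disjoint_bot_left
  obtain ⟨x, hx⟩ := (Ω.eventually_specFinset_injOn ℓ).exists
  refine ((Module.End.eigenspaces_iSupIndep (Ω.S ℓ x)) (H.root ℓ x)).mono ?_ ?_
  · intro v hv
    exact Module.End.mem_eigenspace_iff.2
      (Ω.eig_apply ℓ H (Ω.dependsOn_of_eig ℓ H hH) hv x)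
  · refine iSup_le fun ⟨K, hK⟩ => ?_
    by_cases hK0 : Ω.eig ℓ K = ⊥
    · simp [hK0]
    have hne : K.root ℓ x ≠ H.root ℓ x := fun e =>
      hK (hx (mem_specFinset.2 hK0) (mem_specFinset.2 hH) e)
    refine le_trans ?_ (le_iSup₂ (f := fun μ (_ : μ ≠ H.root ℓ x) =>
      Module.End.eigenspace (Ω.S ℓ x) μ) (K.root ℓ x) hne)
    intro v hv
    exact Module.End.mem_eigenspace_iff.2
      (Ω.eig_apply ℓ K (Ω.dependsOn_of_eig ℓ K hK0) hv x)

namespace IsSpectral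

variable {ℓ : Fin n} {Ω : PfaffianForm n V} (hΩ : Ω.IsSpectral ℓ)

include hΩ

theorem isCompl (H : Hyperplane n) :
    IsCompl (Ω.eig ℓ H) (⨆ H' : {H' // H' ≠ H}, Ω.eig ℓ H'.1) := by
  refine ⟨Ω.disjoint_eig ℓ H, codisjoint_iff.2 (top_unique ?_)⟩
  rw [← show ⨆ H, Ω.eig ℓ H = ⊤ from hΩ]
  refine iSup_le fun K => ?_
  by_cases hK : K = H
  · subst hK; exact le_sup_left
  · exact le_trans (le_iSup (fun H' : {H' // H' ≠ H} => Ω.eig ℓ H'.1) ⟨K, hK⟩) le_sup_right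

theorem eigProj_mem (H : Hyperplane n) (v : V) : Ω.eigProj ℓ H v ∈ Ω.eig ℓ H := by
  rw [eigProj, dif_pos (hΩ.isCompl H)]
  exact Submodule.projection_apply_mem _ _

theorem eigProj_apply_mem {H : Hyperplane n} {v : V} (hv : v ∈ Ω.eig ℓ H) :
    Ω.eigProj ℓ H v = v := by
  rw [eigProj, dif_pos (hΩ.isCompl H)]
  exact Submodule.projection_apply_of_mem_left _ hv

theorem eigProj_apply_of_ne {H K : Hyperplane n} (hK : K ≠ H) {v : V} (hv : v ∈ Ω.eig ℓ K) :
    Ω.eigProj ℓ H v = 0 := by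
  rw [eigProj, dif_pos (hΩ.isCompl H), Submodule.projection_apply_eq_zero_iff]
  exact le_iSup (fun H' : {H' // H' ≠ H} => Ω.eig ℓ H'.1) ⟨K, hK⟩ hv

open scoped Classical in
theorem eigProj_mul (H K : Hyperplane n) :
    Ω.eigProj ℓ H * Ω.eigProj ℓ K = if H = K then Ω.eigProj ℓ H else 0 := by
  ext v
  rw [Module.End.mul_apply]
  split_ifs with h
  · subst h; exact hΩ.eigProj_apply_mem (hΩ.eigProj_mem H v)
  · exact hΩ.eigProj_apply_of_ne (Ne.symm h) (hΩ.eigProj_mem K v)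

theorem sum_eigProj_apply_of_mem {H : Hyperplane n} {v : V} (hv : v ∈ Ω.eig ℓ H)
    (c : Hyperplane n → ℂ) : ∑ K ∈ Ω.specFinset ℓ, c K • Ω.eigProj ℓ K v = c H • v := by
  by_cases hH : Ω.eig ℓ H = ⊥
  · rw [hH, Submodule.mem_bot] at hv
    simp [hv]
  rw [Finset.sum_eq_single H, hΩ.eigProj_apply_mem hv]
  · intro K _ hK
    rw [hΩ.eigProj_apply_of_ne (Ne.symm hK) hv, smul_zero]
  · exact fun h => absurd (mem_specFinset.2 hH) h

theorem sum_eigProj : ∑ H ∈ Ω.specFinset ℓ, Ω.eigProj ℓ H = 1 := by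
  refine hΩ.ext fun H _ v hv => ?_
  simpa using hΩ.sum_eigProj_apply_of_mem hv fun _ => 1

theorem S_eq_sum (x : Fin n → ℂ) :
    Ω.S ℓ x = ∑ H ∈ Ω.specFinset ℓ, H.root ℓ x • Ω.eigProj ℓ H := by
  refine hΩ.ext fun H hH v hv => ?_
  simpa [Ω.eig_apply ℓ H hH hv x] using
    (hΩ.sum_eigProj_apply_of_mem hv fun K => K.root ℓ x).symm

theorem lin_eq_sum {j : Fin n} (hj : j ≠ ℓ) :
    Ω.lin ℓ j = ∑ H ∈ Ω.specFinset ℓ, H.slope ℓ j • Ω.eigProj ℓ H := by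
  refine hΩ.ext fun H hH v hv => ?_
  simpa [Ω.lin_apply_of_mem_eig ℓ H hH hv hj] using
    (hΩ.sum_eigProj_apply_of_mem hv fun K => K.slope ℓ j).symm

theorem eigProj_ne_zero_iff (H : Hyperplane n) : Ω.eigProj ℓ H ≠ 0 ↔ Ω.eig ℓ H ≠ ⊥ := by
  refine ⟨fun h h' => h (Ω.eigProj_eq_zero ℓ H h'), fun h h' => h ?_⟩
  rw [Submodule.eq_bot_iff]
  intro v hv
  rw [← hΩ.eigProj_apply_mem hv, h', LinearMap.zero_apply]

theorem sum_smul_eigProj_mul (c d : Hyperplane n → ℂ) :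
    (∑ H ∈ Ω.specFinset ℓ, c H • Ω.eigProj ℓ H) * (∑ H ∈ Ω.specFinset ℓ, d H • Ω.eigProj ℓ H) =
      ∑ H ∈ Ω.specFinset ℓ, (c H * d H) • Ω.eigProj ℓ H := by
  classical
  rw [Finset.sum_mul_sum]
  refine Finset.sum_congr rfl fun H hH => ?_
  rw [Finset.sum_eq_single H]
  · rw [smul_mul_smul_comm, hΩ.eigProj_mul, if_pos rfl]
  · intro K _ hK
    rw [smul_mul_smul_comm, hΩ.eigProj_mul, if_neg (Ne.symm hK), smul_zero]
  · exact fun h => absurd hH h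

theorem commute_sum (c d : Hyperplane n → ℂ) :
    Commute (∑ H ∈ Ω.specFinset ℓ, c H • Ω.eigProj ℓ H)
      (∑ H ∈ Ω.specFinset ℓ, d H • Ω.eigProj ℓ H) := by
  rw [Commute, SemiconjBy, hΩ.sum_smul_eigProj_mul, hΩ.sum_smul_eigProj_mul]
  simp only [mul_comm]

theorem commute_S_lin (x : Fin n → ℂ) (j : Fin n) : Commute (Ω.S ℓ x) (Ω.lin ℓ j) := by
  by_cases hj : j = ℓ
  · subst hj; simp [Ω.lin_self]
  · rw [hΩ.S_eq_sum, hΩ.lin_eq_sum hj]; exact hΩ.commute_sum _ _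

theorem commute_lin_lin (i j : Fin n) : Commute (Ω.lin ℓ i) (Ω.lin ℓ j) := by
  by_cases hj : j = ℓ
  · subst hj; simp [Ω.lin_self]
  by_cases hi : i = ℓ
  · subst hi; simp [Ω.lin_self]
  · rw [hΩ.lin_eq_sum hi, hΩ.lin_eq_sum hj]; exact hΩ.commute_sum _ _

/-- At a generic point, the spectral projections are polynomials in `S_{x_ℓ}`. -/
theorem eventually_exists_aeval :
    ∀ᶠ x in genericFilter n, ∀ H, ∃ p : Polynomial ℂ,
      Ω.eigProj ℓ H = Polynomial.aeval (Ω.S ℓ x) p := by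
  classical
  filter_upwards [Ω.eventually_specFinset_injOn ℓ] with x hx H
  by_cases hH : Ω.eig ℓ H = ⊥
  · exact ⟨0, by rw [Ω.eigProj_eq_zero ℓ H hH, map_zero]⟩
  have hHs := mem_specFinset.2 hH
  refine ⟨Lagrange.basis (Ω.specFinset ℓ) (fun H => H.root ℓ x) H, hΩ.ext fun K hK v hv => ?_⟩
  by_cases hv0 : v = 0
  · simp [hv0]
  have hKs : K ∈ Ω.specFinset ℓ :=
    mem_specFinset.2 fun h => hv0 (by rwa [h, Submodule.mem_bot] at hv)
  rw [Module.End.aeval_apply_of_hasEigenvector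
    (Module.End.hasEigenvector_iff.2
      ⟨Module.End.mem_eigenspace_iff.2 (Ω.eig_apply ℓ K hK hv x), hv0⟩)]
  by_cases hKH : K = H
  · subst hKH
    rw [hΩ.eigProj_apply_mem hv, Lagrange.eval_basis_self hx hKs, one_smul]
  · rw [hΩ.eigProj_apply_of_ne hKH hv,
      Lagrange.eval_basis_of_ne (v := fun H => H.root ℓ x) (Ne.symm hKH) hKs, zero_smul]

theorem eigProj_mem_of_invariant {U : Submodule ℂ V} (h0 : U ≤ U.comap (Ω.cst ℓ))
    (hl : ∀ j, j ≠ ℓ → U ≤ U.comap (Ω.lin ℓ j)) (H : Hyperplane n) :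
    U ≤ U.comap (Ω.eigProj ℓ H) := by
  obtain ⟨x, hx⟩ := hΩ.eventually_exists_aeval.exists
  obtain ⟨p, hp⟩ := hx H
  have hS : ∀ u ∈ U, Ω.S ℓ x u ∈ U := by
    intro u hu
    rw [S, LinearMap.add_apply, LinearMap.sum_apply]
    refine U.add_mem (h0 hu) (U.sum_mem fun j _ => ?_)
    by_cases hj : j = ℓ
    · subst hj; simp [Ω.lin_self]
    · exact U.smul_mem _ (hl j hj hu)
  intro u hu
  rw [Submodule.mem_comap, hp]
  clear hp
  induction p using Polynomial.induction_on' with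
  | add p q hp hq => rw [map_add, LinearMap.add_apply]; exact U.add_mem hp hq
  | monomial k a =>
    rw [Polynomial.aeval_monomial, Module.End.mul_apply, Module.algebraMap_end_apply]
    refine U.smul_mem _ ?_
    induction k with
    | zero => simpa using hu
    | succ k ih => rw [pow_succ', Module.End.mul_apply]; exact hS _ ih

/-- The values `a_H` are distinct at a generic point, so commuting with `S_{x_ℓ}` at one such point is
enough to preserve the common eigenspaces. -/
theorem eventually_commute_eigProj :
    ∀ᶠ x in genericFilter n, ∀ X : Module.End ℂ V, Commute (Ω.S ℓ x) X →
      ∀ H, Commute (Ω.eigProj ℓ H) X := by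
  filter_upwards [hΩ.eventually_exists_aeval] with x hx X hX H
  obtain ⟨p, hp⟩ := hx H
  rw [hp]
  clear hp
  induction p using Polynomial.induction_on' with
  | add p q hp hq => rw [map_add]; exact hp.add_left hq
  | monomial k a =>
    rw [Polynomial.aeval_monomial]
    exact (Algebra.commute_algebraMap_left a X).mul_left (hX.pow_left k)

end IsSpectral

theorem maxGenEigenspace_eq_of_isDiagonalizable {f : Module.End ℂ V} (hf : IsDiagonalizable f)
    (μ : ℂ) : f.maxGenEigenspace μ = f.eigenspace μ := by
  refine le_antisymm ?_ ((Module.End.genEigenspace f μ).mono le_top)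
  have h := Submodule.eq_iSup_inf_genEigenspace (f := f) (p := f.maxGenEigenspace μ) 1
    (fun x hx => Module.End.mapsTo_maxGenEigenspace_of_comm (Commute.refl f) μ hx) hf
  rw [h]
  refine iSup_le fun ν => ?_
  by_cases hν : ν = μ
  · subst hν; exact inf_le_right
  · have : Disjoint (f.maxGenEigenspace μ) (f.eigenspace ν) :=
      Module.End.disjoint_genEigenspace f (Ne.symm hν) ⊤ 1
    exact this.eq_bot.trans_le bot_le

/-- Commuting diagonalizable endomorphisms are simultaneously diagonalizable: the common eigenspace
for a tuple of eigenvalues is `Ω.eig ℓ H` for the hyperplane `H` with these coefficients. -/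
theorem isSpectral_of_commute {ℓ : Fin n} {Ω : PfaffianForm n V} (h0 : IsDiagonalizable (Ω.cst ℓ))
    (hl : ∀ j, j ≠ ℓ → IsDiagonalizable (Ω.lin ℓ j))
    (hc : ∀ j, Commute (Ω.cst ℓ) (Ω.lin ℓ j)) (hc' : ∀ i j, Commute (Ω.lin ℓ i) (Ω.lin ℓ j)) :
    Ω.IsSpectral ℓ := by
  set f : Fin n → Module.End ℂ V := fun i => if i = ℓ then Ω.cst ℓ else Ω.lin ℓ i with hf
  have hdiag : ∀ i, IsDiagonalizable (f i) := by
    intro i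
    by_cases hi : i = ℓ
    · simpa [hf, hi] using h0
    · simpa [hf, hi] using hl i hi
  have hcomm : Pairwise fun i j => Commute (f i) (f j) := by
    intro i j _
    simp only [hf]
    split_ifs
    · exact Commute.refl _
    · exact hc j
    · exact (hc i).symm
    · exact hc' i j
  have htop := Module.End.iSup_iInf_maxGenEigenspace_eq_top_of_iSup_maxGenEigenspace_eq_top_of_commute
    f hcomm (fun i => by
      simp_rw [maxGenEigenspace_eq_of_isDiagonalizable (hdiag i)]; exact hdiag i)
  simp_rw [fun i μ => maxGenEigenspace_eq_of_isDiagonalizable (hdiag i) μ] at htop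
  -- the tuple `χ` of eigenvalues belongs to the hyperplane `x_ℓ = χ_ℓ + ∑ χ_j x_j`
  set c : (Fin n → ℂ) → Fin n → ℂ := fun χ j => if j = ℓ then 1 else -χ j with hc_def
  have hcne : ∀ χ, c χ ≠ 0 := fun χ h => by simpa [hc_def] using congrFun h ℓ
  refine isSpectral_of_iSup _ (fun χ => Hyperplane.ofCoeffs (c χ) (-χ ℓ) (hcne χ)) ?_ htop
  intro χ v hv
  rw [Submodule.mem_iInf] at hv
  have hv : ∀ i, f i v = χ i • v := fun i => Module.End.mem_eigenspace_iff.1 (hv i)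
  intro x hx
  have hx : ∑ i, c χ i * x i + -χ ℓ = 0 := hx
  have hv0 : Ω.cst ℓ v = χ ℓ • v := by simpa [hf] using hv ℓ
  have hsum : ∑ j, (x j • Ω.lin ℓ j) v = (∑ j ∈ Finset.univ.erase ℓ, χ j * x j) • v := by
    rw [← Finset.add_sum_erase _ _ (Finset.mem_univ ℓ), Ω.lin_self, Finset.sum_smul]
    simp only [smul_zero, LinearMap.zero_apply, zero_add]
    refine Finset.sum_congr rfl fun j hj => ?_
    have := hv j
    simp only [hf, (Finset.mem_erase.1 hj).1, if_false] at this
    rw [LinearMap.smul_apply, this, smul_smul, mul_comm]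
  rw [S, LinearMap.add_apply, LinearMap.sum_apply, hsum, hv0, ← add_smul]
  congr 1
  rw [← Finset.add_sum_erase _ _ (Finset.mem_univ ℓ), Finset.sum_congr rfl
    (g := fun j => -(χ j * x j)), Finset.sum_neg_distrib] at hx
  · simp only [hc_def, if_true] at hx
    linear_combination -hx
  · intro j hj
    simp [hc_def, (Finset.mem_erase.1 hj).1]

/-- The components of `det (x_ℓ - S_{x_ℓ}) = 0` are the hyperplanes with nonzero common
eigenspace. -/
theorem IsSpectral.charArr_eq {ℓ : Fin n} {Ω : PfaffianForm n V} (hΩ : Ω.IsSpectral ℓ) :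
    Ω.charArr ℓ = {H | Ω.eig ℓ H ≠ ⊥} := by
  have hdet : ∀ x : Fin n → ℂ, LinearMap.det (x ℓ • (1 : Module.End ℂ V) - Ω.S ℓ x) = 0 ↔
      ∃ v : V, v ≠ 0 ∧ Ω.S ℓ x v = x ℓ • v := by
    intro x
    rw [← not_iff_not, ← ne_eq, ← isUnit_iff_ne_zero, ← LinearMap.isUnit_iff_isUnit_det,
      LinearMap.isUnit_iff_ker_eq_bot, Submodule.eq_bot_iff]
    simp only [LinearMap.mem_ker, LinearMap.sub_apply, LinearMap.smul_apply, Module.End.one_apply,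
      sub_eq_zero]
    constructor
    · rintro h ⟨v, hv, hv'⟩
      exact hv (h v hv'.symm)
    · intro h v hv
      by_contra hv0
      exact h ⟨v, hv0, hv.symm⟩
  have hroot : ∀ (x : Fin n → ℂ) (v : V), v ≠ 0 → Ω.S ℓ x v = x ℓ • v →
      ∃ K ∈ Ω.specFinset ℓ, x ℓ = K.root ℓ x := by
    intro x v hv hSv
    by_contra! hK
    apply hv
    have h1 := LinearMap.congr_fun hΩ.sum_eigProj v
    rw [LinearMap.sum_apply, Module.End.one_apply] at h1
    rw [← h1]
    refine Finset.sum_eq_zero fun K hKs => ?_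
    have h2 : Ω.eigProj ℓ K (Ω.S ℓ x v) = K.root ℓ x • Ω.eigProj ℓ K v := by
      classical
      rw [hΩ.S_eq_sum, LinearMap.sum_apply, map_sum, Finset.sum_eq_single K]
      · rw [LinearMap.smul_apply, map_smul, ← Module.End.mul_apply, hΩ.eigProj_mul, if_pos rfl]
      · intro L _ hL
        rw [LinearMap.smul_apply, map_smul, ← Module.End.mul_apply, hΩ.eigProj_mul,
          if_neg (Ne.symm hL)]
        simp
      · exact fun h => absurd hKs h
    rw [hSv, map_smul, ← sub_eq_zero, ← sub_smul] at h2
    exact (smul_eq_zero.1 h2).resolve_left (sub_ne_zero.2 (hK K hKs))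
  ext H
  constructor
  · intro hH
    have hH : ∀ x ∈ H.carrier, LinearMap.det (x ℓ • (1 : Module.End ℂ V) - Ω.S ℓ x) = 0 := hH
    by_contra hbot
    have hHs : H ∉ Ω.specFinset ℓ := fun h => hbot (mem_specFinset.1 h)
    by_cases hd : H.DependsOn ℓ
    · have : ∀ᶠ x in genericFilter n, ∀ K ∈ Ω.specFinset ℓ, H.root ℓ x ≠ K.root ℓ x := by
        rw [Filter.eventually_all_finset]
        intro K hK
        exact Hyperplane.eventually_root_ne ℓ hd (dependsOn_of_mem_specFinset hK)
          fun e => hHs (e ▸ hK)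
      obtain ⟨x, hx⟩ := this.exists
      have hmem : Function.update x ℓ (H.root ℓ x) ∈ H.carrier := by
        rw [H.mem_iff_root ℓ hd, H.root_update ℓ hd]; simp
      obtain ⟨v, hv, hSv⟩ := (hdet _).1 (hH _ hmem)
      obtain ⟨K, hK, hKx⟩ := hroot _ v hv hSv
      rw [K.root_update ℓ (dependsOn_of_mem_specFinset hK), Function.update_self] at hKx
      exact hx K hK hKx
    · -- a hyperplane parallel to the `x_ℓ`-axis would give infinitely many eigenvalues
      obtain ⟨i, hi⟩ := Function.ne_iff.1 H.coeff_ne_zero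
      have hi : H.coeff i ≠ 0 := hi
      set x : Fin n → ℂ := Pi.single i (-H.const / H.coeff i) with hx
      have hx0 : H.poly x = 0 := by
        rw [Hyperplane.poly, Finset.sum_eq_single i]
        · rw [hx, Pi.single_eq_same]; field_simp; ring
        · intro j _ hj; simp [hx, hj]
        · simp
      obtain ⟨t, ht⟩ := Infinite.exists_notMem_finset
        ((Ω.specFinset ℓ).image fun K => K.root ℓ x)
      have hmem : Function.update x ℓ t ∈ H.carrier := by
        rw [H.mem_iff, H.poly_update ℓ hd, hx0]
      obtain ⟨v, hv, hSv⟩ := (hdet _).1 (hH _ hmem)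
      obtain ⟨K, hK, hKx⟩ := hroot _ v hv hSv
      rw [K.root_update ℓ (dependsOn_of_mem_specFinset hK), Function.update_self] at hKx
      exact ht (Finset.mem_image.2 ⟨K, hK, hKx.symm⟩)
  · intro hH x hx
    obtain ⟨v, hv, hv0⟩ := (Submodule.ne_bot_iff _).1 hH
    exact (hdet x).2 ⟨v, hv0, hv x hx⟩

end Spectral

end PfaffianForm

/-! ### Consequences of integrability -/

/-- Partial fraction expansion of a commutator of two rational functions with simple poles and
proportional residues. -/
theorem lie_partialFraction {L ι : Type*} [LieRing L] [LieAlgebra ℂ L] (s : Finset ι)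
    (a : ι → ℂ) (ha : Set.InjOn a s) (p₀ p₁ q₀ q₁ : L) (r : ι → L) (u v : ι → ℂ) (t : ℂ)
    (ht : ∀ i ∈ s, t ≠ a i) :
    ⁅p₀ + t • p₁ + ∑ i ∈ s, (u i * (t - a i)⁻¹) • r i,
      q₀ + t • q₁ + ∑ i ∈ s, (v i * (t - a i)⁻¹) • r i⁆ =
    (⁅p₀, q₀⁆ + ∑ i ∈ s, v i • ⁅p₁, r i⁆ + ∑ i ∈ s, u i • ⁅r i, q₁⁆) +
      t • (⁅p₀, q₁⁆ + ⁅p₁, q₀⁆) + t ^ 2 • ⁅p₁, q₁⁆ +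
      ∑ i ∈ s, (t - a i)⁻¹ • (v i • ⁅p₀ + a i • p₁, r i⁆ + u i • ⁅r i, q₀ + a i • q₁⁆ +
        ∑ j ∈ s, ((u i * v j - u j * v i) / (a i - a j)) • ⁅r i, r j⁆) := by
  classical
  have hdouble : ⁅∑ i ∈ s, (u i * (t - a i)⁻¹) • r i, ∑ j ∈ s, (v j * (t - a j)⁻¹) • r j⁆ =
      ∑ i ∈ s, (t - a i)⁻¹ • ∑ j ∈ s, ((u i * v j - u j * v i) / (a i - a j)) • ⁅r i, r j⁆ := by
    have h1 : ⁅∑ i ∈ s, (u i * (t - a i)⁻¹) • r i, ∑ j ∈ s, (v j * (t - a j)⁻¹) • r j⁆ =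
        ∑ i ∈ s, ∑ j ∈ s, (u i * v j / (a i - a j) * (t - a i)⁻¹) • ⁅r i, r j⁆ +
        ∑ i ∈ s, ∑ j ∈ s, (-(u i * v j / (a i - a j) * (t - a j)⁻¹)) • ⁅r i, r j⁆ := by
      rw [← Finset.sum_add_distrib, sum_lie]
      refine Finset.sum_congr rfl fun i hi => ?_
      rw [← Finset.sum_add_distrib, lie_sum]
      refine Finset.sum_congr rfl fun j hj => ?_
      rw [← add_smul, smul_lie, lie_smul, smul_smul]
      by_cases hij : i = j
      · subst hij
        rw [lie_self, smul_zero, smul_zero]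
      · have h1 : a i - a j ≠ 0 := sub_ne_zero.2 fun e => hij (ha hi hj e)
        have h2 := sub_ne_zero.2 (ht i hi)
        have h3 := sub_ne_zero.2 (ht j hj)
        congr 1
        field_simp
        ring
    rw [h1, Finset.sum_comm
      (f := fun i j => (-(u i * v j / (a i - a j) * (t - a j)⁻¹)) • ⁅r i, r j⁆),
      ← Finset.sum_add_distrib]
    refine Finset.sum_congr rfl fun i _ => ?_
    rw [Finset.smul_sum, ← Finset.sum_add_distrib]
    refine Finset.sum_congr rfl fun j _ => ?_
    rw [← lie_skew (r i) (r j), smul_neg, smul_neg, smul_neg, smul_smul, ← neg_smul, ← neg_smul,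
      ← add_smul]
    congr 1
    rw [← neg_sub (a i) (a j), div_neg]
    ring
  have hpole : ∀ (m₀ m₁ : L) (w : ι → ℂ),
      ⁅m₀ + t • m₁, ∑ i ∈ s, (w i * (t - a i)⁻¹) • r i⁆ =
        ∑ i ∈ s, w i • ⁅m₁, r i⁆ + ∑ i ∈ s, (t - a i)⁻¹ • w i • ⁅m₀ + a i • m₁, r i⁆ := by
    intro m₀ m₁ w
    rw [lie_sum, ← Finset.sum_add_distrib]
    refine Finset.sum_congr rfl fun i hi => ?_
    have h : t = (t - a i) + a i := by ring
    have h0 := sub_ne_zero.2 (ht i hi)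
    rw [lie_smul, add_lie, add_lie, smul_lie, smul_lie, smul_add, smul_add, smul_add, smul_smul,
      smul_smul, smul_smul, smul_smul, add_left_comm, ← add_smul, mul_comm (w i)]
    congr 2
    field_simp
    ring
  have hpole' : ⁅∑ i ∈ s, (u i * (t - a i)⁻¹) • r i, q₀ + t • q₁⁆ =
      ∑ i ∈ s, u i • ⁅r i, q₁⁆ + ∑ i ∈ s, (t - a i)⁻¹ • u i • ⁅r i, q₀ + a i • q₁⁆ := by
    rw [← lie_skew, hpole, neg_add, ← Finset.sum_neg_distrib, ← Finset.sum_neg_distrib]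
    congr 1 <;>
    · refine Finset.sum_congr rfl fun i _ => ?_
      rw [← lie_skew (r i)]
      simp only [smul_neg]
  have hpoly : ⁅p₀ + t • p₁, q₀ + t • q₁⁆ =
      ⁅p₀, q₀⁆ + t • (⁅p₀, q₁⁆ + ⁅p₁, q₀⁆) + t ^ 2 • ⁅p₁, q₁⁆ := by
    simp only [add_lie, lie_add, smul_lie, lie_smul, smul_add, smul_smul, pow_two]
    abel
  rw [add_lie, lie_add, lie_add _ (q₀ + t • q₁), hdouble, hpole, hpole', hpoly]
  simp only [smul_add, Finset.sum_add_distrib]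
  abel

/-- If two rational functions with simple poles and proportional residues commute, then the
coefficients of the partial fraction expansion of their commutator vanish. -/
theorem commute_partialFraction {A ι : Type*} [Ring A] [Algebra ℂ A] (s : Finset ι)
    (a : ι → ℂ) (ha : Set.InjOn a s) (p₀ p₁ q₀ q₁ : A) (r : ι → A) (u v : ι → ℂ)
    (hpq : Commute p₁ q₁)
    (h : ∀ᶠ t : ℂ in cofinite, Commute (p₀ + t • p₁ + ∑ i ∈ s, (u i * (t - a i)⁻¹) • r i)
      (q₀ + t • q₁ + ∑ i ∈ s, (v i * (t - a i)⁻¹) • r i)) :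
    ((p₀ * q₀ - q₀ * p₀) + ∑ i ∈ s, v i • (p₁ * r i - r i * p₁) +
      ∑ i ∈ s, u i • (r i * q₁ - q₁ * r i) = 0) ∧
    ((p₀ * q₁ - q₁ * p₀) + (p₁ * q₀ - q₀ * p₁) = 0) ∧
    ∀ i ∈ s, v i • ((p₀ + a i • p₁) * r i - r i * (p₀ + a i • p₁)) +
      u i • (r i * (q₀ + a i • q₁) - (q₀ + a i • q₁) * r i) +
        ∑ j ∈ s, ((u i * v j - u j * v i) / (a i - a j)) • (r i * r j - r j * r i) = 0 := by
  let _ := LieRing.ofAssociativeRing (A := A)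
  have hne : ∀ᶠ t : ℂ in cofinite, ∀ i ∈ s, t ≠ a i := by
    rw [Filter.eventually_all_finset]
    intro i _
    exact (Set.finite_singleton (a i)).subset fun t ht => by simpa using ht
  refine partialFraction_unique s a ha _ _ _ ?_
  filter_upwards [h, hne] with t ht htne
  have key := lie_partialFraction s a ha p₀ p₁ q₀ q₁ r u v t htne
  simp only [LieRing.of_associative_ring_bracket] at key
  rw [ht.eq, sub_self, hpq.eq, sub_self, smul_zero, add_zero] at key
  exact key.symm

namespace PfaffianForm

section Regular

variable {n : ℕ} {V : Type*} [AddCommGroup V] [Module ℂ V]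

open scoped Classical in
/-- The part of the coefficient of `dx_i` in `Ω` that does not involve `x_ℓ`:
`A_{x_i} + ∑_{j ≠ ℓ} A_{x_i x_j} x_j + ∑_K A_K (f_K)_{x_i} / f_K`, with `K` running over the
hyperplanes that do not depend on `x_ℓ`. -/
noncomputable def reg (ℓ : Fin n) (Ω : PfaffianForm n V) (i : Fin n) (x : Fin n → ℂ) :
    Module.End ℂ V :=
  Ω.cst i + ∑ j, (if j = ℓ then 0 else x j) • Ω.lin i j +
    Ω.res.sum fun K A => (if K.DependsOn ℓ then 0 else K.coeff i / K.poly x) • A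

theorem mem_polar {ℓ : Fin n} {Ω : PfaffianForm n V} {H : Hyperplane n} :
    H ∈ Ω.polar ℓ ↔ Ω.res H ≠ 0 ∧ H.DependsOn ℓ := by
  simp [polar]

theorem dependsOn_of_mem_polar {ℓ : Fin n} {Ω : PfaffianForm n V} {H : Hyperplane n}
    (h : H ∈ Ω.polar ℓ) : H.DependsOn ℓ :=
  (mem_polar.1 h).2

theorem coeffAt_eq (ℓ : Fin n) (Ω : PfaffianForm n V) (i : Fin n) (x : Fin n → ℂ) :
    Ω.coeffAt i x = Ω.reg ℓ i x + x ℓ • Ω.lin i ℓ +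
      ∑ H ∈ Ω.polar ℓ, (-H.slope ℓ i * (x ℓ - H.root ℓ x)⁻¹) • Ω.res H := by
  classical
  have h1 : ∑ j, x j • Ω.lin i j =
      ∑ j, (if j = ℓ then 0 else x j) • Ω.lin i j + x ℓ • Ω.lin i ℓ := by
    rw [← Finset.add_sum_erase _ _ (Finset.mem_univ ℓ),
      ← Finset.add_sum_erase _ (fun j => (if j = ℓ then 0 else x j) • Ω.lin i j)
        (Finset.mem_univ ℓ), if_pos rfl, zero_smul, zero_add, add_comm]
    congr 1
    exact Finset.sum_congr rfl fun j hj => by rw [if_neg (Finset.mem_erase.1 hj).1]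
  have h2 : (Ω.res.sum fun H A => (H.coeff i / H.poly x) • A) =
      (Ω.res.sum fun K A => (if K.DependsOn ℓ then 0 else K.coeff i / K.poly x) • A) +
      ∑ H ∈ Ω.polar ℓ, (-H.slope ℓ i * (x ℓ - H.root ℓ x)⁻¹) • Ω.res H := by
    rw [polar, Finset.sum_filter, Finsupp.sum, Finsupp.sum, ← Finset.sum_add_distrib]
    refine Finset.sum_congr rfl fun H _ => ?_
    split_ifs with hd
    · rw [zero_smul, zero_add, H.coeff_div_poly ℓ hd]
    · rw [add_zero]
  rw [coeffAt, S, h1, h2, reg]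
  abel

theorem reg_update (ℓ : Fin n) (Ω : PfaffianForm n V) (i : Fin n) (x : Fin n → ℂ) (t : ℂ) :
    Ω.reg ℓ i (Function.update x ℓ t) = Ω.reg ℓ i x := by
  unfold reg
  congr 2
  · refine Finset.sum_congr rfl fun j _ => ?_
    by_cases hj : j = ℓ
    · simp [hj]
    · simp [hj]
  · funext K A
    by_cases hK : K.DependsOn ℓ
    · simp [hK]
    · rw [K.poly_update ℓ hK]

theorem reg_self (ℓ : Fin n) (Ω : PfaffianForm n V) (x : Fin n → ℂ) :
    Ω.reg ℓ ℓ x = Ω.S ℓ x := by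
  rw [reg, S, Finsupp.sum, Finset.sum_eq_zero (s := Ω.res.support), add_zero]
  · congr 1
    refine Finset.sum_congr rfl fun j _ => ?_
    by_cases hj : j = ℓ
    · subst hj; simp [Ω.lin_self]
    · simp [hj]
  · intro K _
    split_ifs with hK
    · simp
    · simp [show K.coeff ℓ = 0 from not_not.1 hK]

theorem eventually_polar_injOn (ℓ : Fin n) (Ω : PfaffianForm n V) :
    ∀ᶠ x in genericFilter n, Set.InjOn (fun H : Hyperplane n => H.root ℓ x) (Ω.polar ℓ) :=
  Hyperplane.eventually_root_injOn ℓ _ fun _ h => dependsOn_of_mem_polar h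

theorem eventually_notMem_carrier (Ω : PfaffianForm n V) :
    ∀ᶠ x in genericFilter n, ∀ H ∈ Ω.res.support, x ∉ H.carrier := by
  rw [Filter.eventually_all_finset]
  intro H _
  filter_upwards [H.eventually_poly_ne_zero] with x hx
  rwa [H.mem_iff]

/-- The coefficient of `dx_i` as a function of `x_ℓ`. -/
theorem coeffAt_update (ℓ : Fin n) (Ω : PfaffianForm n V) (i : Fin n) (x : Fin n → ℂ) (t : ℂ) :
    Ω.coeffAt i (Function.update x ℓ t) = Ω.reg ℓ i x + t • Ω.lin i ℓ +
      ∑ H ∈ Ω.polar ℓ, (-H.slope ℓ i * (t - H.root ℓ x)⁻¹) • Ω.res H := by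
  rw [coeffAt_eq ℓ, reg_update, Function.update_self]
  congr 1
  refine Finset.sum_congr rfl fun H hH => ?_
  rw [H.root_update ℓ (dependsOn_of_mem_polar hH)]

theorem Integrable.eventually_commute {Ω : PfaffianForm n V} (hΩ : Ω.Integrable) (ℓ : Fin n) :
    ∀ᶠ x in genericFilter n, ∀ i j, ∀ᶠ t : ℂ in cofinite,
      Commute (Ω.coeffAt i (Function.update x ℓ t)) (Ω.coeffAt j (Function.update x ℓ t)) := by
  filter_upwards [eventually_generic_update Ω.eventually_notMem_carrier ℓ] with x hx i j
  filter_upwards [hx] with t ht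
  exact hΩ _ ht i j

/-- The relations between the coefficients that express the commutation of the coefficients of
`dx_ℓ` and `dx_i`. -/
theorem Integrable.eventually_relations {Ω : PfaffianForm n V} (hΩ : Ω.Integrable) (ℓ : Fin n) :
    ∀ᶠ x in genericFilter n, ∀ i,
      Commute (Ω.S ℓ x) (Ω.lin ℓ i) ∧
      (Ω.S ℓ x * Ω.reg ℓ i x - Ω.reg ℓ i x * Ω.S ℓ x) +
        ((∑ H ∈ Ω.polar ℓ, Ω.res H) * Ω.lin ℓ i -
          Ω.lin ℓ i * (∑ H ∈ Ω.polar ℓ, Ω.res H)) = 0 ∧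
      ∀ H ∈ Ω.polar ℓ, Commute (Ω.res H)
        (Ω.reg ℓ i x + H.root ℓ x • Ω.lin ℓ i + H.slope ℓ i • Ω.S ℓ x +
          ∑ H' ∈ Ω.polar ℓ,
            ((H.slope ℓ i - H'.slope ℓ i) / (H.root ℓ x - H'.root ℓ x)) • Ω.res H') := by
  filter_upwards [hΩ.eventually_commute ℓ, Ω.eventually_polar_injOn ℓ] with x hx hinj i
  obtain ⟨h0, h1, h2⟩ := commute_partialFraction (Ω.polar ℓ) (fun H => H.root ℓ x) hinj
    (Ω.S ℓ x) (Ω.lin ℓ ℓ) (Ω.reg ℓ i x) (Ω.lin ℓ i) Ω.res (fun _ => 1) (fun H => -H.slope ℓ i)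
    (by rw [Ω.lin_self]; exact Commute.zero_left _) (by
      filter_upwards [hx ℓ i] with t ht
      rw [coeffAt_update, coeffAt_update, reg_self, Ω.lin_symm i ℓ,
        Finset.sum_congr rfl (g := fun H => ((1 : ℂ) * (t - H.root ℓ x)⁻¹) • Ω.res H)] at ht
      · exact ht
      · intro H hH
        rw [H.slope_self ℓ (dependsOn_of_mem_polar hH), neg_neg])
  simp only [Ω.lin_self, zero_mul, mul_zero, sub_self, smul_zero, Finset.sum_const_zero, add_zero,
    one_smul] at h0 h1 h2
  refine ⟨sub_eq_zero.1 h1, ?_, fun H hH => ?_⟩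
  · rw [Finset.sum_mul, Finset.mul_sum, ← Finset.sum_sub_distrib]
    exact h0
  · have := h2 H hH
    rw [commute_iff_eq, ← sub_eq_zero, ← this]
    have e : ∀ H' : Hyperplane n, (1 * -H'.slope ℓ i - 1 * -H.slope ℓ i) / (H.root ℓ x - H'.root ℓ x) =
        (H.slope ℓ i - H'.slope ℓ i) / (H.root ℓ x - H'.root ℓ x) := fun H' => by congr 1; ring
    simp only [e]
    simp only [mul_add, add_mul, Finset.mul_sum, Finset.sum_mul, mul_smul_comm, smul_mul_assoc,
      smul_sub, Finset.sum_sub_distrib, neg_smul]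
    abel

/-- Either the `A_{x_ℓ x_j}` vanish or the roots `a_H` are constant. -/
theorem Admissible.slope_eq_zero_or {ℓ : Fin n} {Ω : PfaffianForm n V} (hΩ : Ω.Admissible ℓ) :
    (∀ j, Ω.lin ℓ j = 0) ∨ ∀ H ∈ Ω.polar ℓ, ∀ j, j ≠ ℓ → H.slope ℓ j = 0 := by
  by_cases h : ∃ j, j ≠ ℓ ∧ ∃ H ∈ Ω.polar ℓ, H.DependsOn j
  · left
    intro j
    by_cases hj : j = ℓ
    · subst hj; exact Ω.lin_self _
    · exact hΩ.inf h j hj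
  · right
    intro H hH j hj
    by_contra hs
    exact h ⟨j, hj, H, hH, (H.slope_ne_zero_iff ℓ (dependsOn_of_mem_polar hH) j).1 hs⟩

/-- `A_{x_ℓ}` and the `A_{x_ℓ x_j}` commute: at generic points `S_{x_ℓ}` commutes with the
`A_{x_ℓ x_j}`, and the coefficients of this affine identity are the commutators. -/
theorem Admissible.isSpectral [FiniteDimensional ℂ V] {ℓ : Fin n} {Ω : PfaffianForm n V}
    (hΩ : Ω.Admissible ℓ) : Ω.IsSpectral ℓ := by
  have key : ∀ i, (Ω.cst ℓ * Ω.lin ℓ i - Ω.lin ℓ i * Ω.cst ℓ = 0) ∧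
      ∀ j, Ω.lin ℓ j * Ω.lin ℓ i - Ω.lin ℓ i * Ω.lin ℓ j = 0 := by
    intro i
    refine affine_unique _ _ ?_
    filter_upwards [hΩ.integrable.eventually_relations ℓ] with x hx
    have := sub_eq_zero.2 (hx i).1.eq
    rw [S, add_mul, mul_add, Finset.sum_mul, Finset.mul_sum] at this
    simp only [smul_mul_assoc, mul_smul_comm] at this
    rw [← this]
    simp only [smul_sub, Finset.sum_sub_distrib]
    abel
  exact isSpectral_of_commute hΩ.diag_cst hΩ.diag_lin
    (fun j => sub_eq_zero.1 (key j).1) (fun i j => sub_eq_zero.1 ((key j).2 i))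

/-- The parts without `x_ℓ` of the coefficients of `dx_i` and `dx_j` commute. In the expansion of the
commutator in `x_ℓ`, the terms that mix polynomial and polar parts drop out, since either the
`A_{x_ℓ x_j}` or the slopes of the poles vanish. -/
theorem Admissible.eventually_commute_reg [FiniteDimensional ℂ V] {ℓ : Fin n}
    {Ω : PfaffianForm n V} (hΩ : Ω.Admissible ℓ) :
    ∀ᶠ x in genericFilter n, ∀ i j, i ≠ ℓ → j ≠ ℓ →
      Commute (Ω.reg ℓ i x) (Ω.reg ℓ j x) := by
  filter_upwards [hΩ.integrable.eventually_commute ℓ, Ω.eventually_polar_injOn ℓ]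
    with x hx hinj i j hi hj
  obtain ⟨h0, -, -⟩ := commute_partialFraction (Ω.polar ℓ) (fun H => H.root ℓ x) hinj
    (Ω.reg ℓ i x) (Ω.lin ℓ i) (Ω.reg ℓ j x) (Ω.lin ℓ j) Ω.res (fun H => -H.slope ℓ i)
    (fun H => -H.slope ℓ j) (hΩ.isSpectral.commute_lin_lin i j) (by
      filter_upwards [hx i j] with t ht
      rwa [coeffAt_update, coeffAt_update, Ω.lin_symm i ℓ, Ω.lin_symm j ℓ] at ht)
  rw [Finset.sum_eq_zero, Finset.sum_eq_zero, add_zero, add_zero] at h0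
  · exact sub_eq_zero.1 h0
  · intro H hH
    rcases hΩ.slope_eq_zero_or with h | h
    · simp [h]
    · simp [h H hH i hi]
  · intro H hH
    rcases hΩ.slope_eq_zero_or with h | h
    · simp [h]
    · simp [h H hH j hj]

end Regular

end PfaffianForm

/-! ### Comparison of forms at generic points -/

namespace PfaffianForm

section Density

variable {n : ℕ} {V : Type*} [AddCommGroup V] [Module ℂ V]

/-- Integrability may be tested at generic points, as the coefficients are continuous outside the
arrangement. -/
theorem integrable_of_eventually [FiniteDimensional ℂ V] {Ω : PfaffianForm n V}
    (h : ∀ᶠ x in genericFilter n, ∀ i j, Commute (Ω.coeffAt i x) (Ω.coeffAt j x)) :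
    Ω.Integrable := by
  intro x hx i j
  obtain ⟨v, hv⟩ := exists_generic_line h x
  let b := Module.finBasis ℂ V
  let M : (k : Fin n) → ℂ → Matrix _ _ ℂ := fun k t =>
    LinearMap.toMatrix b b (Ω.coeffAt k (x + t • v))
  have hcont : ∀ k, ContinuousAt (M k) 0 := by
    intro k
    have hM : M k = fun t => LinearMap.toMatrix b b (Ω.cst k) +
        ∑ l, (x l + t * v l) • LinearMap.toMatrix b b (Ω.lin k l) +
        ∑ H ∈ Ω.res.support,
          (H.coeff k / H.poly (x + t • v)) • LinearMap.toMatrix b b (Ω.res H) := by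
      funext t
      simp only [M, coeffAt, S, Finsupp.sum, map_add, map_sum, map_smul, Pi.add_apply,
        Pi.smul_apply, smul_eq_mul]
    rw [hM]
    have hpoly : ∀ H ∈ Ω.res.support,
        ContinuousAt (fun t : ℂ => H.coeff k / H.poly (x + t • v)) 0 := by
      intro H hH
      refine ContinuousAt.div continuousAt_const ?_ ?_
      · simp only [Hyperplane.poly, Pi.add_apply, Pi.smul_apply, smul_eq_mul]
        fun_prop
      · rw [zero_smul, add_zero]
        exact fun h0 => hx H hH ((H.mem_iff x).2 h0)
    refine ContinuousAt.add (by fun_prop) (tendsto_finsetSum _ fun H hH => ?_)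
    exact (hpoly H hH).smul continuousAt_const
  have hlim : Tendsto (fun t => M i t * M j t - M j t * M i t) (nhdsWithin 0 {0}ᶜ)
      (nhds (M i 0 * M j 0 - M j 0 * M i 0)) :=
    ((((hcont i).mul (hcont j)).sub ((hcont j).mul (hcont i))).tendsto).mono_left
      nhdsWithin_le_nhds
  have hzero : Tendsto (fun t => M i t * M j t - M j t * M i t) (nhdsWithin 0 {0}ᶜ)
      (nhds 0) := by
    refine tendsto_const_nhds.congr' ?_
    have : ∀ᶠ t : ℂ in nhdsWithin 0 {0}ᶜ, Commute (Ω.coeffAt i (x + t • v))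
        (Ω.coeffAt j (x + t • v)) :=
      (hv.mono fun t ht => ht i j).filter_mono (nhdsNE_le_cofinite 0)
    filter_upwards [this] with t ht
    simp only [M]
    rw [← LinearMap.toMatrix_mul, ← LinearMap.toMatrix_mul, ht.eq, sub_self]
  have h0 := tendsto_nhds_unique hlim hzero
  simp only [M, zero_smul, add_zero] at h0
  rw [← LinearMap.toMatrix_mul, ← LinearMap.toMatrix_mul, sub_eq_zero] at h0
  exact (LinearMap.toMatrix b b).injective h0

end Density

section RegUnique

variable {n : ℕ} {V W M : Type*} [AddCommGroup V] [Module ℂ V] [AddCommGroup W] [Module ℂ W]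
  [AddCommGroup M] [Module ℂ M]

/-- The parts of two forms that do not involve `x_ℓ` can be compared coefficientwise. -/
theorem reg_unique (ℓ : Fin n) (Ω : PfaffianForm n V) (Ω' : PfaffianForm n W)
    (f : Module.End ℂ V →ₗ[ℂ] M) (g : Module.End ℂ W →ₗ[ℂ] M)
    (h : ∀ᶠ x in genericFilter n, ∀ i, i ≠ ℓ → f (Ω.reg ℓ i x) = g (Ω'.reg ℓ i x)) :
    (∀ i, i ≠ ℓ → f (Ω.cst i) = g (Ω'.cst i)) ∧
    (∀ i j, i ≠ ℓ → j ≠ ℓ → f (Ω.lin i j) = g (Ω'.lin i j)) ∧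
    ∀ K : Hyperplane n, ¬ K.DependsOn ℓ → f (Ω.res K) = g (Ω'.res K) := by
  classical
  set r₀ : Hyperplane n →₀ M := Ω.res.mapRange f (map_zero f) - Ω'.res.mapRange g (map_zero g)
    with hr₀
  set r : Hyperplane n →₀ M := r₀.filter fun K => ¬ K.DependsOn ℓ with hr
  obtain ⟨h1, h2, h3⟩ := logForm_unique
    (fun i => if i = ℓ then 0 else f (Ω.cst i) - g (Ω'.cst i))
    (fun i j => if i = ℓ ∨ j = ℓ then 0 else f (Ω.lin i j) - g (Ω'.lin i j)) r (by
      filter_upwards [h] with x hx i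
      by_cases hi : i = ℓ
      · subst hi
        have : (r.sum fun H A => (H.coeff i / H.poly x) • A) = 0 := by
          refine Finset.sum_eq_zero fun K hK => ?_
          have hK : ¬ K.DependsOn i := by
            by_contra hd
            rw [Finsupp.mem_support_iff, hr, Finsupp.filter_apply_neg
              (fun K : Hyperplane n => ¬ K.DependsOn i) _ (not_not.2 hd)] at hK
            exact hK rfl
          simp [show K.coeff i = 0 from not_not.1 hK]
        simp [this]
      · have hx := sub_eq_zero.2 (hx i hi)
        have hsum : (r.sum fun H A => (H.coeff i / H.poly x) • A) =
            f (Ω.res.sum fun K A =>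
              (if K.DependsOn ℓ then 0 else K.coeff i / K.poly x) • A) -
            g (Ω'.res.sum fun K A =>
              (if K.DependsOn ℓ then 0 else K.coeff i / K.poly x) • A) := by
          have e1 : (r.sum fun H A => (H.coeff i / H.poly x) • A) =
              r₀.sum fun K A => (if K.DependsOn ℓ then 0 else K.coeff i / K.poly x) • A := by
            rw [hr, Finsupp.sum, Finsupp.sum, Finsupp.support_filter, Finset.sum_filter]
            refine Finset.sum_congr rfl fun K _ => ?_
            by_cases hK : K.DependsOn ℓ
            · simp [hK]
            · simp [hK]
          rw [e1, hr₀, Finsupp.sum_sub_index (fun _ _ _ => smul_sub _ _ _),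
            Finsupp.sum_mapRange_index (by simp), Finsupp.sum_mapRange_index (by simp),
            Finsupp.sum, Finsupp.sum, Finsupp.sum, Finsupp.sum, map_sum, map_sum]
          simp only [map_smul]
        refine Eq.trans ?_ hx
        rw [hsum, reg, reg]
        simp only [hi, false_or, if_false, map_add, map_sum, map_smul]
        have e2 : ∑ j, x j • (if j = ℓ then (0 : M) else f (Ω.lin i j) - g (Ω'.lin i j)) =
            ∑ j, (if j = ℓ then (0 : ℂ) else x j) • f (Ω.lin i j) -
              ∑ j, (if j = ℓ then (0 : ℂ) else x j) • g (Ω'.lin i j) := by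
          rw [← Finset.sum_sub_distrib]
          refine Finset.sum_congr rfl fun j _ => ?_
          by_cases hj : j = ℓ <;> simp [hj, smul_sub]
        rw [e2]
        abel)
  refine ⟨fun i hi => ?_, fun i j hi hj => ?_, fun K hK => ?_⟩
  · simpa [hi, sub_eq_zero] using h1 i
  · simpa [hi, hj, sub_eq_zero] using h2 i j
  · have := h3 K
    rw [hr, Finsupp.filter_apply_pos (fun K : Hyperplane n => ¬ K.DependsOn ℓ) _ hK, hr₀] at this
    simpa [sub_eq_zero] using this

end RegUnique

end PfaffianForm

/-! ### Dual pairs of forms -/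

namespace PfaffianForm

section Dual

variable {n : ℕ} {V W : Type*} [AddCommGroup V] [Module ℂ V] [AddCommGroup W] [Module ℂ W]

/-- Harnad duality in the direction `x_ℓ`. The linear maps `P : V → W` and `Q : W → V` exchange the
poles of `Ω` with the eigenvalues of the polynomial part of `Ω'` and vice versa, up to the sign `ε`:
with `T = -ε S'_{x_ℓ}` the coefficients of `dx_ℓ` are `S + Q (x - T)⁻¹ P` and
`-ε T - P (x - ε S)⁻¹ Q`. The remaining coefficients satisfy intertwining relations, which hold at
generic points. -/
structure IsDual (ℓ : Fin n) (ε : ℤˣ) (Ω : PfaffianForm n V) (Ω' : PfaffianForm n W)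
    (P : V →ₗ[ℂ] W) (Q : W →ₗ[ℂ] V) : Prop where
  spectral : Ω.IsSpectral ℓ
  spectral' : Ω'.IsSpectral ℓ
  res : ∀ (H : Hyperplane n), H.DependsOn ℓ → ∀ v,
    Ω.res H v = Q (Ω'.eigProj ℓ (H.flip ℓ (-ε)) (P v))
  res' : ∀ (K : Hyperplane n), K.DependsOn ℓ → ∀ w,
    Ω'.res K w = -P (Ω.eigProj ℓ (K.flip ℓ ε) (Q w))
  surj : ∀ K w, ∃ v, Ω'.eigProj ℓ K (P v) = Ω'.eigProj ℓ K w
  surj' : ∀ H v, ∃ w, Ω.eigProj ℓ H (Q w) = Ω.eigProj ℓ H v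
  inj : ∀ K w, Q (Ω'.eigProj ℓ K w) = 0 → Ω'.eigProj ℓ K w = 0
  inj' : ∀ H v, P (Ω.eigProj ℓ H v) = 0 → Ω.eigProj ℓ H v = 0
  reg_left : ∀ᶠ x in genericFilter n, ∀ i, i ≠ ℓ → ∀ v,
    Ω'.reg ℓ i x (P v) = P (Ω.reg ℓ i x v) -
      ((ε : ℤ) : ℂ) • (Ω'.S ℓ x (P (Ω.lin ℓ i v)) + Ω'.lin ℓ i (P (Ω.S ℓ x v)))
  reg_right : ∀ᶠ x in genericFilter n, ∀ i, i ≠ ℓ → ∀ w,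
    Q (Ω'.reg ℓ i x w) = Ω.reg ℓ i x (Q w) -
      ((ε : ℤ) : ℂ) • (Ω.lin ℓ i (Q (Ω'.S ℓ x w)) + Ω.S ℓ x (Q (Ω'.lin ℓ i w)))
  comm : ∀ᶠ x in genericFilter n, ∀ i, i ≠ ℓ → ∀ v,
    Ω.S ℓ x (Ω.reg ℓ i x v) - Ω.reg ℓ i x (Ω.S ℓ x v) +
      (Q (P (Ω.lin ℓ i v)) - Ω.lin ℓ i (Q (P v))) = 0
  comm' : ∀ᶠ x in genericFilter n, ∀ i, i ≠ ℓ → ∀ w,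
    Ω'.S ℓ x (Ω'.reg ℓ i x w) - Ω'.reg ℓ i x (Ω'.S ℓ x w) +
      (Ω'.lin ℓ i (P (Q w)) - P (Q (Ω'.lin ℓ i w))) = 0

namespace IsDual

variable {ℓ : Fin n} {ε : ℤˣ} {Ω : PfaffianForm n V} {Ω' : PfaffianForm n W}
  {P : V →ₗ[ℂ] W} {Q : W →ₗ[ℂ] V}

/-- Duality is symmetric. -/
theorem symm (h : IsDual ℓ ε Ω Ω' P Q) : IsDual ℓ (-ε) Ω' Ω Q (-P) where
  spectral := h.spectral'
  spectral' := h.spectral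
  res K hK w := by rw [h.res' K hK, neg_neg, LinearMap.neg_apply]
  res' H hH v := by rw [h.res H hH, LinearMap.neg_apply, map_neg, map_neg, neg_neg]
  surj := h.surj'
  surj' K w := by
    obtain ⟨v, hv⟩ := h.surj K w
    exact ⟨-v, by simpa using hv⟩
  inj H v hv := h.inj' H v (by simpa using hv)
  inj' := h.inj
  reg_left := by
    filter_upwards [h.reg_right] with x hx i hi w
    rw [hx i hi w]
    simp only [Units.val_neg, Int.cast_neg]
    module
  reg_right := by
    filter_upwards [h.reg_left] with x hx i hi v
    simp only [LinearMap.neg_apply, map_neg, Units.val_neg, Int.cast_neg]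
    rw [hx i hi v]
    module
  comm := by
    filter_upwards [h.comm'] with x hx i hi w
    rw [← hx i hi w]
    simp only [LinearMap.neg_apply, map_neg]
    abel
  comm' := by
    filter_upwards [h.comm] with x hx i hi v
    rw [← hx i hi v]
    simp only [LinearMap.neg_apply, map_neg]
    abel

variable [FiniteDimensional ℂ W]

theorem mem_polar_iff (h : IsDual ℓ ε Ω Ω' P Q) (H : Hyperplane n) :
    H ∈ Ω.polar ℓ ↔ H.flip ℓ (-ε) ∈ Ω'.specFinset ℓ := by
  by_cases hd : H.DependsOn ℓ
  · rw [mem_polar, and_iff_left hd, mem_specFinset, ← h.spectral'.eigProj_ne_zero_iff,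
      not_iff_not]
    constructor
    · intro h0
      ext w
      obtain ⟨v, hv⟩ := h.surj (H.flip ℓ (-ε)) w
      rw [← hv, LinearMap.zero_apply]
      exact h.inj _ _ (by rw [← h.res H hd, h0, LinearMap.zero_apply])
    · intro h0
      ext v
      rw [h.res H hd, h0]
      simp
  · refine iff_of_false (fun h' => hd (dependsOn_of_mem_polar h')) fun h' => hd ?_
    exact (Hyperplane.dependsOn_flip_iff (-ε)).1 (dependsOn_of_mem_specFinset h')

theorem sum_polar (h : IsDual ℓ ε Ω Ω' P Q) (c : Hyperplane n → ℂ) (v : V) :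
    (∑ H ∈ Ω.polar ℓ, c H • Ω.res H) v =
      Q ((∑ K ∈ Ω'.specFinset ℓ, c (K.flip ℓ (-ε)) • Ω'.eigProj ℓ K) (P v)) := by
  rw [LinearMap.sum_apply, LinearMap.sum_apply, map_sum]
  refine Finset.sum_nbij' (fun H => H.flip ℓ (-ε)) (fun K => K.flip ℓ (-ε)) ?_ ?_ ?_ ?_ ?_
  · exact fun H hH => (h.mem_polar_iff H).1 hH
  · intro K hK
    rw [h.mem_polar_iff, Hyperplane.flip_flip]
    exact hK
  · exact fun H _ => H.flip_flip ℓ _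
  · exact fun K _ => K.flip_flip ℓ _
  · intro H hH
    rw [Hyperplane.flip_flip, LinearMap.smul_apply, LinearMap.smul_apply, map_smul,
      h.res H (dependsOn_of_mem_polar hH)]

/-- An endomorphism that commutes with `S'_{x_ℓ}` and kills the image of `P` vanishes. -/
theorem eventually_eq_zero (h : IsDual ℓ ε Ω Ω' P Q) :
    ∀ᶠ x in genericFilter n, ∀ X : Module.End ℂ W, (∀ w, Ω'.S ℓ x (X w) = X (Ω'.S ℓ x w)) →
      (∀ v, X (P v) = 0) → X = 0 := by
  filter_upwards [h.spectral'.eventually_commute_eigProj] with x hx X hX hXP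
  refine h.spectral'.ext fun K _ w hw => ?_
  obtain ⟨v, hv⟩ := h.surj K w
  rw [h.spectral'.eigProj_apply_mem hw] at hv
  have := LinearMap.congr_fun (hx X (LinearMap.ext hX) K).eq (P v)
  rw [Module.End.mul_apply, Module.End.mul_apply, hXP, map_zero, hv] at this
  rw [← this, LinearMap.zero_apply]

end IsDual

end Dual

section Uniqueness

variable {n : ℕ} {V W₁ W₂ : Type*} [AddCommGroup V] [Module ℂ V] [AddCommGroup W₁] [Module ℂ W₁]
  [AddCommGroup W₂] [Module ℂ W₂] [FiniteDimensional ℂ W₁] [FiniteDimensional ℂ W₂]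
  {ℓ : Fin n} {ε : ℤˣ} {Ω : PfaffianForm n V} {Ω₁ : PfaffianForm n W₁} {Ω₂ : PfaffianForm n W₂}
  {P₁ : V →ₗ[ℂ] W₁} {Q₁ : W₁ →ₗ[ℂ] V} {P₂ : V →ₗ[ℂ] W₂} {Q₂ : W₂ →ₗ[ℂ] V}

/-- The map from a sum of copies of `V` onto the dual space, given by the components of `P` in the
common eigenspaces. -/
noncomputable def dualCover {W : Type*} [AddCommGroup W] [Module ℂ W] (ℓ : Fin n)
    (Ω' : PfaffianForm n W) (P : V →ₗ[ℂ] W) : (Hyperplane n →₀ V) →ₗ[ℂ] W :=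
  Finsupp.lsum ℂ fun K => Ω'.eigProj ℓ K ∘ₗ P

namespace IsDual

theorem eigProj_dualCover (h : IsDual ℓ ε Ω Ω₁ P₁ Q₁) (K : Hyperplane n) (f : Hyperplane n →₀ V) :
    Ω₁.eigProj ℓ K (dualCover ℓ Ω₁ P₁ f) = Ω₁.eigProj ℓ K (P₁ (f K)) := by
  classical
  induction f using Finsupp.induction_linear with
  | zero => simp
  | add f g hf hg => rw [map_add, map_add, hf, hg, Finsupp.add_apply, map_add, map_add]
  | single H v =>
    rw [dualCover, Finsupp.lsum_single, LinearMap.comp_apply, ← Module.End.mul_apply,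
      h.spectral'.eigProj_mul]
    by_cases hKH : K = H
    · subst hKH; simp
    · rw [if_neg hKH, Finsupp.single_eq_of_ne hKH]; simp

theorem dualCover_surjective (h : IsDual ℓ ε Ω Ω₁ P₁ Q₁) :
    Function.Surjective (dualCover ℓ Ω₁ P₁) := by
  rw [← LinearMap.range_eq_top, eq_top_iff]
  rintro w -
  rw [← Module.End.one_apply (R := ℂ) w, ← h.spectral'.sum_eigProj, LinearMap.sum_apply]
  refine Submodule.sum_mem _ fun K _ => ?_
  obtain ⟨v, hv⟩ := h.surj K w
  exact ⟨Finsupp.single K v, by rw [← hv, dualCover, Finsupp.lsum_single, LinearMap.comp_apply]⟩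

theorem mem_ker_dualCover (h : IsDual ℓ ε Ω Ω₁ P₁ Q₁) (f : Hyperplane n →₀ V) :
    f ∈ LinearMap.ker (dualCover ℓ Ω₁ P₁) ↔
      ∀ K : Hyperplane n, K.DependsOn ℓ → Ω.res (K.flip ℓ (-ε)) (f K) = 0 := by
  have hres : ∀ K : Hyperplane n, K.DependsOn ℓ →
      Ω.res (K.flip ℓ (-ε)) (f K) = Q₁ (Ω₁.eigProj ℓ K (P₁ (f K))) := by
    intro K hK
    rw [h.res _ (hK.flip _), Hyperplane.flip_flip]
  rw [LinearMap.mem_ker]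
  constructor
  · intro hf K hK
    rw [hres K hK, ← h.eigProj_dualCover, hf, map_zero, map_zero]
  · intro hf
    rw [← Module.End.one_apply (R := ℂ) (dualCover ℓ Ω₁ P₁ f), ← h.spectral'.sum_eigProj,
      LinearMap.sum_apply]
    refine Finset.sum_eq_zero fun K hK => ?_
    have hK := dependsOn_of_mem_specFinset hK
    rw [h.eigProj_dualCover]
    exact h.inj _ _ (by rw [← hres K hK, hf K hK])

/-- The dual of a form is unique up to gauge equivalence: the kernel of `dualCover` depends only on the
residues of `Ω`, so that the spaces of two duals are quotients of the same space by the same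
subspace. -/
theorem gaugeEquiv (h₁ : IsDual ℓ ε Ω Ω₁ P₁ Q₁) (h₂ : IsDual ℓ ε Ω Ω₂ P₂ Q₂) :
    Ω₁.GaugeEquiv Ω₂ := by
  classical
  have hker : LinearMap.ker (dualCover ℓ Ω₁ P₁) = LinearMap.ker (dualCover ℓ Ω₂ P₂) := by
    ext f
    rw [h₁.mem_ker_dualCover, h₂.mem_ker_dualCover]
  let θ : W₁ ≃ₗ[ℂ] W₂ :=
    ((dualCover ℓ Ω₁ P₁).quotKerEquivOfSurjective h₁.dualCover_surjective).symm.trans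
      ((Submodule.quotEquivOfEq _ _ hker).trans
        ((dualCover ℓ Ω₂ P₂).quotKerEquivOfSurjective h₂.dualCover_surjective))
  have hθ : ∀ f, θ (dualCover ℓ Ω₁ P₁ f) = dualCover ℓ Ω₂ P₂ f := by
    intro f
    have : ((dualCover ℓ Ω₁ P₁).quotKerEquivOfSurjective h₁.dualCover_surjective).symm
        (dualCover ℓ Ω₁ P₁ f) = Submodule.Quotient.mk f := by
      rw [LinearEquiv.symm_apply_eq]; rfl
    simp only [θ, LinearEquiv.trans_apply, this]
    rfl
  have hproj : ∀ K w, θ (Ω₁.eigProj ℓ K w) = Ω₂.eigProj ℓ K (θ w) := by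
    intro K w
    obtain ⟨f, rfl⟩ := h₁.dualCover_surjective w
    rw [hθ, h₁.eigProj_dualCover, h₂.eigProj_dualCover]
    have := hθ (Finsupp.single K (f K))
    simpa only [dualCover, Finsupp.lsum_single, LinearMap.comp_apply] using this
  have hθeig : ∀ K, ∀ w ∈ Ω₁.eig ℓ K, θ w ∈ Ω₂.eig ℓ K := by
    intro K w hw
    rw [← h₁.spectral'.eigProj_apply_mem hw, hproj]
    exact h₂.spectral'.eigProj_mem K _
  have hS : ∀ x w, θ (Ω₁.S ℓ x w) = Ω₂.S ℓ x (θ w) := by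
    intro x
    refine fun w => LinearMap.congr_fun (h₁.spectral'.ext (f := θ.toLinearMap ∘ₗ Ω₁.S ℓ x)
      (g := Ω₂.S ℓ x ∘ₗ θ.toLinearMap) fun K hK w hw => ?_) w
    simp only [LinearMap.comp_apply, LinearEquiv.coe_coe]
    rw [Ω₁.eig_apply ℓ K hK hw, Ω₂.eig_apply ℓ K hK (hθeig K w hw), map_smul]
  have hcst : ∀ w, θ (Ω₁.cst ℓ w) = Ω₂.cst ℓ (θ w) := by
    simpa only [S_zero] using hS 0
  have hlin : ∀ j w, θ (Ω₁.lin ℓ j w) = Ω₂.lin ℓ j (θ w) := by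
    intro j w
    have := hS (Pi.single j 1) w
    rw [S_single, S_single, LinearMap.add_apply, LinearMap.add_apply, map_add, hcst] at this
    exact add_left_cancel this
  have hP : ∀ v, θ (P₁ v) = P₂ v := by
    intro v
    rw [← Module.End.one_apply (R := ℂ) (θ (P₁ v)), ← Module.End.one_apply (R := ℂ) (P₂ v),
      ← h₂.spectral'.sum_eigProj, LinearMap.sum_apply, LinearMap.sum_apply]
    refine Finset.sum_congr rfl fun K _ => ?_
    rw [← hproj]
    have := hθ (Finsupp.single K v)
    simpa only [dualCover, Finsupp.lsum_single, LinearMap.comp_apply] using this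
  have hQ : ∀ w, Q₂ (θ w) = Q₁ w := by
    refine fun w => LinearMap.congr_fun (h₁.spectral'.ext (f := Q₂ ∘ₗ θ.toLinearMap)
      (g := Q₁) fun K hK w hw => ?_) w
    obtain ⟨v, hv⟩ := h₁.surj K w
    rw [h₁.spectral'.eigProj_apply_mem hw] at hv
    have e₁ := h₁.res _ (hK.flip (-ε)) v
    have e₂ := h₂.res _ (hK.flip (-ε)) v
    rw [Hyperplane.flip_flip] at e₁ e₂
    rw [LinearMap.comp_apply, LinearEquiv.coe_coe, ← hv, hproj, hP, ← e₁, ← e₂]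
  have hres : ∀ K : Hyperplane n, K.DependsOn ℓ → ∀ w, θ (Ω₁.res K w) = Ω₂.res K (θ w) := by
    intro K hK w
    rw [h₁.res' K hK, h₂.res' K hK, map_neg, hP, hQ]
  have hreg : ∀ᶠ x in genericFilter n, ∀ i, i ≠ ℓ →
      θ.toLinearMap ∘ₗ Ω₁.reg ℓ i x ∘ₗ θ.symm.toLinearMap = Ω₂.reg ℓ i x := by
    filter_upwards [h₂.eventually_eq_zero, h₁.reg_left, h₂.reg_left, h₁.comm', h₂.comm']
      with x hx hl₁ hl₂ hc₁ hc₂ i hi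
    rw [← sub_eq_zero]
    have hsymm : ∀ v, θ.symm (P₂ v) = P₁ v := fun v => by
      rw [← hP, LinearEquiv.symm_apply_apply]
    refine hx _ (fun w => ?_) fun v => ?_
    · obtain ⟨u, rfl⟩ := θ.surjective w
      have e₁ := congrArg θ (hc₁ i hi u)
      have e₂ := hc₂ i hi (θ u)
      simp only [map_add, map_sub, map_zero, hS, hlin, hP] at e₁
      simp only [LinearMap.sub_apply, LinearMap.comp_apply, LinearEquiv.coe_coe,
        LinearEquiv.symm_apply_apply, ← hS, map_sub]
      simp only [← hlin, hQ, ← hS] at e₁ e₂ ⊢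
      rw [← sub_eq_zero]
      rw [← sub_eq_zero] at e₁ e₂
      linear_combination (norm := module) e₁ - e₂
    · simp only [LinearMap.sub_apply, LinearMap.comp_apply, LinearEquiv.coe_coe, hsymm]
      rw [hl₁ i hi, hl₂ i hi]
      simp only [map_sub, map_smul, map_add, hP, hS, hlin, sub_self]
  obtain ⟨r1, r2, r3⟩ := reg_unique ℓ Ω₁ Ω₂ (θ.conj.toLinearMap) LinearMap.id (by
    filter_upwards [hreg] with x hx i hi
    exact hx i hi)
  have conj_eq : ∀ (f : Module.End ℂ W₁) (g : Module.End ℂ W₂), (∀ w, θ (f w) = g (θ w)) →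
      g = θ.conj f := by
    intro f g hfg
    ext w
    rw [LinearEquiv.conj_apply_apply, hfg, LinearEquiv.apply_symm_apply]
  refine ⟨θ, fun i => ?_, fun i j => ?_, fun K => ?_⟩
  · by_cases hi : i = ℓ
    · subst hi; exact conj_eq _ _ hcst
    · exact (r1 i hi).symm
  · by_cases hi : i = ℓ
    · subst hi; exact conj_eq _ _ (hlin j)
    · by_cases hj : j = ℓ
      · subst hj
        rw [Ω₁.lin_symm, Ω₂.lin_symm]; exact conj_eq _ _ (hlin i)
      · exact (r2 i j hi hj).symm
  · by_cases hK : K.DependsOn ℓ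
    · exact conj_eq _ _ (hres K hK)
    · exact (r3 K hK).symm

end IsDual

end Uniqueness

end PfaffianForm

/-! ### Admissibility and irreducibility of the dual form -/

namespace PfaffianForm

section

variable {n : ℕ} {V W : Type*} [AddCommGroup V] [Module ℂ V] [AddCommGroup W] [Module ℂ W]
  [FiniteDimensional ℂ W]
  {ℓ : Fin n} {ε : ℤˣ} {Ω : PfaffianForm n V} {Ω' : PfaffianForm n W}
  {P : V →ₗ[ℂ] W} {Q : W →ₗ[ℂ] V}

namespace IsDual

/-- The mixed terms in the commutator of the coefficients of `dx_i` and `dx_j` cancel: this follows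
from `comm'`, block by block. -/
theorem eventually_mixed (h : IsDual ℓ ε Ω Ω' P Q) :
    ∀ᶠ x in genericFilter n, ∀ i j, i ≠ ℓ → j ≠ ℓ → ∀ w,
      Ω'.reg ℓ i x (Ω'.lin ℓ j w) - Ω'.lin ℓ j (Ω'.reg ℓ i x w) =
        Ω'.reg ℓ j x (Ω'.lin ℓ i w) - Ω'.lin ℓ i (Ω'.reg ℓ j x w) := by
  filter_upwards [h.comm', Ω'.eventually_specFinset_injOn ℓ] with x hx hinj i j hi hj
  have hs := h.spectral'
  have hprojlin : ∀ K : Hyperplane n, K.DependsOn ℓ → ∀ k, k ≠ ℓ → ∀ w,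
      Ω'.eigProj ℓ K (Ω'.lin ℓ k w) = K.slope ℓ k • Ω'.eigProj ℓ K w := by
    intro K hK k hk
    refine fun w => LinearMap.congr_fun (hs.ext (f := Ω'.eigProj ℓ K ∘ₗ Ω'.lin ℓ k)
      (g := K.slope ℓ k • Ω'.eigProj ℓ K) fun L hL w hw => ?_) w
    rw [LinearMap.comp_apply, Ω'.lin_apply_of_mem_eig ℓ L hL hw hk, LinearMap.smul_apply, map_smul]
    by_cases hLK : L = K
    · rw [hLK]
    · rw [hs.eigProj_apply_of_ne hLK hw, smul_zero, smul_zero]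
  have hprojS : ∀ K : Hyperplane n, K.DependsOn ℓ → ∀ w,
      Ω'.eigProj ℓ K (Ω'.S ℓ x w) = K.root ℓ x • Ω'.eigProj ℓ K w := by
    intro K hK
    refine fun w => LinearMap.congr_fun (hs.ext (f := Ω'.eigProj ℓ K ∘ₗ Ω'.S ℓ x)
      (g := K.root ℓ x • Ω'.eigProj ℓ K) fun L hL w hw => ?_) w
    rw [LinearMap.comp_apply, Ω'.eig_apply ℓ L hL hw, LinearMap.smul_apply, map_smul]
    by_cases hLK : L = K
    · rw [hLK]
    · rw [hs.eigProj_apply_of_ne hLK hw, smul_zero, smul_zero]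
  refine fun w => sub_eq_zero.1 (LinearMap.congr_fun (hs.ext
    (f := (Ω'.reg ℓ i x ∘ₗ Ω'.lin ℓ j - Ω'.lin ℓ j ∘ₗ Ω'.reg ℓ i x) -
      (Ω'.reg ℓ j x ∘ₗ Ω'.lin ℓ i - Ω'.lin ℓ i ∘ₗ Ω'.reg ℓ j x)) (g := 0) fun K hK w hw => ?_) w)
  by_cases hw0 : w = 0
  · simp [hw0]
  have hKs : K ∈ Ω'.specFinset ℓ :=
    mem_specFinset.2 fun h0 => hw0 (by rwa [h0, Submodule.mem_bot] at hw)
  set X := ((Ω'.reg ℓ i x ∘ₗ Ω'.lin ℓ j - Ω'.lin ℓ j ∘ₗ Ω'.reg ℓ i x) -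
      (Ω'.reg ℓ j x ∘ₗ Ω'.lin ℓ i - Ω'.lin ℓ i ∘ₗ Ω'.reg ℓ j x)) w with hX
  rw [LinearMap.zero_apply, ← Module.End.one_apply (R := ℂ) X, ← hs.sum_eigProj,
    LinearMap.sum_apply]
  refine Finset.sum_eq_zero fun L hLs => ?_
  have hL := dependsOn_of_mem_specFinset hLs
  have e1 := congrArg (Ω'.eigProj ℓ L) (hx i hi w)
  have e2 := congrArg (Ω'.eigProj ℓ L) (hx j hj w)
  simp only [map_add, map_sub, map_zero, hprojS L hL, hprojlin L hL i hi, hprojlin L hL j hj,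
    Ω'.eig_apply ℓ K hK hw, Ω'.lin_apply_of_mem_eig ℓ K hK hw hi,
    Ω'.lin_apply_of_mem_eig ℓ K hK hw hj, map_smul] at e1 e2
  rw [hX]
  simp only [LinearMap.sub_apply, LinearMap.comp_apply, map_sub, hprojlin L hL i hi,
    hprojlin L hL j hj, Ω'.lin_apply_of_mem_eig ℓ K hK hw hi,
    Ω'.lin_apply_of_mem_eig ℓ K hK hw hj, map_smul]
  by_cases hLK : L = K
  · subst hLK; module
  -- `comm'` gives the block of `Ω'.reg ℓ i x` as a multiple of that of `P Q`, with the factor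
  -- `-(s_L - s_K) / (a_L - a_K)` for the slopes `s` in the direction `x_i`
  · have hne : L.root ℓ x - K.root ℓ x ≠ 0 := sub_ne_zero.2 fun e => hLK (hinj hLs hKs e)
    refine (smul_eq_zero.1 ?_).resolve_left hne
    linear_combination (norm := module) (K.slope ℓ j - L.slope ℓ j) • e1 -
      (K.slope ℓ i - L.slope ℓ i) • e2

/-- The coefficients of a form in terms of its dual, by means of the resolvent
`R = (x_ℓ - T)⁻¹`, `T = -ε S'_{x_ℓ}`. -/
theorem eventually_resolvent (h : IsDual ℓ ε Ω Ω' P Q) :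
    ∀ᶠ x in genericFilter n, ∃ R : Module.End ℂ W,
      (∀ w, ((ε : ℤ) : ℂ) • R (Ω'.S ℓ x w) = w - x ℓ • R w) ∧
      (∀ w, R (Ω'.S ℓ x w) = Ω'.S ℓ x (R w)) ∧
      (∀ i w, R (Ω'.lin ℓ i w) = Ω'.lin ℓ i (R w)) ∧
      (∀ v, Ω.coeffAt ℓ x v = Ω.S ℓ x v + Q (R (P v))) ∧
      ∀ i, i ≠ ℓ → ∀ v, Ω.coeffAt i x v = Ω.reg ℓ i x v + x ℓ • Ω.lin ℓ i v +
        ((ε : ℤ) : ℂ) • Q (Ω'.lin ℓ i (R (P v))) := by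
  have hgen : ∀ᶠ x in genericFilter n, ∀ K ∈ Ω'.specFinset ℓ,
      x ℓ - (K.flip ℓ (-ε)).root ℓ x ≠ 0 := by
    rw [Filter.eventually_all_finset]
    intro K hK
    have hd := (dependsOn_of_mem_specFinset hK).flip (-ε)
    filter_upwards [(K.flip ℓ (-ε)).eventually_poly_ne_zero] with x hx
    rw [Hyperplane.root, sub_sub_cancel]
    exact div_ne_zero hx hd
  filter_upwards [hgen] with x hx
  have hs := h.spectral'
  set ρ : Hyperplane n → ℂ := fun K => (x ℓ - (K.flip ℓ (-ε)).root ℓ x)⁻¹ with hρ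
  have hroot : ∀ K ∈ Ω'.specFinset ℓ,
      (K.flip ℓ (-ε)).root ℓ x = -((ε : ℤ) : ℂ) * K.root ℓ x := by
    intro K hK
    rw [K.root_flip ℓ (-ε) (dependsOn_of_mem_specFinset hK)]
    simp
  refine ⟨∑ K ∈ Ω'.specFinset ℓ, ρ K • Ω'.eigProj ℓ K, fun w => ?_, fun w => ?_, fun i w => ?_,
    fun v => ?_, fun i hi v => ?_⟩
  · have e : ((ε : ℤ) : ℂ) • ((∑ K ∈ Ω'.specFinset ℓ, ρ K • Ω'.eigProj ℓ K) * Ω'.S ℓ x) =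
        1 - x ℓ • ∑ K ∈ Ω'.specFinset ℓ, ρ K • Ω'.eigProj ℓ K := by
      rw [hs.S_eq_sum, hs.sum_smul_eigProj_mul, ← hs.sum_eigProj, Finset.smul_sum,
        Finset.smul_sum, ← Finset.sum_sub_distrib]
      refine Finset.sum_congr rfl fun K hK => ?_
      have h0 := hx K hK
      have : ((ε : ℤ) : ℂ) * (ρ K * K.root ℓ x) = 1 - x ℓ * ρ K := by
        simp only [hρ]
        field_simp
        rw [hroot K hK]
        ring
      rw [smul_smul, this, sub_smul, one_smul, smul_smul]
    exact LinearMap.congr_fun e w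
  · rw [hs.S_eq_sum]
    exact LinearMap.congr_fun (hs.commute_sum _ _).eq w
  · by_cases hi : i = ℓ
    · subst hi; simp [Ω'.lin_self]
    · rw [hs.lin_eq_sum hi]
      exact LinearMap.congr_fun (hs.commute_sum _ _).eq w
  · rw [coeffAt_eq ℓ, reg_self, Ω.lin_self, smul_zero, add_zero, LinearMap.add_apply, h.sum_polar]
    have e : ∑ K ∈ Ω'.specFinset ℓ, (-(K.flip ℓ (-ε)).slope ℓ ℓ *
        (x ℓ - (K.flip ℓ (-ε)).root ℓ x)⁻¹) • Ω'.eigProj ℓ K =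
        ∑ K ∈ Ω'.specFinset ℓ, ρ K • Ω'.eigProj ℓ K := by
      refine Finset.sum_congr rfl fun K hK => ?_
      rw [Hyperplane.slope_self ℓ _ ((dependsOn_of_mem_specFinset hK).flip (-ε)), neg_neg,
        one_mul]
    rw [e]
  · rw [coeffAt_eq ℓ, LinearMap.add_apply, h.sum_polar, Ω.lin_symm i ℓ, LinearMap.add_apply,
      LinearMap.smul_apply]
    congr 1
    have e : ∑ K ∈ Ω'.specFinset ℓ, (-(K.flip ℓ (-ε)).slope ℓ i *
        (x ℓ - (K.flip ℓ (-ε)).root ℓ x)⁻¹) • Ω'.eigProj ℓ K =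
        ((ε : ℤ) : ℂ) • (Ω'.lin ℓ i * ∑ K ∈ Ω'.specFinset ℓ, ρ K • Ω'.eigProj ℓ K) := by
      rw [hs.lin_eq_sum hi, hs.sum_smul_eigProj_mul, Finset.smul_sum]
      refine Finset.sum_congr rfl fun K hK => ?_
      rw [K.slope_flip ℓ (-ε) (dependsOn_of_mem_specFinset hK) hi, smul_smul]
      congr 1
      simp [hρ, mul_assoc]
    rw [e, LinearMap.smul_apply, map_smul, Module.End.mul_apply]

/-- The condition on the `A_{x_ℓ x_j}` in the assumptions, in its symmetric form: the slopes of the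
poles of `Ω` are, up to sign, the eigenvalues of the `A'_{x_ℓ x_j}`. -/
theorem lin_eq_zero_or (h : IsDual ℓ ε Ω Ω' P Q) (hΩ : Ω.Admissible ℓ) :
    (∀ j, Ω.lin ℓ j = 0) ∨ ∀ j, Ω'.lin ℓ j = 0 := by
  refine hΩ.slope_eq_zero_or.imp_right fun hs j => ?_
  by_cases hj : j = ℓ
  · subst hj; exact Ω'.lin_self _
  rw [h.spectral'.lin_eq_sum hj]
  refine Finset.sum_eq_zero fun K hK => ?_
  have hd := dependsOn_of_mem_specFinset hK
  have := hs (K.flip ℓ (-ε)) ((h.mem_polar_iff _).2 (by rwa [Hyperplane.flip_flip])) j hj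
  rw [K.slope_flip ℓ _ hd hj] at this
  have h0 : K.slope ℓ j = 0 :=
    (mul_eq_zero.1 this).resolve_left (by exact_mod_cast (-ε).ne_zero)
  rw [h0, zero_smul]

variable [FiniteDimensional ℂ V]

/-- If the polynomial parts of `Ω` and `Ω'` in the direction `x_ℓ` do not both vary, and the parts
`Ω.reg` of the coefficients commute, then so do the parts `Ω'.reg`. Their commutator commutes with
`S'_{x_ℓ}` and kills the image of `P`. -/
theorem eventually_commute_reg (h : IsDual ℓ ε Ω Ω' P Q)
    (hdich : (∀ j, Ω.lin ℓ j = 0) ∨ ∀ j, Ω'.lin ℓ j = 0)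
    (hY : ∀ᶠ x in genericFilter n, ∀ i j, i ≠ ℓ → j ≠ ℓ →
      Commute (Ω.reg ℓ i x) (Ω.reg ℓ j x)) :
    ∀ᶠ x in genericFilter n, ∀ i j, i ≠ ℓ → j ≠ ℓ →
      Commute (Ω'.reg ℓ i x) (Ω'.reg ℓ j x) := by
  filter_upwards [h.eventually_eq_zero, h.reg_left, h.reg_right, h.comm, h.comm',
    h.eventually_mixed, h.symm.eventually_mixed, hY] with x hzero hl hr hc hc' hm' hm hY i j hi hj
  have hYij : ∀ v, Ω.reg ℓ i x (Ω.reg ℓ j x v) = Ω.reg ℓ j x (Ω.reg ℓ i x v) := fun v =>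
    LinearMap.congr_fun (hY i j hi hj).eq v
  have hll : ∀ v, Ω.lin ℓ i (Ω.lin ℓ j v) = Ω.lin ℓ j (Ω.lin ℓ i v) := fun v =>
    LinearMap.congr_fun (h.spectral.commute_lin_lin i j).eq v
  have hll' : ∀ v, Ω'.lin ℓ i (Ω'.lin ℓ j v) = Ω'.lin ℓ j (Ω'.lin ℓ i v) := fun v =>
    LinearMap.congr_fun (h.spectral'.commute_lin_lin i j).eq v
  rw [commute_iff_eq, ← sub_eq_zero]
  have hli := hl i hi
  have hlj := hl j hj
  have hri := hr i hi
  have hrj := hr j hj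
  have hci := hc i hi
  have hcj := hc j hj
  have hci' := hc' i hi
  have hcj' := hc' j hj
  have hmij := hm i j hi hj
  have hmij' := hm' i j hi hj
  clear hl hr hc hc' hm hm' hY
  rcases hdich with h0 | h0
  · -- the polynomial part of `Ω` in the direction `x_ℓ` is constant
    simp only [h0, LinearMap.zero_apply, map_zero, zero_add, add_zero, sub_self]
      at hli hlj hri hrj hci hcj
    have hSi : ∀ v, Ω.S ℓ x (Ω.reg ℓ i x v) = Ω.reg ℓ i x (Ω.S ℓ x v) := fun v =>
      sub_eq_zero.1 (hci v)
    have hSj : ∀ v, Ω.S ℓ x (Ω.reg ℓ j x v) = Ω.reg ℓ j x (Ω.S ℓ x v) := fun v =>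
      sub_eq_zero.1 (hcj v)
    refine hzero _ (fun w => ?_) fun v => ?_
    · simp only [LinearMap.sub_apply, Module.End.mul_apply, map_sub]
      have a1 := hci' (Ω'.reg ℓ j x w)
      have a2 := congrArg (Ω'.reg ℓ i x) (hcj' w)
      have a3 := hcj' (Ω'.reg ℓ i x w)
      have a4 := congrArg (Ω'.reg ℓ j x) (hci' w)
      have b1 := hmij' (P (Q w))
      have b2 := congrArg P (congrArg Q (hmij' w))
      simp only [map_add, map_sub, map_smul, map_zero, hri, hrj, hli, hlj, hll']
        at a1 a2 a3 a4 b1 b2 ⊢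
      linear_combination (norm := module) a1 + a2 - a3 - a4 - b1 + b2
    · have b1 := hmij' (P (Ω.S ℓ x v))
      simp only [LinearMap.sub_apply, Module.End.mul_apply, hli, hlj, map_sub, map_smul, hSi, hSj,
        hYij, hll'] at b1 ⊢
      linear_combination (norm := module) -((ε : ℤ) : ℂ) • b1
  · -- the eigenvalues of `S_{x_ℓ}` in `Ω'` are constant
    simp only [h0, LinearMap.zero_apply, map_zero, add_zero, sub_self]
      at hli hlj hri hrj hci' hcj'
    have hSi : ∀ v, Ω'.S ℓ x (Ω'.reg ℓ i x v) = Ω'.reg ℓ i x (Ω'.S ℓ x v) := fun v =>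
      sub_eq_zero.1 (hci' v)
    have hSj : ∀ v, Ω'.S ℓ x (Ω'.reg ℓ j x v) = Ω'.reg ℓ j x (Ω'.S ℓ x v) := fun v =>
      sub_eq_zero.1 (hcj' v)
    refine hzero _ (fun w => ?_) fun v => ?_
    · simp only [LinearMap.sub_apply, Module.End.mul_apply, map_sub, hSi, hSj]
    · have b1 := congrArg (Ω'.S ℓ x) (congrArg P (hmij v))
      simp only [LinearMap.sub_apply, Module.End.mul_apply, hli, hlj, map_sub, map_smul, ← hSi,
        ← hSj, hYij, hll] at b1 ⊢
      linear_combination (norm := module) -((ε : ℤ) : ℂ) • b1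

/-- The intertwining relations imply that the coefficients of a form commute at generic points, as can be
read off from their expressions in terms of the resolvent. -/
theorem integrable (h : IsDual ℓ ε Ω Ω' P Q)
    (hdich : (∀ j, Ω.lin ℓ j = 0) ∨ ∀ j, Ω'.lin ℓ j = 0)
    (hY : ∀ᶠ x in genericFilter n, ∀ i j, i ≠ ℓ → j ≠ ℓ →
      Commute (Ω.reg ℓ i x) (Ω.reg ℓ j x)) : Ω.Integrable := by
  refine integrable_of_eventually ?_
  filter_upwards [h.eventually_resolvent, h.reg_left, h.reg_right, h.comm, h.comm',
    h.eventually_mixed, h.symm.eventually_mixed, hY] with x ⟨R, hR1, hR2, hR3, hBx, hBy⟩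
    hl hr hc hc' hm' hm hY
  set e : ℂ := ((ε : ℤ) : ℂ) with he
  have hSl : ∀ k v, Ω.S ℓ x (Ω.lin ℓ k v) = Ω.lin ℓ k (Ω.S ℓ x v) := fun k v =>
    LinearMap.congr_fun (h.spectral.commute_S_lin x k).eq v
  have hll : ∀ i j v, Ω.lin ℓ i (Ω.lin ℓ j v) = Ω.lin ℓ j (Ω.lin ℓ i v) := fun i j v =>
    LinearMap.congr_fun (h.spectral.commute_lin_lin i j).eq v
  have hll' : ∀ i j v, Ω'.lin ℓ i (Ω'.lin ℓ j v) = Ω'.lin ℓ j (Ω'.lin ℓ i v) := fun i j v =>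
    LinearMap.congr_fun (h.spectral'.commute_lin_lin i j).eq v
  -- the commutator of `Ω'.reg ℓ i x` with the resolvent, from `comm'`
  have hDR : ∀ i, i ≠ ℓ → ∀ w, Ω'.reg ℓ i x (R w) = R (Ω'.reg ℓ i x w) -
      e • R (Ω'.lin ℓ i (P (Q (R w)))) + e • R (P (Q (Ω'.lin ℓ i (R w)))) := by
    intro i hi w
    have a1 := congrArg R (hc' i hi (R w))
    have a2 := hR1 (Ω'.reg ℓ i x (R w))
    have a3 := congrArg (fun u => R (Ω'.reg ℓ i x u)) (hR1 w)
    simp only [map_add, map_sub, map_smul, map_zero, hR2] at a1 a2 a3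
    linear_combination (norm := module) e • a1 - a2 + a3
  have hxi : ∀ i, i ≠ ℓ → Commute (Ω.coeffAt ℓ x) (Ω.coeffAt i x) := by
    intro i hi
    refine LinearMap.ext fun v => ?_
    rw [Module.End.mul_apply, Module.End.mul_apply, hBy i hi, hBy i hi, hBx, hBx]
    have a1 := congrArg (fun u => Q (R u)) (hl i hi v)
    have a2 := hr i hi (R (P v))
    have a3 := congrArg Q (hDR i hi (P v))
    have a4 := hc i hi v
    have a5 := congrArg Q (hR1 (P (Ω.lin ℓ i v)))
    have a6 := congrArg (fun u => Ω.lin ℓ i (Q u)) (hR1 (P v))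
    simp only [map_add, map_sub, map_smul, hR2, hR3, hSl] at a1 a2 a3 a4 a5 a6 ⊢
    linear_combination (norm := module) -a1 + a2 - a3 + a4 + a5 - a6
  have hij : ∀ i j, i ≠ ℓ → j ≠ ℓ → Commute (Ω.coeffAt i x) (Ω.coeffAt j x) := by
    intro i j hi hj
    refine LinearMap.ext fun v => ?_
    have hYij := LinearMap.congr_fun (hY i j hi hj).eq v
    have b1 := hm i j hi hj v
    rw [Module.End.mul_apply, Module.End.mul_apply] at hYij ⊢
    rw [hBy i hi, hBy i hi, hBy j hj, hBy j hj]
    rcases hdich with h0 | h0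
    · have a1 := hr i hi (Ω'.lin ℓ j (R (P v)))
      have a2 := hr j hj (Ω'.lin ℓ i (R (P v)))
      have a3 := congrArg (fun u => Q (Ω'.lin ℓ i (R u))) (hl j hj v)
      have a4 := congrArg (fun u => Q (Ω'.lin ℓ j (R u))) (hl i hi v)
      have a5 := congrArg Q (hm' i j hi hj (R (P v)))
      have a6 := congrArg (fun u => Q (Ω'.lin ℓ i u)) (hDR j hj (P v))
      have a7 := congrArg (fun u => Q (Ω'.lin ℓ j u)) (hDR i hi (P v))
      simp only [map_add, map_sub, map_smul, map_zero, smul_zero, add_zero, zero_add,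
        LinearMap.zero_apply, h0, hR3, hll' i j] at a1 a2 a3 a4 a5 a6 a7 ⊢
      linear_combination (norm := module)
        e • (-a1 + a2 - a3 + a4 + a5 - a6 + a7) + hYij
    · simp only [h0, LinearMap.zero_apply, map_zero, smul_zero, add_zero, map_add, map_smul,
        hYij, hll i j]
      linear_combination (norm := module) x ℓ • b1
  intro i j
  by_cases hi : i = ℓ
  · subst hi
    by_cases hj : j = i
    · subst hj; exact Commute.refl _
    · exact hxi j hj
  · by_cases hj : j = ℓ
    · subst hj; exact (hxi i hi).symm
    · exact hij i j hi hj

/-- The dual of an admissible form is admissible. -/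
theorem admissible (h : IsDual ℓ ε Ω Ω' P Q) (hΩ : Ω.Admissible ℓ) : Ω'.Admissible ℓ := by
  have hd := h.lin_eq_zero_or hΩ
  refine ⟨?_, h.spectral'.isDiagonalizable_cst, fun j hj => h.spectral'.isDiagonalizable_lin hj, ?_⟩
  · exact h.symm.integrable hd.symm (h.eventually_commute_reg hd hΩ.eventually_commute_reg)
  · rintro ⟨j, hj, K, hK, hKj⟩
    refine hd.elim (fun h0 => ?_) fun h0 i _ => h0 i
    -- if the `A_{x_ℓ x_j}` vanish, then the poles of the dual form do not depend on `x_j`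
    exfalso
    have hKd := dependsOn_of_mem_polar hK
    have hKs := (h.symm.mem_polar_iff K).1 hK
    have hd' := dependsOn_of_mem_specFinset hKs
    obtain ⟨v, hv, hv0⟩ := (Submodule.ne_bot_iff _).1 (mem_specFinset.1 hKs)
    have h1 := Ω.lin_apply_of_mem_eig ℓ _ hd' hv hj
    rw [h0, LinearMap.zero_apply, K.slope_flip ℓ _ hKd hj] at h1
    have h2 := (smul_eq_zero.1 h1.symm).resolve_right hv0
    exact (K.slope_ne_zero_iff ℓ hKd j).2 hKj
      ((mul_eq_zero.1 h2).resolve_left (by exact_mod_cast (- -ε).ne_zero))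

/-- The dual of an irreducible form is irreducible: an invariant subspace `U` of the dual corresponds
to the span of the `E_H Q(U)`. -/
theorem irreducible (h : IsDual ℓ ε Ω Ω' P Q) (hΩ : Ω.Irreducible ℓ) :
    Ω'.Irreducible ℓ := by
  intro U hU0 hUl hUres
  have hUproj := h.spectral'.eigProj_mem_of_invariant hU0 hUl
  have hPEQ : ∀ H : Hyperplane n, H.DependsOn ℓ → ∀ u ∈ U, P (Ω.eigProj ℓ H (Q u)) ∈ U := by
    intro H hH u hu
    have h1 := h.res' (H.flip ℓ ε) (hH.flip ε) u
    rw [Hyperplane.flip_flip] at h1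
    rw [← U.neg_mem_iff, ← h1]
    by_cases hp : H.flip ℓ ε ∈ Ω'.polar ℓ
    · exact hUres _ hp hu
    · have : Ω'.res (H.flip ℓ ε) = 0 := by
        by_contra h0
        exact hp (mem_polar.2 ⟨h0, hH.flip ε⟩)
      rw [this]
      exact U.zero_mem
  -- the subspace of `V` that corresponds to `U`
  set X : Submodule ℂ V := ⨆ H : Hyperplane n, U.map (Ω.eigProj ℓ H ∘ₗ Q) with hX
  have hmem : ∀ H, ∀ u ∈ U, Ω.eigProj ℓ H (Q u) ∈ X := fun H u hu =>
    Submodule.mem_iSup_of_mem H ⟨u, hu, rfl⟩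
  have hXle : ∀ {Y : Submodule ℂ V}, (∀ H : Hyperplane n, H.DependsOn ℓ → ∀ u ∈ U,
      Ω.eigProj ℓ H (Q u) ∈ Y) → X ≤ Y := by
    intro Y hY
    refine iSup_le fun H => ?_
    rintro _ ⟨u, hu, rfl⟩
    by_cases hd : H.DependsOn ℓ
    · exact hY H hd u hu
    · rw [LinearMap.comp_apply, Ω.eigProj_eq_zero ℓ H (Ω.eig_eq_bot ℓ H hd)]
      exact Y.zero_mem
  have hQU : ∀ u ∈ U, Q u ∈ X := by
    intro u hu
    rw [← Module.End.one_apply (R := ℂ) (Q u), ← h.spectral.sum_eigProj, LinearMap.sum_apply]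
    exact X.sum_mem fun H _ => hmem H u hu
  have hPX : X ≤ U.comap P := hXle fun H hd u hu => hPEQ H hd u hu
  rcases hΩ X
    (hXle fun H hd u hu => by
      rw [Submodule.mem_comap, Ω.cst_apply_of_mem_eig ℓ H hd (h.spectral.eigProj_mem H _)]
      exact X.smul_mem _ (hmem H u hu))
    (fun j hj => hXle fun H hd u hu => by
      rw [Submodule.mem_comap, Ω.lin_apply_of_mem_eig ℓ H hd (h.spectral.eigProj_mem H _) hj]
      exact X.smul_mem _ (hmem H u hu))
    (fun H hH v hv => by
      rw [Submodule.mem_comap, h.res H (dependsOn_of_mem_polar hH)]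
      exact hQU _ (hUproj _ (hPX hv))) with h0 | h0
  · left
    rw [Submodule.eq_bot_iff]
    intro u hu
    rw [← Module.End.one_apply (R := ℂ) u, ← h.spectral'.sum_eigProj, LinearMap.sum_apply]
    refine Finset.sum_eq_zero fun K _ => h.inj _ _ ?_
    have := hQU _ (hUproj K hu)
    rwa [h0, Submodule.mem_bot] at this
  · right
    rw [eq_top_iff]
    rintro w -
    rw [← Module.End.one_apply (R := ℂ) w, ← h.spectral'.sum_eigProj, LinearMap.sum_apply]
    refine U.sum_mem fun K _ => ?_
    obtain ⟨v, hv⟩ := h.surj K w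
    rw [← hv]
    exact hUproj K (hPX (h0 ▸ Submodule.mem_top))

end IsDual

end

end PfaffianForm

/-! ### The blocks of the Laplace transform -/

namespace Hyperplane

variable {n : ℕ}

open scoped Classical in
/-- The coefficient `A` placed at the hyperplane `a_H = a_{H'}`, provided that this is a hyperplane:
the residues of the form `A d log (a_H - a_{H'})`. -/
noncomputable def rootDiff {M : Type*} [AddCommGroup M] (ℓ : Fin n) (H H' : Hyperplane n) (A : M) :
    Hyperplane n →₀ M :=
  if h : ∃ K : Hyperplane n, K.carrier = {x | H.root ℓ x = H'.root ℓ x} then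
    Finsupp.single h.choose A
  else 0

open scoped Classical in
theorem rootDiff_apply {M : Type*} [AddCommGroup M] (ℓ : Fin n) (H H' : Hyperplane n) (A : M)
    (K : Hyperplane n) : rootDiff ℓ H H' A K =
      if K.carrier = {x | H.root ℓ x = H'.root ℓ x} then A else 0 := by
  unfold rootDiff
  split_ifs with h hK hK
  · have : h.choose = K := Hyperplane.ext (h.choose_spec.trans hK.symm)
    rw [this, Finsupp.single_eq_same]
  · rw [Finsupp.single_eq_of_ne]
    rintro rfl
    exact hK h.choose_spec
  · exact absurd ⟨K, hK⟩ h
  · rfl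

/-- The value of `A d log (a_H - a_{H'})` at a point with `a_H ≠ a_{H'}`. -/
theorem rootDiff_sum {M : Type*} [AddCommGroup M] [Module ℂ M] (ℓ : Fin n) {H H' : Hyperplane n}
    (hH : H.DependsOn ℓ) (hH' : H'.DependsOn ℓ) (A : M) {i : Fin n} (hi : i ≠ ℓ) (x : Fin n → ℂ)
    [DecidablePred fun K : Hyperplane n => K.DependsOn ℓ] :
    ((rootDiff ℓ H H' A).sum fun K B =>
      (if K.DependsOn ℓ then 0 else K.coeff i / K.poly x) • B) =
    ((H.slope ℓ i - H'.slope ℓ i) / (H.root ℓ x - H'.root ℓ x)) • A := by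
  set c : Fin n → ℂ := fun j => if j = ℓ then 0 else H.slope ℓ j - H'.slope ℓ j with hc
  have hroot : ∀ x, H.root ℓ x - H'.root ℓ x =
      ∑ j, c j * x j + (H.root ℓ 0 - H'.root ℓ 0) := root_sub_eq ℓ hH hH'
  have hci : c i = H.slope ℓ i - H'.slope ℓ i := if_neg hi
  by_cases hc0 : c = 0
  · -- the difference of the roots is constant
    have : rootDiff ℓ H H' A = 0 := by
      ext K
      rw [rootDiff_apply, if_neg, Finsupp.zero_apply]
      intro hK
      obtain ⟨y, hy⟩ := K.eventually_poly_ne_zero.exists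
      obtain ⟨j, hj⟩ := Function.ne_iff.1 K.coeff_ne_zero
      have hj : K.DependsOn j := hj
      have hz : Function.update y j (K.root j y) ∈ K.carrier := by
        rw [K.mem_iff_root j hj, K.root_update j hj]; simp
      have hy' : y ∉ K.carrier := fun h => hy ((K.mem_iff y).1 h)
      rw [hK] at hz hy'
      have e1 := hroot y
      have e2 := hroot (Function.update y j (K.root j y))
      simp only [hc0, Pi.zero_apply, zero_mul, Finset.sum_const_zero, zero_add] at e1 e2
      apply hy'
      have hz : H.root ℓ (Function.update y j (K.root j y)) =
        H'.root ℓ (Function.update y j (K.root j y)) := hz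
      change H.root ℓ y = H'.root ℓ y
      rw [← sub_eq_zero, e1, ← e2, hz, sub_self]
    rw [this, Finsupp.sum_zero_index, ← hci, hc0, Pi.zero_apply, zero_div, zero_smul]
  · have hK : ∃ K : Hyperplane n, K.carrier = {x | H.root ℓ x = H'.root ℓ x} := by
      refine ⟨ofCoeffs c (H.root ℓ 0 - H'.root ℓ 0) hc0, ?_⟩
      ext y
      change ∑ j, c j * y j + (H.root ℓ 0 - H'.root ℓ 0) = 0 ↔ H.root ℓ y = H'.root ℓ y
      rw [← hroot, sub_eq_zero]
    rw [rootDiff, dif_pos hK]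
    refine (Finsupp.sum_single_index (h := fun (K : Hyperplane n) (B : M) =>
      (if K.DependsOn ℓ then (0 : ℂ) else K.coeff i / K.poly x) • B) (smul_zero _)).trans ?_
    obtain ⟨r, hr, h1, -, h3⟩ := hK.choose.exists_smul_eq c (H.root ℓ 0 - H'.root ℓ 0) hc0 (by
      intro y
      rw [hK.choose_spec, ← hroot, sub_eq_zero]
      rfl)
    have hd : ¬ hK.choose.DependsOn ℓ := by
      rw [DependsOn, h1]
      simp [hc]
    rw [if_neg hd, h1, h3, ← hroot, hci, mul_div_mul_left _ _ hr]

end Hyperplane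

namespace PfaffianForm

section Block

variable {n : ℕ} {V : Type*} [AddCommGroup V] [Module ℂ V]

/-- The form with values in `End V` whose part without `x_ℓ` is the diagonal block `H` of the
Laplace transform. -/
noncomputable def blockForm (ℓ : Fin n) (Ω : PfaffianForm n V) (H : Hyperplane n) :
    PfaffianForm n V where
  cst y := Ω.cst y + H.root ℓ 0 • Ω.lin y ℓ + H.slope ℓ y • Ω.cst ℓ
  lin := Ω.lin
  lin_self := Ω.lin_self
  lin_symm := Ω.lin_symm
  res := Ω.res + ∑ H' : Ω.polar ℓ, Hyperplane.rootDiff ℓ H H'.1 (Ω.res H'.1)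

theorem blockForm_reg {ℓ : Fin n} {Ω : PfaffianForm n V} (hΩ : Ω.Admissible ℓ) {H : Hyperplane n}
    (hH : H ∈ Ω.polar ℓ) (x : Fin n → ℂ) {i : Fin n} (hi : i ≠ ℓ) :
    (Ω.blockForm ℓ H).reg ℓ i x =
      Ω.reg ℓ i x + H.root ℓ x • Ω.lin ℓ i + H.slope ℓ i • Ω.S ℓ x +
        ∑ H' : Ω.polar ℓ,
          ((H.slope ℓ i - H'.1.slope ℓ i) / (H.root ℓ x - H'.1.root ℓ x)) • Ω.res H'.1 := by
  classical
  have hd := dependsOn_of_mem_polar hH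
  have h1 : H.root ℓ 0 • Ω.lin i ℓ = H.root ℓ x • Ω.lin ℓ i := by
    rw [Ω.lin_symm i ℓ]
    rcases hΩ.slope_eq_zero_or with h | h
    · simp [h]
    · rw [H.root_eq_sum ℓ hd x, Finset.sum_eq_zero, add_zero]
      intro j _
      by_cases hj : j = ℓ
      · simp [hj]
      · simp [h H hH j hj]
  have h2 : H.slope ℓ i • Ω.cst ℓ = H.slope ℓ i • Ω.S ℓ x := by
    rcases hΩ.slope_eq_zero_or with h | h
    · simp [S, h]
    · simp [h H hH i hi]
  have h3 : ((Ω.blockForm ℓ H).res.sum fun K A =>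
      (if K.DependsOn ℓ then 0 else K.coeff i / K.poly x) • A) =
      (Ω.res.sum fun K A => (if K.DependsOn ℓ then 0 else K.coeff i / K.poly x) • A) +
      ∑ H' : Ω.polar ℓ,
          ((H.slope ℓ i - H'.1.slope ℓ i) / (H.root ℓ x - H'.1.root ℓ x)) • Ω.res H'.1 := by
    rw [blockForm, Finsupp.sum_add_index' (fun _ => smul_zero _) (fun _ _ _ => smul_add _ _ _),
      ← Finsupp.sum_finsetSum_index (fun _ => smul_zero _) (fun _ _ _ => smul_add _ _ _)]
    congr 1
    exact Finset.sum_congr rfl fun H' _ =>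
      Hyperplane.rootDiff_sum ℓ hd (dependsOn_of_mem_polar H'.2) _ hi x
  have h3' : (Ω.blockForm ℓ H).reg ℓ i x = (Ω.cst i + H.root ℓ 0 • Ω.lin i ℓ +
      H.slope ℓ i • Ω.cst ℓ) + ∑ j, (if j = ℓ then 0 else x j) • Ω.lin i j +
      ((Ω.blockForm ℓ H).res.sum fun K A =>
      (if K.DependsOn ℓ then 0 else K.coeff i / K.poly x) • A) := by
    rfl
  rw [h3', h3, h1, h2, reg]
  have : ∀ a b c d e f : Module.End ℂ V, a + b + c + d + (e + f) = a + d + e + b + c + f := by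
    intros; abel
  rw [this]

/-- The coefficients of the block form commute with `A_H`. -/
theorem commute_blockForm {ℓ : Fin n} {Ω : PfaffianForm n V} (hΩ : Ω.Admissible ℓ)
    {H : Hyperplane n} (hH : H ∈ Ω.polar ℓ) :
    (∀ i, i ≠ ℓ → Commute (Ω.res H) ((Ω.blockForm ℓ H).cst i)) ∧
    (∀ i j, i ≠ ℓ → j ≠ ℓ → Commute (Ω.res H) (Ω.lin i j)) ∧
    ∀ K : Hyperplane n, ¬ K.DependsOn ℓ → Commute (Ω.res H) ((Ω.blockForm ℓ H).res K) := by
  refine reg_unique ℓ (Ω.blockForm ℓ H) (Ω.blockForm ℓ H)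
    (LinearMap.mulLeft ℂ (Ω.res H)) (LinearMap.mulRight ℂ (Ω.res H)) ?_
  filter_upwards [hΩ.integrable.eventually_relations ℓ] with x hx i hi
  have := ((hx i).2.2 H hH).eq
  rw [← Finset.sum_coe_sort (Ω.polar ℓ), ← blockForm_reg hΩ hH x hi] at this
  exact this

end Block

end PfaffianForm

/-! ### The coefficients of the Laplace transform -/

theorem inducedEnd_mk {V : Type*} [AddCommGroup V] [Module ℂ V] {K : Submodule ℂ V}
    {f : Module.End ℂ V} (h : K ≤ K.comap f) (v : V) :
    inducedEnd K f (Submodule.Quotient.mk v) = Submodule.Quotient.mk (f v) := by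
  rw [inducedEnd, dif_pos h]
  rfl

namespace PfaffianForm

theorem reg_quotient {n : ℕ} {V : Type*} [AddCommGroup V] [Module ℂ V] (ℓ : Fin n)
    {Ω : PfaffianForm n V} {K : Submodule ℂ V} (h : Ω.Preserves K) (i : Fin n) (x : Fin n → ℂ)
    (v : V) : (Ω.quotient K).reg ℓ i x (Submodule.Quotient.mk v) =
      Submodule.Quotient.mk (Ω.reg ℓ i x v) := by
  classical
  have hsum : (Ω.quotient K).res.sum (fun H A =>
      (if H.DependsOn ℓ then 0 else H.coeff i / H.poly x) • A) =
      Ω.res.sum fun H A =>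
        (if H.DependsOn ℓ then 0 else H.coeff i / H.poly x) • inducedEnd K A :=
    Finsupp.sum_mapRange_index (hf := inducedEnd_zero K) fun H => smul_zero _
  have : (Ω.quotient K).reg ℓ i x = inducedEnd K (Ω.cst i) +
      ∑ j, (if j = ℓ then 0 else x j) • inducedEnd K (Ω.lin i j) +
      (Ω.quotient K).res.sum (fun H A =>
      (if H.DependsOn ℓ then 0 else H.coeff i / H.poly x) • A) := rfl
  rw [this, hsum]
  have h2 : Ω.reg ℓ i x = Ω.cst i + ∑ j, (if j = ℓ then 0 else x j) • Ω.lin i j +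
      Ω.res.sum (fun H A => (if H.DependsOn ℓ then 0 else H.coeff i / H.poly x) • A) := rfl
  rw [h2]
  simp only [LinearMap.add_apply, LinearMap.sum_apply, LinearMap.smul_apply, Finsupp.sum,
    inducedEnd_mk (h.1 i), inducedEnd_mk (h.2.1 i _), inducedEnd_mk (h.2.2 _)]
  simp only [← Submodule.mkQ_apply, map_add, map_sum, map_smul]

theorem mem_kerSum {n : ℕ} {V : Type*} [AddCommGroup V] [Module ℂ V] {ℓ : Fin n}
    {Ω : PfaffianForm n V} {v : Ω.polar ℓ → V} : v ∈ Ω.kerSum ℓ ↔ ∀ H, Ω.res H.1 (v H) = 0 := by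
  simp [kerSum, Submodule.mem_pi]

section Laplace

variable {n : ℕ} {V : Type*} [AddCommGroup V] [Module ℂ V] [FiniteDimensional ℂ V]
  {ℓ : Fin n} {Ω : PfaffianForm n V}

theorem signedLaplace_cst_self (ε : ℤˣ) (v : Ω.polar ℓ → V) (H : Ω.polar ℓ) :
    (Ω.signedLaplace ℓ ε).cst ℓ v H = (-((ε : ℤ) : ℂ) * H.1.root ℓ 0) • v H := by
  simp [signedLaplace, blockDiag]

theorem signedLaplace_lin_self (ε : ℤˣ) {j : Fin n} (hj : j ≠ ℓ) (v : Ω.polar ℓ → V)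
    (H : Ω.polar ℓ) :
    (Ω.signedLaplace ℓ ε).lin ℓ j v H = (-((ε : ℤ) : ℂ) * H.1.slope ℓ j) • v H := by
  simp [signedLaplace, blockDiag, Ne.symm hj]

theorem signedLaplace_cst (ε : ℤˣ) {i : Fin n} (hi : i ≠ ℓ) (v : Ω.polar ℓ → V) (H : Ω.polar ℓ) :
    (Ω.signedLaplace ℓ ε).cst i v H = (Ω.blockForm ℓ H).cst i (v H) := by
  simp [signedLaplace, blockDiag, hi, blockForm]

theorem signedLaplace_lin (ε : ℤˣ) {i j : Fin n} (hi : i ≠ ℓ) (hj : j ≠ ℓ) (v : Ω.polar ℓ → V)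
    (H : Ω.polar ℓ) : (Ω.signedLaplace ℓ ε).lin i j v H = Ω.lin i j (v H) := by
  by_cases hij : i = j
  · subst hij; simp [PfaffianForm.lin_self]
  · simp [signedLaplace, blockDiag, hi, hj, hij]

theorem signedLaplace_res (ε : ℤˣ) (K : Hyperplane n) :
    (Ω.signedLaplace ℓ ε).res K = Ω.laplaceRes ℓ ε K := rfl

theorem signedLaplace_res_of_dependsOn (ε : ℤˣ) {K : Hyperplane n} (hK : K.DependsOn ℓ)
    (v : Ω.polar ℓ → V) (H : Ω.polar ℓ) : (Ω.signedLaplace ℓ ε).res K v H =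
      -Ω.eigProj ℓ (K.flip ℓ ε) (∑ H' : Ω.polar ℓ, Ω.res H'.1 (v H')) := by
  rw [signedLaplace_res, laplaceRes, if_pos hK]
  simp

theorem signedLaplace_res_of_not_dependsOn (ε : ℤˣ) {K : Hyperplane n} (hK : ¬ K.DependsOn ℓ)
    (v : Ω.polar ℓ → V) (H : Ω.polar ℓ) : (Ω.signedLaplace ℓ ε).res K v H =
      (Ω.blockForm ℓ H).res K (v H) -
        ∑ H' : Ω.polar ℓ, Hyperplane.rootDiff ℓ H.1 H'.1 (Ω.res H'.1 (v H')) K := by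
  classical
  have e : (Ω.blockForm ℓ H).res K =
      Ω.res K + ∑ H' : Ω.polar ℓ, Hyperplane.rootDiff ℓ H H'.1 (Ω.res H'.1) K := by
    rw [blockForm, Finsupp.add_apply, Finsupp.finsetSum_apply]
  rw [signedLaplace_res, laplaceRes, if_neg hK, e]
  simp only [LinearMap.add_apply, Pi.add_apply, blockDiag, LinearMap.pi_apply,
    LinearMap.comp_apply, LinearMap.proj_apply, LinearMap.sum_apply, add_sub_assoc]
  congr 1
  rw [← Finset.sum_sub_distrib]
  refine Finset.sum_congr rfl fun H' _ => ?_
  rw [Hyperplane.rootDiff_apply, Hyperplane.rootDiff_apply]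
  split_ifs <;> simp

/-- The Laplace transform acts on `𝒦` by its diagonal blocks, which are scalars or coefficients of
`blockForm`, and the latter commute with `A_H`. -/
theorem signedLaplace_preserves (hΩ : Ω.Admissible ℓ) (ε : ℤˣ) :
    (Ω.signedLaplace ℓ ε).Preserves (Ω.kerSum ℓ) := by
  have hker : ∀ {A B : Module.End ℂ V}, Commute A B → ∀ {v : V}, A v = 0 → A (B v) = 0 := by
    intro A B h v hv
    have := LinearMap.congr_fun h.eq v
    rw [Module.End.mul_apply, Module.End.mul_apply, hv, map_zero] at this
    exact this
  have hlin : ∀ j, j ≠ ℓ → Ω.kerSum ℓ ≤ (Ω.kerSum ℓ).comap ((Ω.signedLaplace ℓ ε).lin ℓ j) := by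
    intro j hj v hv
    rw [mem_kerSum] at hv
    rw [Submodule.mem_comap, mem_kerSum]
    intro H
    rw [signedLaplace_lin_self ε hj, map_smul, hv H, smul_zero]
  refine ⟨fun i v hv => ?_, fun i j => ?_, fun K v hv => ?_⟩
  · rw [mem_kerSum] at hv
    rw [Submodule.mem_comap, mem_kerSum]
    intro H
    by_cases hi : i = ℓ
    · subst hi
      rw [signedLaplace_cst_self, map_smul, hv H, smul_zero]
    · rw [signedLaplace_cst ε hi]
      exact hker ((commute_blockForm hΩ H.2).1 i hi) (hv H)
  · by_cases hi : i = ℓ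
    · subst hi
      by_cases hj : j = i
      · subst hj
        rw [PfaffianForm.lin_self]
        intro v _
        simp
      · exact hlin j hj
    · by_cases hj : j = ℓ
      · subst hj
        rw [PfaffianForm.lin_symm]
        exact hlin i hi
      · intro v hv
        rw [mem_kerSum] at hv
        rw [Submodule.mem_comap, mem_kerSum]
        intro H
        rw [signedLaplace_lin ε hi hj]
        exact hker ((commute_blockForm hΩ H.2).2.1 i j hi hj) (hv H)
  · rw [mem_kerSum] at hv
    rw [Submodule.mem_comap, mem_kerSum]
    intro H
    by_cases hK : K.DependsOn ℓ
    · rw [signedLaplace_res_of_dependsOn ε hK]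
      simp [hv]
    · rw [signedLaplace_res_of_not_dependsOn ε hK, Finset.sum_eq_zero, sub_zero]
      · exact hker ((commute_blockForm hΩ H.2).2.2 K hK) (hv H)
      · intro H' _
        classical
        rw [Hyperplane.rootDiff_apply, hv, ite_self]

theorem signedLaplace_reg (hΩ : Ω.Admissible ℓ) (ε : ℤˣ) {i : Fin n} (hi : i ≠ ℓ)
    (x : Fin n → ℂ) (v : Ω.polar ℓ → V) (H : Ω.polar ℓ) :
    (Ω.signedLaplace ℓ ε).reg ℓ i x v H =
      (Ω.reg ℓ i x + H.1.root ℓ x • Ω.lin ℓ i + H.1.slope ℓ i • Ω.S ℓ x +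
        ∑ H' : Ω.polar ℓ, ((H.1.slope ℓ i - H'.1.slope ℓ i) /
          (H.1.root ℓ x - H'.1.root ℓ x)) • Ω.res H'.1) (v H) -
      ∑ H' : Ω.polar ℓ, ((H.1.slope ℓ i - H'.1.slope ℓ i) /
          (H.1.root ℓ x - H'.1.root ℓ x)) • Ω.res H'.1 (v H') := by
  classical
  set c : Hyperplane n → ℂ := fun K => if K.DependsOn ℓ then 0 else K.coeff i / K.poly x with hc
  have hreg : ∀ {V : Type _} [AddCommGroup V] [Module ℂ V] (Ω : PfaffianForm n V),
      Ω.reg ℓ i x = Ω.cst i + ∑ j, (if j = ℓ then 0 else x j) • Ω.lin i j +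
        Ω.res.sum fun K A => c K • A := fun Ω => rfl
  rw [← blockForm_reg hΩ H.2 x hi, hreg, hreg (Ω.blockForm ℓ H)]
  have h1 : ∀ H' : Ω.polar ℓ, ((H.1.slope ℓ i - H'.1.slope ℓ i) /
      (H.1.root ℓ x - H'.1.root ℓ x)) • Ω.res H'.1 (v H') =
      (Hyperplane.rootDiff ℓ H.1 H'.1 (Ω.res H'.1 (v H'))).sum fun K B => c K • B := fun H' =>
    (Hyperplane.rootDiff_sum ℓ (dependsOn_of_mem_polar H.2) (dependsOn_of_mem_polar H'.2) _ hi
      x).symm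
  simp only [h1]
  -- a finite set that contains all the supports
  set s : Finset (Hyperplane n) := (Ω.signedLaplace ℓ ε).res.support ∪
    (Ω.blockForm ℓ H).res.support ∪ Finset.univ.biUnion fun H' : Ω.polar ℓ =>
      (Hyperplane.rootDiff ℓ H.1 H'.1 (Ω.res H'.1 (v H'))).support with hs
  rw [Finsupp.sum_of_support_subset (s := s) _ (fun K hK => by simp only [hs, Finset.mem_union]; tauto)
      _ (fun _ _ => smul_zero _),
    Finsupp.sum_of_support_subset (s := s) (Ω.blockForm ℓ H).res
      (fun K hK => by simp only [hs, Finset.mem_union]; tauto) _ (fun _ _ => smul_zero _),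
    Finset.sum_congr rfl fun H' _ => Finsupp.sum_of_support_subset (s := s)
      (Hyperplane.rootDiff ℓ H.1 H'.1 (Ω.res H'.1 (v H')))
      (fun K hK => by
        simp only [hs, Finset.mem_union, Finset.mem_biUnion]
        exact Or.inr ⟨H', Finset.mem_univ _, hK⟩) _ (fun _ _ => smul_zero _)]
  rw [Finset.sum_comm]
  simp only [LinearMap.add_apply, LinearMap.sum_apply, LinearMap.smul_apply, Pi.add_apply,
    Finset.sum_apply, Pi.smul_apply]
  rw [add_sub_assoc, signedLaplace_cst ε hi, ← Finset.sum_sub_distrib]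
  congr 1
  · congr 1
    refine Finset.sum_congr rfl fun j _ => ?_
    by_cases hj : j = ℓ
    · simp [hj]
    · rw [signedLaplace_lin ε hi hj]; rfl
  · refine Finset.sum_congr rfl fun K _ => ?_
    by_cases hK : K.DependsOn ℓ
    · simp [hc, hK]
    · rw [signedLaplace_res_of_not_dependsOn ε hK, smul_sub, Finset.smul_sum]

theorem signedLaplace_S (ε : ℤˣ) (x : Fin n → ℂ) (v : Ω.polar ℓ → V) (H : Ω.polar ℓ) :
    (Ω.signedLaplace ℓ ε).S ℓ x v H = (-((ε : ℤ) : ℂ) * H.1.root ℓ x) • v H := by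
  rw [S, H.1.root_eq_sum ℓ (dependsOn_of_mem_polar H.2) x]
  simp only [LinearMap.add_apply, LinearMap.sum_apply, LinearMap.smul_apply, Pi.add_apply,
    Finset.sum_apply, Pi.smul_apply]
  rw [signedLaplace_cst_self, mul_add, add_smul, Finset.mul_sum, Finset.sum_smul]
  congr 1
  refine Finset.sum_congr rfl fun j _ => ?_
  by_cases hj : j = ℓ
  · subst hj; simp [PfaffianForm.lin_self]
  · rw [signedLaplace_lin_self ε hj, if_neg hj, smul_smul]
    congr 1
    ring

end Laplace

end PfaffianForm

/-! ### The middle Laplace transform is dual to the form -/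

namespace PfaffianForm

section MiddleLaplace

variable {n : ℕ} {V : Type*} [AddCommGroup V] [Module ℂ V]

/-- The diagonal embedding of `V` into the blocks, modulo the kernels of the residues. -/
noncomputable def diagMap (ℓ : Fin n) (Ω : PfaffianForm n V) :
    V →ₗ[ℂ] (Ω.polar ℓ → V) ⧸ Ω.kerSum ℓ :=
  (Ω.kerSum ℓ).mkQ ∘ₗ LinearMap.pi fun _ => LinearMap.id

/-- The map `(v_H)_H ↦ ∑ A_H v_H`, which is defined modulo the kernels of the residues. -/
noncomputable def resMap (ℓ : Fin n) (Ω : PfaffianForm n V) :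
    ((Ω.polar ℓ → V) ⧸ Ω.kerSum ℓ) →ₗ[ℂ] V :=
  (Ω.kerSum ℓ).liftQ (∑ H : Ω.polar ℓ, Ω.res H.1 ∘ₗ LinearMap.proj H) (by
    intro v hv
    rw [mem_kerSum] at hv
    simp [LinearMap.sum_apply, hv])

theorem diagMap_apply (ℓ : Fin n) (Ω : PfaffianForm n V) (v : V) :
    Ω.diagMap ℓ v = Submodule.Quotient.mk fun _ => v := rfl

theorem resMap_mk (ℓ : Fin n) (Ω : PfaffianForm n V) (v : Ω.polar ℓ → V) :
    Ω.resMap ℓ (Submodule.Quotient.mk v) = ∑ H : Ω.polar ℓ, Ω.res H.1 (v H) := by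
  have : Ω.resMap ℓ (Submodule.Quotient.mk v) =
      (∑ H : Ω.polar ℓ, Ω.res H.1 ∘ₗ LinearMap.proj H : (Ω.polar ℓ → V) →ₗ[ℂ] V) v := rfl
  rw [this, LinearMap.sum_apply]
  rfl

variable [FiniteDimensional ℂ V] {ℓ : Fin n} {Ω : PfaffianForm n V}

/-- The (inverse) middle Laplace transform, according to the sign `ε`. -/
noncomputable abbrev signedMiddleLaplace (ℓ : Fin n) (ε : ℤˣ) (Ω : PfaffianForm n V) :
    PfaffianForm n ((Ω.polar ℓ → V) ⧸ Ω.kerSum ℓ) :=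
  (Ω.signedLaplace ℓ ε).quotient (Ω.kerSum ℓ)

theorem signedMiddleLaplace_S (hΩ : Ω.Admissible ℓ) (ε : ℤˣ) (x : Fin n → ℂ)
    (v : Ω.polar ℓ → V) : (Ω.signedMiddleLaplace ℓ ε).S ℓ x (Submodule.Quotient.mk v) =
      Submodule.Quotient.mk fun H => (-((ε : ℤ) : ℂ) * H.1.root ℓ x) • v H := by
  rw [← reg_self, reg_quotient ℓ (signedLaplace_preserves hΩ ε), reg_self]
  congr 1
  funext H
  rw [signedLaplace_S]

theorem signedMiddleLaplace_lin (hΩ : Ω.Admissible ℓ) (ε : ℤˣ) {j : Fin n} (hj : j ≠ ℓ)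
    (v : Ω.polar ℓ → V) : (Ω.signedMiddleLaplace ℓ ε).lin ℓ j (Submodule.Quotient.mk v) =
      Submodule.Quotient.mk fun H => (-((ε : ℤ) : ℂ) * H.1.slope ℓ j) • v H := by
  refine (inducedEnd_mk ((signedLaplace_preserves hΩ ε).2.1 ℓ j) v).trans ?_
  congr 1
  funext H
  rw [signedLaplace_lin_self ε hj]

theorem signedMiddleLaplace_res (hΩ : Ω.Admissible ℓ) (ε : ℤˣ) {K : Hyperplane n}
    (hK : K.DependsOn ℓ) (w : (Ω.polar ℓ → V) ⧸ Ω.kerSum ℓ) :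
    (Ω.signedMiddleLaplace ℓ ε).res K w =
      -Ω.diagMap ℓ (Ω.eigProj ℓ (K.flip ℓ ε) (Ω.resMap ℓ w)) := by
  obtain ⟨v, rfl⟩ := Submodule.Quotient.mk_surjective _ w
  have h1 : (Ω.signedMiddleLaplace ℓ ε).res K =
      inducedEnd (Ω.kerSum ℓ) ((Ω.signedLaplace ℓ ε).res K) := 
    Finsupp.mapRange_apply (hf := inducedEnd_zero _)
  rw [h1, inducedEnd_mk ((signedLaplace_preserves hΩ ε).2.2 K), resMap_mk, diagMap_apply,
    ← Submodule.Quotient.mk_neg]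
  congr 1
  funext H
  rw [signedLaplace_res_of_dependsOn ε hK]
  rfl

open scoped Classical in
theorem mk_single_mem_eig (hΩ : Ω.Admissible ℓ) (ε : ℤˣ) (H : Ω.polar ℓ) (v : V) :
    (Submodule.Quotient.mk (Pi.single H v) : (Ω.polar ℓ → V) ⧸ Ω.kerSum ℓ) ∈
      (Ω.signedMiddleLaplace ℓ ε).eig ℓ (H.1.flip ℓ (-ε)) := by
  have hd := dependsOn_of_mem_polar H.2
  have hsingle : ∀ c : Ω.polar ℓ → ℂ,
      (fun K => c K • (Pi.single H v : Ω.polar ℓ → V) K) = c H • Pi.single H v := by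
    intro c
    funext K
    by_cases hK : K = H
    · subst hK; rfl
    · simp [hK]
  refine mem_eig_of_apply ℓ _ _ (hd.flip (-ε)) ?_ fun j hj => ?_
  · rw [← S_zero, signedMiddleLaplace_S hΩ, hsingle fun K => -((ε : ℤ) : ℂ) * K.1.root ℓ 0,
      H.1.root_flip ℓ _ hd, Submodule.Quotient.mk_smul]
    simp
  · rw [signedMiddleLaplace_lin hΩ ε hj, hsingle fun K => -((ε : ℤ) : ℂ) * K.1.slope ℓ j,
      H.1.slope_flip ℓ _ hd hj, Submodule.Quotient.mk_smul]
    simp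

omit [FiniteDimensional ℂ V] in
open scoped Classical in
theorem mk_eq_sum_single (v : Ω.polar ℓ → V) :
    (Submodule.Quotient.mk v : (Ω.polar ℓ → V) ⧸ Ω.kerSum ℓ) = ∑ H : Ω.polar ℓ, Submodule.Quotient.mk (Pi.single H (v H)) := by
  simp only [← Submodule.mkQ_apply]
  rw [← map_sum, Finset.univ_sum_single]

theorem isSpectral_signedMiddleLaplace (hΩ : Ω.Admissible ℓ) (ε : ℤˣ) :
    (Ω.signedMiddleLaplace ℓ ε).IsSpectral ℓ := by
  classical
  refine isSpectral_of_iSup (fun H : Ω.polar ℓ => LinearMap.range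
    ((Ω.kerSum ℓ).mkQ ∘ₗ LinearMap.single ℂ (fun _ : Ω.polar ℓ => V) H))
    (fun H => H.1.flip ℓ (-ε)) ?_ ?_
  · rintro H _ ⟨v, rfl⟩
    exact mk_single_mem_eig hΩ ε H v
  · rw [eq_top_iff]
    rintro w -
    obtain ⟨v, rfl⟩ := Submodule.Quotient.mk_surjective _ w
    rw [mk_eq_sum_single]
    exact Submodule.sum_mem _ fun H _ => Submodule.mem_iSup_of_mem H ⟨v H, rfl⟩

open scoped Classical in
theorem eigProj_signedMiddleLaplace (hΩ : Ω.Admissible ℓ) (ε : ℤˣ) (H : Ω.polar ℓ)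
    (v : Ω.polar ℓ → V) :
    (Ω.signedMiddleLaplace ℓ ε).eigProj ℓ (H.1.flip ℓ (-ε)) (Submodule.Quotient.mk v) = Submodule.Quotient.mk (Pi.single H (v H)) := by
  have hs := isSpectral_signedMiddleLaplace hΩ ε
  rw [mk_eq_sum_single v, map_sum, Finset.sum_eq_single H]
  · exact hs.eigProj_apply_mem (mk_single_mem_eig hΩ ε H _)
  · intro K _ hK
    refine hs.eigProj_apply_of_ne (fun e => hK ?_) (mk_single_mem_eig hΩ ε K _)
    exact Subtype.ext (flip_injective ℓ (-ε) e)
  · exact fun h => absurd (Finset.mem_univ H) h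

theorem eigProj_signedMiddleLaplace_of_notMem (hΩ : Ω.Admissible ℓ) (ε : ℤˣ) {K : Hyperplane n}
    (hK : K.flip ℓ (-ε) ∉ Ω.polar ℓ) : (Ω.signedMiddleLaplace ℓ ε).eigProj ℓ K = 0 := by
  classical
  have hs := isSpectral_signedMiddleLaplace hΩ ε
  refine LinearMap.ext fun w => ?_
  obtain ⟨v, rfl⟩ := Submodule.Quotient.mk_surjective _ w
  rw [mk_eq_sum_single v, map_sum, LinearMap.zero_apply]
  refine Finset.sum_eq_zero fun H _ => ?_
  refine hs.eigProj_apply_of_ne (fun e => hK ?_) (mk_single_mem_eig hΩ ε H _)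
  rw [← e, Hyperplane.flip_flip]
  exact H.2

theorem res_eq_resMap_eigProj_diagMap (hΩ : Ω.Admissible ℓ) (ε : ℤˣ) {H : Hyperplane n}
    (hH : H.DependsOn ℓ) (v : V) : Ω.res H v = Ω.resMap ℓ
      ((Ω.signedMiddleLaplace ℓ ε).eigProj ℓ (H.flip ℓ (-ε)) (Ω.diagMap ℓ v)) := by
  classical
  by_cases hp : H ∈ Ω.polar ℓ
  · rw [diagMap_apply, eigProj_signedMiddleLaplace hΩ ε ⟨H, hp⟩, resMap_mk,
      Finset.sum_eq_single ⟨H, hp⟩]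
    · rw [Pi.single_eq_same]
    · intro K _ hK
      rw [Pi.single_eq_of_ne hK, map_zero]
    · exact fun h => absurd (Finset.mem_univ _) h
  · rw [eigProj_signedMiddleLaplace_of_notMem hΩ ε (by rwa [Hyperplane.flip_flip]),
      LinearMap.zero_apply, map_zero]
    have : Ω.res H = 0 := by
      by_contra h
      exact hp (mem_polar.2 ⟨h, hH⟩)
    rw [this, LinearMap.zero_apply]

/-- In an irreducible system, every common eigenspace is spanned by components of the images of the
residues. -/
theorem Irreducible.exists_eigProj_resMap (hΩ : Ω.Admissible ℓ) (hirr : Ω.Irreducible ℓ)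
    (hne : (Ω.polar ℓ).Nonempty) (H : Hyperplane n) (v : V) :
    ∃ w, Ω.eigProj ℓ H (Ω.resMap ℓ w) = Ω.eigProj ℓ H v := by
  classical
  have hs := hΩ.isSpectral
  set X : Submodule ℂ V := ⨆ K, LinearMap.range (Ω.eigProj ℓ K ∘ₗ Ω.resMap ℓ) with hX
  have hmem : ∀ K w, Ω.eigProj ℓ K (Ω.resMap ℓ w) ∈ X := fun K w =>
    Submodule.mem_iSup_of_mem K ⟨w, rfl⟩
  have hXle : ∀ {Y : Submodule ℂ V}, (∀ K : Hyperplane n, K.DependsOn ℓ → ∀ w,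
      Ω.eigProj ℓ K (Ω.resMap ℓ w) ∈ Y) → X ≤ Y := by
    intro Y hY
    refine iSup_le fun K => ?_
    rintro _ ⟨w, rfl⟩
    by_cases hd : K.DependsOn ℓ
    · exact hY K hd w
    · rw [LinearMap.comp_apply, Ω.eigProj_eq_zero ℓ K (Ω.eig_eq_bot ℓ K hd)]
      exact Y.zero_mem
  have hres : ∀ K ∈ Ω.polar ℓ, ∀ u, Ω.res K u ∈ X := by
    intro K hK u
    rw [res_eq_resMap_eigProj_diagMap hΩ 1 (dependsOn_of_mem_polar hK)]
    set w := (Ω.signedMiddleLaplace ℓ 1).eigProj ℓ (K.flip ℓ (-1)) (Ω.diagMap ℓ u)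
    rw [← Module.End.one_apply (R := ℂ) (Ω.resMap ℓ w), ← hs.sum_eigProj, LinearMap.sum_apply]
    exact X.sum_mem fun L _ => hmem L w
  have htop : X = ⊤ := by
    refine (hirr X
      (hXle fun K hd w => by
        rw [Submodule.mem_comap, Ω.cst_apply_of_mem_eig ℓ K hd (hs.eigProj_mem K _)]
        exact X.smul_mem _ (hmem K w))
      (fun j hj => hXle fun K hd w => by
        rw [Submodule.mem_comap, Ω.lin_apply_of_mem_eig ℓ K hd (hs.eigProj_mem K _) hj]
        exact X.smul_mem _ (hmem K w))
      (fun K hK u _ => hres K hK u)).resolve_left fun h0 => ?_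
    obtain ⟨K, hK⟩ := hne
    refine (mem_polar.1 hK).1 (LinearMap.ext fun u => ?_)
    have := hres K hK u
    rwa [h0, Submodule.mem_bot] at this
  have hv : v ∈ X := htop ▸ Submodule.mem_top
  have hle : X ≤ (LinearMap.range (Ω.eigProj ℓ H ∘ₗ Ω.resMap ℓ)).comap (Ω.eigProj ℓ H) := by
    refine hXle fun K _ w => ?_
    rw [Submodule.mem_comap, ← Module.End.mul_apply, hs.eigProj_mul]
    split_ifs with h
    · exact ⟨w, rfl⟩
    · exact Submodule.zero_mem _
  obtain ⟨w, hw⟩ := hle hv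
  exact ⟨w, hw⟩

/-- In an irreducible system, no vector of a common eigenspace is killed by all residues. -/
theorem Irreducible.eigProj_eq_zero (hΩ : Ω.Admissible ℓ) (hirr : Ω.Irreducible ℓ)
    (hne : (Ω.polar ℓ).Nonempty) (H : Hyperplane n) (v : V)
    (hv : Ω.diagMap ℓ (Ω.eigProj ℓ H v) = 0) : Ω.eigProj ℓ H v = 0 := by
  classical
  have hs := hΩ.isSpectral
  set Y : Submodule ℂ V := ⨅ K, LinearMap.ker (Ω.diagMap ℓ ∘ₗ Ω.eigProj ℓ K) with hY
  have hmem : ∀ {u}, u ∈ Y ↔ ∀ K, Ω.diagMap ℓ (Ω.eigProj ℓ K u) = 0 := by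
    intro u
    simp [hY, Submodule.mem_iInf]
  have hcomm : ∀ (f : Module.End ℂ V) (c : Hyperplane n → ℂ),
      (∀ K : Hyperplane n, K.DependsOn ℓ → ∀ u ∈ Ω.eig ℓ K, f u = c K • u) → Y ≤ Y.comap f := by
    intro f c hf u hu
    rw [Submodule.mem_comap, hmem]
    intro K
    have : Ω.eigProj ℓ K (f u) = c K • Ω.eigProj ℓ K u := by
      refine LinearMap.congr_fun (hs.ext (f := Ω.eigProj ℓ K ∘ₗ f) (g := c K • Ω.eigProj ℓ K)
        fun L hL w hw => ?_) u
      rw [LinearMap.comp_apply, hf L hL w hw, LinearMap.smul_apply, map_smul]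
      by_cases hLK : L = K
      · rw [hLK]
      · rw [hs.eigProj_apply_of_ne hLK hw, smul_zero, smul_zero]
    rw [this, map_smul, hmem.1 hu, smul_zero]
  have hP : ∀ u ∈ Y, Ω.diagMap ℓ u = 0 := by
    intro u hu
    rw [← Module.End.one_apply (R := ℂ) u, ← hs.sum_eigProj, LinearMap.sum_apply, map_sum]
    exact Finset.sum_eq_zero fun K _ => hmem.1 hu K
  have hres : ∀ K ∈ Ω.polar ℓ, ∀ u ∈ Y, Ω.res K u = 0 := by
    intro K hK u hu
    rw [res_eq_resMap_eigProj_diagMap hΩ 1 (dependsOn_of_mem_polar hK), hP u hu, map_zero, map_zero]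
  have hbot : Y = ⊥ := by
    refine (hirr Y (hcomm _ _ fun K hK u hu => Ω.cst_apply_of_mem_eig ℓ K hK hu)
      (fun j hj => hcomm _ _ fun K hK u hu => Ω.lin_apply_of_mem_eig ℓ K hK hu hj)
      (fun K hK u hu => ?_)).resolve_right fun h0 => ?_
    · rw [Submodule.mem_comap, hres K hK u hu]
      exact Y.zero_mem
    · obtain ⟨K, hK⟩ := hne
      exact (mem_polar.1 hK).1 (LinearMap.ext fun u => hres K hK u (h0 ▸ Submodule.mem_top))
  have : Ω.eigProj ℓ H v ∈ Y := by
    rw [hmem]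
    intro K
    rw [← Module.End.mul_apply, hs.eigProj_mul]
    split_ifs with h
    · rw [h]; exact hv
    · simp
  rwa [hbot, Submodule.mem_bot] at this

/-- The middle Laplace transform of an irreducible system is dual to the system. -/
theorem isDual_signedMiddleLaplace (hΩ : Ω.Admissible ℓ) (hirr : Ω.Irreducible ℓ)
    (hne : (Ω.polar ℓ).Nonempty) (ε : ℤˣ) :
    IsDual ℓ ε Ω (Ω.signedMiddleLaplace ℓ ε) (Ω.diagMap ℓ) (Ω.resMap ℓ) := by
  classical
  have hε : ((ε : ℤ) : ℂ) * ((ε : ℤ) : ℂ) = 1 := by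
    rcases Int.units_eq_one_or ε with h | h <;> simp [h]
  -- every eigenprojection of the transform is a block projection or zero
  have hblock : ∀ K, (∃ H : Ω.polar ℓ, K = H.1.flip ℓ (-ε)) ∨
      (Ω.signedMiddleLaplace ℓ ε).eigProj ℓ K = 0 := by
    intro K
    by_cases hK : K.flip ℓ (-ε) ∈ Ω.polar ℓ
    · exact Or.inl ⟨⟨_, hK⟩, (K.flip_flip ℓ _).symm⟩
    · exact Or.inr (eigProj_signedMiddleLaplace_of_notMem hΩ ε hK)
  have hsum : ∀ f : Hyperplane n → Module.End ℂ V,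
      ∑ H ∈ Ω.polar ℓ, f H = ∑ H : Ω.polar ℓ, f H.1 := fun f =>
    (Finset.sum_coe_sort (Ω.polar ℓ) f).symm
  set c : Fin n → (Fin n → ℂ) → Ω.polar ℓ → Ω.polar ℓ → ℂ := fun i x H H' =>
    (H.1.slope ℓ i - H'.1.slope ℓ i) / (H.1.root ℓ x - H'.1.root ℓ x) with hc
  have hcs : ∀ i x H H', c i x H H' = c i x H' H := fun i x H H' => by
    simp only [hc]
    rw [← neg_sub (H'.1.slope ℓ i), ← neg_sub (H'.1.root ℓ x), neg_div_neg_eq]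
  have hreg : ∀ x i, i ≠ ℓ → ∀ v : Ω.polar ℓ → V,
      (Ω.signedMiddleLaplace ℓ ε).reg ℓ i x (Submodule.Quotient.mk v) =
        Submodule.Quotient.mk fun H => (Ω.reg ℓ i x + H.1.root ℓ x • Ω.lin ℓ i +
          H.1.slope ℓ i • Ω.S ℓ x + ∑ H', c i x H H' • Ω.res H'.1) (v H) -
          ∑ H', c i x H H' • Ω.res H'.1 (v H') := fun x i hi v => by
    rw [reg_quotient ℓ (signedLaplace_preserves hΩ ε)]
    exact congrArg Submodule.Quotient.mk (funext fun H => signedLaplace_reg hΩ ε hi x v H)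
  refine
    { spectral := hΩ.isSpectral
      spectral' := isSpectral_signedMiddleLaplace hΩ ε
      res := fun H hH v => res_eq_resMap_eigProj_diagMap hΩ ε hH v
      res' := fun K hK w => signedMiddleLaplace_res hΩ ε hK w
      surj := ?_
      surj' := hirr.exists_eigProj_resMap hΩ hne
      inj := ?_
      inj' := hirr.eigProj_eq_zero hΩ hne
      reg_left := ?_
      reg_right := ?_
      comm := ?_
      comm' := ?_ }
  · intro K w
    obtain ⟨v, rfl⟩ := Submodule.Quotient.mk_surjective _ w
    rcases hblock K with ⟨H, rfl⟩ | h0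
    · exact ⟨v H, by rw [diagMap_apply, eigProj_signedMiddleLaplace hΩ,
        eigProj_signedMiddleLaplace hΩ]⟩
    · exact ⟨0, by rw [h0]; rfl⟩
  · intro K w hw
    obtain ⟨v, rfl⟩ := Submodule.Quotient.mk_surjective _ w
    rcases hblock K with ⟨H, rfl⟩ | h0
    · rw [eigProj_signedMiddleLaplace hΩ] at hw ⊢
      rw [resMap_mk, Finset.sum_eq_single H, Pi.single_eq_same] at hw
      · rw [Submodule.Quotient.mk_eq_zero, mem_kerSum]
        intro K
        by_cases hK : K = H
        · subst hK; rw [Pi.single_eq_same, hw]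
        · rw [Pi.single_eq_of_ne hK, map_zero]
      · intro K _ hK
        rw [Pi.single_eq_of_ne hK, map_zero]
      · exact fun h => absurd (Finset.mem_univ _) h
    · rw [h0, LinearMap.zero_apply]
  · refine Eventually.of_forall fun x i hi v => ?_
    rw [diagMap_apply, hreg x i hi, diagMap_apply, diagMap_apply, diagMap_apply,
      signedMiddleLaplace_S hΩ, signedMiddleLaplace_lin hΩ ε hi, ← Submodule.Quotient.mk_add,
      ← Submodule.Quotient.mk_smul, ← Submodule.Quotient.mk_sub]
    congr 1
    funext H
    simp only [LinearMap.add_apply, LinearMap.sum_apply, LinearMap.smul_apply, Pi.add_apply,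
      Pi.sub_apply, Pi.smul_apply, smul_add, smul_smul]
    rw [← mul_assoc, ← mul_assoc, mul_neg, hε]
    module
  · filter_upwards [hΩ.integrable.eventually_relations ℓ] with x hx i hi w
    obtain ⟨v, rfl⟩ := Submodule.Quotient.mk_surjective _ w
    rw [hreg x i hi, signedMiddleLaplace_S hΩ, signedMiddleLaplace_lin hΩ ε hi]
    simp only [resMap_mk]
    have hcomm : ∀ (H : Ω.polar ℓ) (u : V), Ω.res H.1 ((Ω.reg ℓ i x + H.1.root ℓ x • Ω.lin ℓ i +
        H.1.slope ℓ i • Ω.S ℓ x + ∑ H', c i x H H' • Ω.res H'.1) u) =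
        (Ω.reg ℓ i x + H.1.root ℓ x • Ω.lin ℓ i +
        H.1.slope ℓ i • Ω.S ℓ x + ∑ H', c i x H H' • Ω.res H'.1) (Ω.res H.1 u) := fun H u => by
      have := LinearMap.congr_fun ((hx i).2.2 H.1 H.2).eq u
      rw [hsum fun H' => ((H.1.slope ℓ i - H'.slope ℓ i) / (H.1.root ℓ x - H'.root ℓ x)) •
        Ω.res H'] at this
      exact this
    -- the terms that are quadratic in the residues cancel by symmetry
    have hsymm : ∑ H : Ω.polar ℓ, ∑ H' : Ω.polar ℓ, c i x H H' • Ω.res H'.1 (Ω.res H.1 (v H)) =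
        ∑ H : Ω.polar ℓ, ∑ H' : Ω.polar ℓ, c i x H H' • Ω.res H.1 (Ω.res H'.1 (v H')) := by
      rw [Finset.sum_comm]
      exact Finset.sum_congr rfl fun H _ => Finset.sum_congr rfl fun H' _ => by rw [hcs]
    simp only [map_sub, hcomm, Finset.sum_sub_distrib]
    simp only [LinearMap.add_apply, LinearMap.sum_apply, LinearMap.smul_apply, map_sum, map_smul,
      Finset.sum_add_distrib, hsymm, smul_add, Finset.smul_sum, smul_smul]
    simp only [neg_mul, mul_neg, ← mul_assoc, hε, one_mul, neg_smul, Finset.sum_neg_distrib]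
    abel
  · filter_upwards [hΩ.integrable.eventually_relations ℓ] with x hx i hi v
    have h1 := LinearMap.congr_fun (hx i).2.1 v
    rw [hsum] at h1
    simp only [LinearMap.add_apply, LinearMap.sub_apply, Module.End.mul_apply, LinearMap.zero_apply,
      LinearMap.sum_apply] at h1
    rw [diagMap_apply, diagMap_apply, resMap_mk, resMap_mk]
    exact h1
  · filter_upwards [Ω.eventually_polar_injOn ℓ] with x hinj i hi w
    obtain ⟨v, rfl⟩ := Submodule.Quotient.mk_surjective _ w
    rw [hreg x i hi, signedMiddleLaplace_S hΩ, signedMiddleLaplace_S hΩ, hreg x i hi,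
      signedMiddleLaplace_lin hΩ ε hi, resMap_mk, resMap_mk, diagMap_apply, diagMap_apply,
      signedMiddleLaplace_lin hΩ ε hi, ← Submodule.Quotient.mk_sub, ← Submodule.Quotient.mk_sub,
      ← Submodule.Quotient.mk_add, ← Submodule.Quotient.mk_zero]
    congr 1
    funext H
    have hterm : ∀ H' : Ω.polar ℓ, (H.1.root ℓ x - H'.1.root ℓ x) * c i x H H' =
        H.1.slope ℓ i - H'.1.slope ℓ i := fun H' => by
      by_cases e : H = H'
      · subst e; simp
      · refine mul_div_cancel₀ _ (sub_ne_zero.2 fun h => e ?_)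
        exact Subtype.ext (hinj H.2 H'.2 h)
    have key : ∑ H' : Ω.polar ℓ, ((H.1.root ℓ x - H'.1.root ℓ x) * c i x H H') •
        Ω.res H'.1 (v H') = ∑ H' : Ω.polar ℓ, (H.1.slope ℓ i - H'.1.slope ℓ i) •
        Ω.res H'.1 (v H') :=
      Finset.sum_congr rfl fun H' _ => by rw [hterm]
    simp only [sub_mul, sub_smul, Finset.sum_sub_distrib] at key
    replace key := congrArg (fun u => (-((ε : ℤ) : ℂ)) • u) key
    simp only [smul_sub, Finset.smul_sum, smul_smul] at key
    have hcomm : ∀ H' : Ω.polar ℓ, c i x H H' * (-((ε : ℤ) : ℂ) * H'.1.root ℓ x) =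
        -((ε : ℤ) : ℂ) * (H'.1.root ℓ x * c i x H H') := fun H' => by ring
    simp only [Pi.sub_apply, Pi.add_apply, Pi.zero_apply, map_smul, smul_sub,
      smul_smul, Finset.smul_sum, hcomm, mul_assoc (-((ε : ℤ) : ℂ))]
    rw [eq_comm, ← sub_eq_zero] at key
    rw [← key]
    abel

end MiddleLaplace

end PfaffianForm

/-! ### Duality and gauge equivalence -/

namespace PfaffianForm

section Gauge

variable {n : ℕ} {V W W' : Type*} [AddCommGroup V] [Module ℂ V] [AddCommGroup W] [Module ℂ W]
  [AddCommGroup W'] [Module ℂ W'] {ℓ : Fin n} {ε : ℤˣ}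

section

variable [FiniteDimensional ℂ W] [FiniteDimensional ℂ W']

/-- Duality is invariant under gauge equivalence of the dual form. -/
theorem IsDual.gauge_right {Ω : PfaffianForm n V} {Ω₁ : PfaffianForm n W} {Ω₂ : PfaffianForm n W'}
    {P : V →ₗ[ℂ] W} {Q : W →ₗ[ℂ] V} (h : IsDual ℓ ε Ω Ω₁ P Q) (hg : Ω₁.GaugeEquiv Ω₂) :
    ∃ P' Q', IsDual ℓ ε Ω Ω₂ P' Q' := by
  obtain ⟨θ, hc, hl, hr⟩ := hg
  have hcθ : ∀ i w, Ω₂.cst i (θ w) = θ (Ω₁.cst i w) := fun i w => by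
    rw [hc, LinearEquiv.conj_apply_apply, θ.symm_apply_apply]
  have hlθ : ∀ i j w, Ω₂.lin i j (θ w) = θ (Ω₁.lin i j w) := fun i j w => by
    rw [hl, LinearEquiv.conj_apply_apply, θ.symm_apply_apply]
  have hrθ : ∀ H w, Ω₂.res H (θ w) = θ (Ω₁.res H w) := fun H w => by
    rw [hr, LinearEquiv.conj_apply_apply, θ.symm_apply_apply]
  have hS : ∀ i x w, Ω₂.S i x (θ w) = θ (Ω₁.S i x w) := fun i x w => by
    simp only [S, LinearMap.add_apply, LinearMap.sum_apply, LinearMap.smul_apply, hcθ, hlθ,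
      map_add, map_sum, map_smul]
  have hsupp : Ω₂.res.support = Ω₁.res.support := by
    ext H
    rw [Finsupp.mem_support_iff, Finsupp.mem_support_iff, hr, not_iff_not,
      LinearEquiv.map_eq_zero_iff]
  have hreg : ∀ i x w, Ω₂.reg ℓ i x (θ w) = θ (Ω₁.reg ℓ i x w) := fun i x w => by
    simp only [reg, Finsupp.sum, hsupp, LinearMap.add_apply, LinearMap.sum_apply,
      LinearMap.smul_apply, hcθ, hlθ, hrθ, map_add, map_sum, map_smul]
  have heig : ∀ H w, w ∈ Ω₁.eig ℓ H → θ w ∈ Ω₂.eig ℓ H := fun H w hw x hx => by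
    rw [hS, hw x hx, map_smul]
  have hspec : Ω₂.IsSpectral ℓ := by
    refine eq_top_iff.2 fun w' _ => ?_
    have hle : ⨆ H, Ω₁.eig ℓ H ≤ (⨆ H, Ω₂.eig ℓ H).comap θ.toLinearMap :=
      iSup_le fun H w hw => Submodule.mem_iSup_of_mem H (heig H w hw)
    have := hle (show θ.symm w' ∈ ⨆ H, Ω₁.eig ℓ H from h.spectral'.symm ▸ Submodule.mem_top)
    simpa using this
  have hproj : ∀ K w, Ω₂.eigProj ℓ K (θ w) = θ (Ω₁.eigProj ℓ K w) := fun K => by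
    refine LinearMap.congr_fun (h.spectral'.ext (f := Ω₂.eigProj ℓ K ∘ₗ θ.toLinearMap)
      (g := θ.toLinearMap ∘ₗ Ω₁.eigProj ℓ K) fun L _ w hw => ?_)
    simp only [LinearMap.comp_apply, LinearEquiv.coe_coe]
    by_cases hLK : L = K
    · subst hLK
      rw [hspec.eigProj_apply_mem (heig L w hw), h.spectral'.eigProj_apply_mem hw]
    · rw [hspec.eigProj_apply_of_ne hLK (heig L w hw), h.spectral'.eigProj_apply_of_ne hLK hw,
        map_zero]
  refine ⟨θ.toLinearMap ∘ₗ P, Q ∘ₗ θ.symm.toLinearMap,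
    { spectral := h.spectral
      spectral' := hspec
      res := fun H hH v => ?_
      res' := fun K hK w' => ?_
      surj := fun K w' => ?_
      surj' := fun H v => ?_
      inj := fun K w' hw' => ?_
      inj' := fun H v hv => ?_
      reg_left := ?_
      reg_right := ?_
      comm := ?_
      comm' := ?_ }⟩
  · simp [hproj, ← h.res H hH]
  · obtain ⟨w, rfl⟩ := θ.surjective w'
    simp [hrθ, h.res' K hK]
  · obtain ⟨w, rfl⟩ := θ.surjective w'
    obtain ⟨v, hv⟩ := h.surj K w
    exact ⟨v, by simp [hproj, hv]⟩
  · obtain ⟨w, hw⟩ := h.surj' H v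
    exact ⟨θ w, by simp [hw]⟩
  · obtain ⟨w, rfl⟩ := θ.surjective w'
    rw [hproj] at hw' ⊢
    rw [h.inj K w (by simpa using hw'), map_zero]
  · exact h.inj' H v (by simpa using hv)
  · filter_upwards [h.reg_left] with x hx i hi v
    simp [hreg, hS, hlθ, hx i hi]
  · filter_upwards [h.reg_right] with x hx i hi w'
    obtain ⟨w, rfl⟩ := θ.surjective w'
    simp [hreg, hS, hlθ, hx i hi]
  · filter_upwards [h.comm] with x hx i hi v
    simpa using hx i hi v
  · filter_upwards [h.comm'] with x hx i hi w'
    obtain ⟨w, rfl⟩ := θ.surjective w'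
    simpa [hreg, hS, hlθ] using congrArg θ (hx i hi w)

theorem IsDual.gauge_left [FiniteDimensional ℂ V] {Ω : PfaffianForm n V} {Ω₁ : PfaffianForm n W} {Ω₂ : PfaffianForm n W'}
    {P : W →ₗ[ℂ] V} {Q : V →ₗ[ℂ] W} (h : IsDual ℓ ε Ω₁ Ω P Q) (hg : Ω₁.GaugeEquiv Ω₂) :
    ∃ P' Q', IsDual ℓ ε Ω₂ Ω P' Q' := by
  obtain ⟨P', Q', h'⟩ := h.symm.gauge_right hg
  exact ⟨Q', -P', by simpa using h'.symm⟩

end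

/-- The image of a form under a linear equivalence of the coefficient spaces. -/
noncomputable def transport (Ω : PfaffianForm n V) (θ : V ≃ₗ[ℂ] W) : PfaffianForm n W where
  cst i := θ.conj (Ω.cst i)
  lin i j := θ.conj (Ω.lin i j)
  lin_self i := by rw [Ω.lin_self, map_zero]
  lin_symm i j := by rw [Ω.lin_symm]
  res := Ω.res.mapRange θ.conj (map_zero _)

theorem gaugeEquiv_transport (Ω : PfaffianForm n V) (θ : V ≃ₗ[ℂ] W) :
    Ω.GaugeEquiv (Ω.transport θ) :=
  ⟨θ, fun _ => rfl, fun _ _ => rfl, fun _ => rfl⟩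

end Gauge

section Duality

variable {n : ℕ} {V W : Type*} [AddCommGroup V] [Module ℂ V] [FiniteDimensional ℂ V]
  [AddCommGroup W] [Module ℂ W] [FiniteDimensional ℂ W] {ℓ : Fin n} {ε : ℤˣ}
  {Ω : PfaffianForm n V} {Ω' : PfaffianForm n W} {P : V →ₗ[ℂ] W} {Q : W →ₗ[ℂ] V}

omit [FiniteDimensional ℂ W] in
/-- The poles of the dual form are, up to the sign, the components of the characteristic variety. -/
theorem IsDual.coe_polar (h : IsDual ℓ ε Ω Ω' P Q) :
    (Ω'.polar ℓ : Set (Hyperplane n)) = Hyperplane.flip ℓ ε '' Ω.charArr ℓ := by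
  ext K
  rw [Finset.mem_coe, h.symm.mem_polar_iff, neg_neg, mem_specFinset, h.spectral.charArr_eq]
  constructor
  · exact fun hK => ⟨_, hK, K.flip_flip ℓ ε⟩
  · rintro ⟨H, hH, rfl⟩
    rwa [H.flip_flip]

omit [FiniteDimensional ℂ V] in
theorem IsDual.charArr_eq (h : IsDual ℓ ε Ω Ω' P Q) :
    Ω'.charArr ℓ = Hyperplane.flip ℓ (-ε) '' (Ω.polar ℓ : Set (Hyperplane n)) := by
  have h' := h.symm.coe_polar
  rw [h', Set.image_image]
  simp [Hyperplane.flip_flip]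

omit [FiniteDimensional ℂ V] in
theorem nontrivial_of_polar_nonempty (hne : (Ω.polar ℓ).Nonempty) : Nontrivial V := by
  obtain ⟨H, hH⟩ := hne
  by_contra hV
  rw [not_nontrivial_iff_subsingleton] at hV
  exact (mem_polar.1 hH).1 (Subsingleton.elim _ _)

theorem IsSpectral.charArr_nonempty [Nontrivial V] (hΩ : Ω.IsSpectral ℓ) :
    (Ω.charArr ℓ).Nonempty := by
  rw [Set.nonempty_iff_ne_empty]
  intro h0
  have hs : Ω.specFinset ℓ = ∅ := by
    rw [Finset.eq_empty_iff_forall_notMem]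
    intro H hH
    have : H ∈ Ω.charArr ℓ := by
      rw [hΩ.charArr_eq]
      exact mem_specFinset.1 hH
    rwa [h0] at this
  have := hΩ.sum_eigProj
  rw [hs, Finset.sum_empty] at this
  exact zero_ne_one this

omit [FiniteDimensional ℂ W] in
theorem IsDual.polar_nonempty (h : IsDual ℓ ε Ω Ω' P Q) (hne : (Ω.polar ℓ).Nonempty) :
    (Ω'.polar ℓ).Nonempty := by
  have := nontrivial_of_polar_nonempty hne
  rw [← Finset.coe_nonempty, h.coe_polar]
  exact h.spectral.charArr_nonempty.image _

/-- The dual forms are the forms that are gauge equivalent to the middle Laplace transform. -/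
theorem gaugeEquiv_signedMiddleLaplace_iff (hΩ : Ω.Admissible ℓ) (hirr : Ω.Irreducible ℓ)
    (hne : (Ω.polar ℓ).Nonempty) :
    (Ω.signedMiddleLaplace ℓ ε).GaugeEquiv Ω' ↔ ∃ P Q, IsDual ℓ ε Ω Ω' P Q :=
  ⟨(isDual_signedMiddleLaplace hΩ hirr hne ε).gauge_right, fun ⟨_, _, h⟩ =>
    (isDual_signedMiddleLaplace hΩ hirr hne ε).gaugeEquiv h⟩

/-- The transforms of opposite signs are inverse to each other: the form itself is a dual of its
middle Laplace transform. -/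
theorem signedMiddleLaplace_neg_gaugeEquiv (hΩ : Ω.Admissible ℓ) (hirr : Ω.Irreducible ℓ)
    (hne : (Ω.polar ℓ).Nonempty) (ε : ℤˣ) :
    ((Ω.signedMiddleLaplace ℓ ε).signedMiddleLaplace ℓ (-ε)).GaugeEquiv Ω := by
  have h := isDual_signedMiddleLaplace hΩ hirr hne ε
  exact (gaugeEquiv_signedMiddleLaplace_iff (h.admissible hΩ) (h.irreducible hirr)
    (h.polar_nonempty hne)).2 ⟨_, _, h.symm⟩

end Duality

/-! ### The bijections between sets of gauge classes -/

section Classes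

variable {n : ℕ} {ℓ : Fin n} {ε : ℤˣ} {T S T' S' : Set (Hyperplane n)}

theorem IrrSystem.polar_nonempty (hT : T.Nonempty) (X : IrrSystem ℓ T S) :
    (X.form.polar ℓ).Nonempty := by
  rwa [← Finset.coe_nonempty, X.polar_eq]

/-- Every irreducible system has a dual with matrix coefficients. -/
theorem IrrSystem.exists_isDual (hT : T.Nonempty) (hT' : T' = Hyperplane.flip ℓ ε '' S)
    (hS' : S' = Hyperplane.flip ℓ (-ε) '' T) (X : IrrSystem ℓ T S) :
    ∃ Y : IrrSystem ℓ T' S', ∃ P Q, IsDual ℓ ε X.form Y.form P Q := by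
  have hne := X.polar_nonempty hT
  have h := isDual_signedMiddleLaplace X.admissible X.irreducible hne ε
  obtain ⟨P, Q, h'⟩ := h.gauge_right
    (gaugeEquiv_transport _ (Module.finBasis ℂ _).equivFun)
  have := nontrivial_of_polar_nonempty (h.polar_nonempty hne)
  exact ⟨⟨_, Module.finrank_pos, _, h'.admissible X.admissible, h'.irreducible X.irreducible,
    by rw [h'.coe_polar, X.charArr_eq, hT'], by rw [h'.charArr_eq, X.polar_eq, hS']⟩, P, Q, h'⟩

/-- The signed middle Laplace transform induces a bijection of sets of gauge classes. -/
theorem exists_bijective_irrClass (hT : T.Nonempty) (hS : S.Nonempty)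
    (hT' : T' = Hyperplane.flip ℓ ε '' S) (hS' : S' = Hyperplane.flip ℓ (-ε) '' T) :
    ∃ Φ : IrrClass ℓ T S → IrrClass ℓ T' S', Function.Bijective Φ ∧
      ∀ X Y, Φ (Quotient.mk _ X) = Quotient.mk _ Y ↔
        (X.form.signedMiddleLaplace ℓ ε).GaugeEquiv Y.form := by
  have hflip : ∀ (η : ℤˣ) (U : Set (Hyperplane n)),
      Hyperplane.flip ℓ η '' (Hyperplane.flip ℓ η '' U) = U := fun η U => by
    rw [Set.image_image]
    simp [Hyperplane.flip_flip]
  choose D hD using fun X : IrrSystem ℓ T S => X.exists_isDual hT hT' hS'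
  have huniq : ∀ (X : IrrSystem ℓ T S) (Y Y' : IrrSystem ℓ T' S'),
      (∃ P Q, IsDual ℓ ε X.form Y.form P Q) → (∃ P Q, IsDual ℓ ε X.form Y'.form P Q) →
      (Quotient.mk _ Y : IrrClass ℓ T' S') = Quotient.mk _ Y' := by
    rintro X Y Y' ⟨_, _, h⟩ ⟨_, _, h'⟩
    exact Quotient.sound (h.gaugeEquiv h')
  have hspec : ∀ (X : IrrSystem ℓ T S) (Y : IrrSystem ℓ T' S'),
      (Quotient.mk _ (D X) : IrrClass ℓ T' S') = Quotient.mk _ Y ↔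
        ∃ P Q, IsDual ℓ ε X.form Y.form P Q := by
    refine fun X Y => ⟨fun h => ?_, huniq X _ _ (hD X)⟩
    obtain ⟨_, _, h'⟩ := hD X
    exact h'.gauge_right (Quotient.exact h)
  refine ⟨Quotient.lift (fun X => Quotient.mk _ (D X)) fun X X' hX => ?_, ⟨?_, ?_⟩, fun X Y => ?_⟩
  · rw [eq_comm, hspec]
    obtain ⟨_, _, h⟩ := hD X
    exact (hspec X' _).1 (huniq X' _ _ (hD X') (h.gauge_left hX))
  · intro X X' h
    induction X using Quotient.inductionOn with | _ X
    induction X' using Quotient.inductionOn with | _ X'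
    obtain ⟨_, _, h1⟩ := (hspec X (D X')).1 h
    obtain ⟨_, _, h2⟩ := hD X'
    exact Quotient.sound (h1.symm.gaugeEquiv h2.symm)
  · intro Y
    induction Y using Quotient.inductionOn with | _ Y
    obtain ⟨X, _, _, h⟩ := Y.exists_isDual (T' := T) (S' := S) (ε := -ε)
      (hT' ▸ hS.image _) (by rw [hS', hflip]) (by rw [hT', neg_neg, hflip])
    have h' := h.symm
    rw [neg_neg] at h'
    exact ⟨Quotient.mk _ X, (hspec X Y).2 ⟨_, _, h'⟩⟩
  · rw [gaugeEquiv_signedMiddleLaplace_iff X.admissible X.irreducible (X.polar_nonempty hT)]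
    exact hspec X Y

end Classes

end PfaffianForm

theorem theorem5 {n : ℕ} (ℓ : Fin n) :
    (∀ (V : Type*) [AddCommGroup V] [Module ℂ V] [FiniteDimensional ℂ V]
        (Ω : PfaffianForm n V),
      Ω.Admissible ℓ → Ω.Irreducible ℓ → (Ω.polar ℓ).Nonempty →
      -- both transforms are well defined, and are again systems of the same class
      ((Ω.laplace ℓ).Preserves (Ω.kerSum ℓ) ∧
        (Ω.invLaplace ℓ).Preserves (Ω.kerSum ℓ) ∧
        (Ω.middleLaplace ℓ).Admissible ℓ ∧
        (Ω.invMiddleLaplace ℓ).Admissible ℓ) ∧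
      -- inversion formulas
      (((Ω.middleLaplace ℓ).invMiddleLaplace ℓ).GaugeEquiv Ω ∧
        ((Ω.invMiddleLaplace ℓ).middleLaplace ℓ).GaugeEquiv Ω) ∧
      -- preservation of irreducibility
      ((Ω.middleLaplace ℓ).Irreducible ℓ ∧ (Ω.invMiddleLaplace ℓ).Irreducible ℓ)) ∧
    -- bijections between sets of gauge classes
    (∀ T S : Set (Hyperplane n), T.Finite → S.Finite → T.Nonempty → S.Nonempty →
      (∀ H ∈ T, H.DependsOn ℓ) → (∀ H ∈ S, H.DependsOn ℓ) →
      (∃ Φ : PfaffianForm.IrrClass ℓ T S →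
          PfaffianForm.IrrClass ℓ S (Hyperplane.flip ℓ (-1) '' T),
        Function.Bijective Φ ∧
        ∀ X Y, Φ (Quotient.mk _ X) = Quotient.mk _ Y ↔
          (X.form.middleLaplace ℓ).GaugeEquiv Y.form) ∧
      (∃ Ψ : PfaffianForm.IrrClass ℓ T S →
          PfaffianForm.IrrClass ℓ (Hyperplane.flip ℓ (-1) '' S) T,
        Function.Bijective Ψ ∧
        ∀ X Y, Ψ (Quotient.mk _ X) = Quotient.mk _ Y ↔
          (X.form.invMiddleLaplace ℓ).GaugeEquiv Y.form)) := by
  refine ⟨fun V _ _ _ Ω hΩ hirr hne => ?_, fun T S _ _ hT hS _ _ => ⟨?_, ?_⟩⟩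
  · have h (ε : ℤˣ) := PfaffianForm.isDual_signedMiddleLaplace hΩ hirr hne ε
    refine ⟨⟨PfaffianForm.signedLaplace_preserves hΩ 1, PfaffianForm.signedLaplace_preserves hΩ (-1),
      (h 1).admissible hΩ, (h (-1)).admissible hΩ⟩,
      ⟨PfaffianForm.signedMiddleLaplace_neg_gaugeEquiv hΩ hirr hne 1, ?_⟩,
      (h 1).irreducible hirr, (h (-1)).irreducible hirr⟩
    simpa using PfaffianForm.signedMiddleLaplace_neg_gaugeEquiv hΩ hirr hne (-1)
  · refine PfaffianForm.exists_bijective_irrClass (ε := 1) hT hS ?_ rfl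
    rw [funext (Hyperplane.flip_one ℓ), Set.image_id']
  · refine PfaffianForm.exists_bijective_irrClass (ε := -1) hT hS rfl ?_
    rw [neg_neg, funext (Hyperplane.flip_one ℓ), Set.image_id']
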